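/- We work either in the smooth category ($\mathbb{K}=\mathbb{R}$) or in the complex-analytic category ($\mathbb{K}=\mathbb{C}$, with holomorphic tangent bundles and holomorphic data). Let $E$ be a vector bundle over a manifold $M$, with typical fibre $F$ (of finite dimension) and structural group a Lie subgroup $G$ of $\mathrm{GL}(F)$; let $P$ be the corresponding frame bundle of $E$. Let $\nabla$ be a connection on $E$ compatible with $G$ (that is, its local connection forms, with respect to local sections of $P$, take values in the Lie algebra $\mathfrak{g}$ of $G$), and let $R$ be its curvature form. Let $\rho:E\to TM$ be a morphism of vector bundles, and let $T$ be the torsion of $\nabla$ with respect to $\rho$, that is, the section of $TM\otimes\Lambda^2E^*$ characterised by $$T(s_1,s_2)=\rho\bigl(\nabla_{\rho s_1}s_2-\nabla_{\rho s_2}s_1\bigr)-[\rho s_1,\rho s_2]$$ for any local sections $s_1,s_2$ of $E$. Let $S$ be a submanifold of a Grassmannian of $F$ on which $G$ acts transitively, let $Z=P\times_GS$ be the associated subbundle of a Grassmannian bundle of $E$, with projection $\pi:Z\to M$, and let $\mathcal{H}\subseteq TZ$ be the connection on $Z$ induced by $\nabla$. A point $p\in Z$ is thus a vector subspace of $E_{\pi(p)}$.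 Suppose that, for any $p\in Z$, the restriction of $\rho$ to $p$ is injective, and let $\mathcal{C}$ be the distribution on $Z$ characterised by $\mathcal{C}\subseteq\mathcal{H}$ and $\mathrm{d}\pi(\mathcal{C}_p)=\rho(p)$ for any $p\in Z$. Then the following assertions are equivalent: (i) $\mathcal{C}$ is integrable (that is, the Lie bracket of any two local sections of $\mathcal{C}$ is a local section of $\mathcal{C}$); (ii) $R\bigl(\Lambda^2(\rho(p))\bigr)(p)\subseteq p$ and $T(\Lambda^2p)\subseteq\rho(p)$, for any $p\in Z$. Consequently, if $T=0$ and $\mathcal{C}$ is integrable then $$R\bigl(\rho(e_1),\rho(e_2)\bigr)e_3+R\bigl(\rho(e_2),\rho(e_3)\bigr)e_1+R\bigl(\rho(e_3),\rho(e_1)\bigr)e_2=0,$$ for any $p\in Z$ and any $e_1,e_2,e_3\in p$. -/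

import Mathlib

open scoped Manifold ContDiff Topology

noncomputable section

/-! ### Structure groups -/

section StructureGroup

variable {𝕜 : Type*} [RCLike 𝕜]
  {EG : Type*} [NormedAddCommGroup EG] [NormedSpace 𝕜 EG]
  {HG : Type*} [TopologicalSpace HG] (IG : ModelWithCorners 𝕜 EG HG)
  {G : Type*} [TopologicalSpace G] [ChartedSpace HG G] [Group G]
  {F : Type*} [NormedAddCommGroup F] [NormedSpace 𝕜 F]

/-- `φ` exhibits the Lie group `G` as a Lie subgroup of the general linear group of `F`: it is an
injective immersive homomorphism. -/
structure IsLinearLieGroup (φ : G →* (F ≃L[𝕜] F)) : Prop where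
  contMDiff : ContMDiff IG 𝓘(𝕜, F →L[𝕜] F) ∞ (fun g : G ↦ (φ g : F →L[𝕜] F))
  injective : Function.Injective φ
  injective_mfderiv : Function.Injective
    (mfderiv IG 𝓘(𝕜, F →L[𝕜] F) (fun g : G ↦ (φ g : F →L[𝕜] F)) 1)

/-- The infinitesimal representation of the Lie algebra `𝔤 = T₁G` on `F`. -/
def lieAlgebraRep (φ : G →* (F ≃L[𝕜] F)) : GroupLieAlgebra IG G →L[𝕜] (F →L[𝕜] F) :=
  mfderiv IG 𝓘(𝕜, F →L[𝕜] F) (fun g : G ↦ (φ g : F →L[𝕜] F)) 1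

variable {ES : Type*} [NormedAddCommGroup ES] [NormedSpace 𝕜 ES]
  {HS : Type*} [TopologicalSpace HS] (IS : ModelWithCorners 𝕜 ES HS)
  {S : Type*} [TopologicalSpace S] [ChartedSpace HS S]

/-- The value at `s` of the fundamental vector field on `S` induced by `A ∈ 𝔤`, that is, the
derivative at `t = 0` of `exp (t A) • s`. -/
def infinitesimalAction [MulAction G S] (s : S) : GroupLieAlgebra IG G →L[𝕜] TangentSpace IS s :=
  mfderiv IG IS (fun g : G ↦ g • s) 1

/-- The subspace of `F` which is the graph of a linear map `a` from `p` to `q`. For `q` a complement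
of `p`, the map `a ↦ graphSubspace a` is (the inverse of) the standard chart of the Grassmannian
of `F` around `p`. -/
def graphSubspace {p q : Submodule 𝕜 F} (a : p →L[𝕜] q) : Submodule 𝕜 F :=
  LinearMap.range (p.subtype + q.subtype ∘ₗ (a : p →ₗ[𝕜] q))

/-- `incl` exhibits the manifold `S` as a submanifold of the Grassmannian of `F`: it is injective
and, in the standard charts of the Grassmannian, it is a smooth immersion. -/
structure IsGrassmannianSubmanifold (incl : S → Submodule 𝕜 F) : Prop where
  injective : Function.Injective incl
  immersion : ∀ s₀ : S, ∃ q : Submodule 𝕜 F, IsCompl (incl s₀) q ∧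
    ∃ a : S → (incl s₀ →L[𝕜] q),
      ContMDiffAt IS 𝓘(𝕜, incl s₀ →L[𝕜] q) ∞ a s₀ ∧
      Function.Injective (mfderiv IS 𝓘(𝕜, incl s₀ →L[𝕜] q) a s₀) ∧
      ∀ᶠ s in 𝓝 s₀, incl s = graphSubspace (a s)

end StructureGroup

/-! ### Vector bundles with structure group `G`, and connections on them -/

section Bundle

variable {𝕜 : Type*} [RCLike 𝕜]
  {EM : Type*} [NormedAddCommGroup EM] [NormedSpace 𝕜 EM]
  {HM : Type*} [TopologicalSpace HM] (IM : ModelWithCorners 𝕜 EM HM)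
  {M : Type*} [TopologicalSpace M] [ChartedSpace HM M]
  {F : Type*} [NormedAddCommGroup F] [NormedSpace 𝕜 F]
  {E : M → Type*} [TopologicalSpace (Bundle.TotalSpace F E)]
  [∀ x, AddCommGroup (E x)] [∀ x, Module 𝕜 (E x)] [∀ x, TopologicalSpace (E x)]
  [∀ x, IsTopologicalAddGroup (E x)] [∀ x, ContinuousSMul 𝕜 (E x)]
  [FiberBundle F E]

/-- A connection is smooth if, on every open set, it maps smooth sections to smooth one-forms.
(The condition is imposed on local sections because, in the complex-analytic category, there may
be few global ones.) -/
def IsSmoothConnection [IsManifold IM 1 M] [VectorBundle 𝕜 F E]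
    (cov : CovariantDerivative IM F E) : Prop :=
  ∀ U : Set M, IsOpen U → ContMDiffCovariantDerivativeOn F ∞ cov.toFun U

/-- The torsion, with respect to `ρ : E → TM`, of a connection on `E`: the tensor field given by
`T(s₁, s₂) = ρ (∇_{ρ s₁} s₂ - ∇_{ρ s₂} s₁) - [ρ s₁, ρ s₂]` for local sections `s₁`, `s₂` of `E`.
Its value on `e₁, e₂ ∈ E x` is computed on smooth local sections extending `e₁`, `e₂`. -/
def anchoredTorsion (cov : CovariantDerivative IM F E) (ρ : ∀ x, E x →L[𝕜] TangentSpace IM x)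
    (x : M) (e₁ e₂ : E x) : TangentSpace IM x :=
  ρ x (cov (FiberBundle.extend F e₂) x (ρ x e₁) - cov (FiberBundle.extend F e₁) x (ρ x e₂))
    - VectorField.mlieBracket IM (fun y ↦ ρ y (FiberBundle.extend F e₁ y))
        (fun y ↦ ρ y (FiberBundle.extend F e₂ y)) x

/-- The curvature of a connection on `E`: the tensor field given by
`R(X, Y) s = ∇_X ∇_Y s - ∇_Y ∇_X s - ∇_{[X, Y]} s`. Its value on `v, w ∈ T_x M` and `e ∈ E x` is
computed on smooth local sections extending `v`, `w`, `e`. -/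
def connectionCurvature [IsManifold IM 1 M] (cov : CovariantDerivative IM F E)
    (x : M) (v w : TangentSpace IM x) (e : E x) : E x :=
  cov (fun y ↦ cov (FiberBundle.extend F e) y
      (FiberBundle.extend (E := (TangentSpace IM : M → Type _)) EM w y)) x v
    - cov (fun y ↦ cov (FiberBundle.extend F e) y
        (FiberBundle.extend (E := (TangentSpace IM : M → Type _)) EM v y)) x w
    - cov (FiberBundle.extend F e) x
        (VectorField.mlieBracket IM
          (FiberBundle.extend (E := (TangentSpace IM : M → Type _)) EM v)
          (FiberBundle.extend (E := (TangentSpace IM : M → Type _)) EM w) x)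

variable {EG : Type*} [NormedAddCommGroup EG] [NormedSpace 𝕜 EG]
  {HG : Type*} [TopologicalSpace HG] (IG : ModelWithCorners 𝕜 EG HG)
  {G : Type*} [TopologicalSpace G] [ChartedSpace HG G] [Group G]

/-- A reduction of the structure group of the vector bundle `E`, with typical fibre `F`, to `G`:
a covering of the base by open sets over which there are smooth frames (that is, smooth local
sections `x ↦ frame i x : F ≃ E x` of the frame bundle), any two of which differ by a smooth
function with values in `G`. (The values of `frame i` and of `transition i j` outside `baseSet i`,
respectively `baseSet i ∩ baseSet j`, are irrelevant.) -/
structure GStructure (E : M → Type*) [TopologicalSpace (Bundle.TotalSpace F E)]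
    [∀ x, AddCommGroup (E x)] [∀ x, Module 𝕜 (E x)] [∀ x, TopologicalSpace (E x)]
    [FiberBundle F E] (φ : G →* (F ≃L[𝕜] F)) (ι : Type*) where
  baseSet : ι → Set M
  isOpen_baseSet : ∀ i, IsOpen (baseSet i)
  indexAt : M → ι
  mem_baseSet_at : ∀ x, x ∈ baseSet (indexAt x)
  frame : ι → ∀ x, F ≃L[𝕜] E x
  contMDiffOn_frame : ∀ i (ξ : F), ContMDiffOn IM (IM.prod 𝓘(𝕜, F)) ∞
    (fun x ↦ Bundle.TotalSpace.mk' F x (frame i x ξ)) (baseSet i)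
  transition : ι → ι → M → G
  contMDiffOn_transition : ∀ i j,
    ContMDiffOn IM IG ∞ (transition i j) (baseSet i ∩ baseSet j)
  frame_transition : ∀ i j, ∀ x ∈ baseSet i ∩ baseSet j, ∀ ξ : F,
    frame j x (φ (transition i j x) ξ) = frame i x ξ

namespace GStructure

variable {IM IG} {φ : G →* (F ≃L[𝕜] F)} {ι : Type*} (P : GStructure IM IG E φ ι)

/-- The local connection form `Γ` of a connection with respect to the frame `u = frame i`: it is
characterised by `∇_v (u ξ) = u (Γ(v) ξ)`, for `ξ ∈ F`. -/
def connectionForm (cov : CovariantDerivative IM F E) (i : ι) (x : M) (v : TangentSpace IM x)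
    (ξ : F) : F :=
  (P.frame i x).symm (cov (fun y ↦ P.frame i y ξ) x v)

/-- The connection is compatible with the structure group `G`: its local connection forms take
values in the Lie algebra of `G`. -/
def IsCompatible (cov : CovariantDerivative IM F E) : Prop :=
  ∀ i, ∀ x ∈ P.baseSet i, ∀ v : TangentSpace IM x, ∃ A : GroupLieAlgebra IG G,
    ∀ ξ : F, lieAlgebraRep IG φ A ξ = P.connectionForm cov i x v ξ

end GStructure

end Bundle

/-! ### The associated bundle `Z = P ×_G S` -/

section OrbitBundle

variable {𝕜 : Type*} [RCLike 𝕜]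
  {EM : Type*} [NormedAddCommGroup EM] [NormedSpace 𝕜 EM]
  {HM : Type*} [TopologicalSpace HM] {IM : ModelWithCorners 𝕜 EM HM}
  {M : Type*} [TopologicalSpace M] [ChartedSpace HM M]
  {F : Type*} [NormedAddCommGroup F] [NormedSpace 𝕜 F]
  {E : M → Type*} [TopologicalSpace (Bundle.TotalSpace F E)]
  [∀ x, AddCommGroup (E x)] [∀ x, Module 𝕜 (E x)] [∀ x, TopologicalSpace (E x)]
  [FiberBundle F E]
  {EG : Type*} [NormedAddCommGroup EG] [NormedSpace 𝕜 EG]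
  {HG : Type*} [TopologicalSpace HG] {IG : ModelWithCorners 𝕜 EG HG}
  {G : Type*} [TopologicalSpace G] [ChartedSpace HG G] [Group G]
  {φ : G →* (F ≃L[𝕜] F)} {ι : Type*}

lemma GStructure.transition_self (P : GStructure IM IG E φ ι) (hφ : Function.Injective φ) {i : ι} {x : M} (hx : x ∈ P.baseSet i) :
    P.transition i i x = 1 := by
  apply hφ
  ext ξ
  apply (P.frame i x).injective
  rw [map_one]
  exact P.frame_transition i i x ⟨hx, hx⟩ ξ

lemma GStructure.transition_mul (P : GStructure IM IG E φ ι) (hφ : Function.Injective φ) {i j k : ι} {x : M} (hi : x ∈ P.baseSet i)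
    (hj : x ∈ P.baseSet j) (hk : x ∈ P.baseSet k) :
    P.transition j k x * P.transition i j x = P.transition i k x := by
  apply hφ
  ext ξ
  apply (P.frame k x).injective
  rw [P.frame_transition i k x ⟨hi, hk⟩, map_mul]
  exact (P.frame_transition j k x ⟨hj, hk⟩ _).trans (P.frame_transition i j x ⟨hi, hj⟩ ξ)

variable {ES : Type*} [NormedAddCommGroup ES] [NormedSpace 𝕜 ES]
  {HS : Type*} [TopologicalSpace HS] (IS : ModelWithCorners 𝕜 ES HS)
  (S : Type*) [TopologicalSpace S] [ChartedSpace HS S] [MulAction G S]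
  [ContMDiffSMul IG IS ∞ G S]

/-- The cocycle data of the bundle with fibre `S` associated to a `G`-structure: in the
trivialization given by a frame `u`, the pair `(x, s)` corresponds to the class of `(u x, s)`
in `P ×_G S`. -/
def GStructure.fiberBundleCore (P : GStructure IM IG E φ ι) (hφ : IsLinearLieGroup IG φ) :
    FiberBundleCore ι M S where
  baseSet := P.baseSet
  isOpen_baseSet := P.isOpen_baseSet
  indexAt := P.indexAt
  mem_baseSet_at := P.mem_baseSet_at
  coordChange i j x s := P.transition i j x • s
  coordChange_self i x hx s := by rw [P.transition_self hφ.injective hx, one_smul]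
  continuousOn_coordChange i j := by
    have : ContinuousSMul G S := ContMDiffSMul.continuousSMul (I := IG) (I' := IS) ∞
    exact ((P.contMDiffOn_transition i j).continuousOn.comp continuousOn_fst
      (fun p hp ↦ hp.1)).smul continuousOn_snd
  coordChange_comp i j k x hx s := by
    rw [smul_smul, P.transition_mul hφ.injective hx.1.1 hx.1.2 hx.2]

/-- The total space of the bundle `Z = P ×_G S`. -/
def OrbitBundle (P : GStructure IM IG E φ ι) (hφ : IsLinearLieGroup IG φ) : Type _ :=
  (P.fiberBundleCore IS S hφ).TotalSpace

namespace OrbitBundle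

variable {IS S} {P : GStructure IM IG E φ ι} {hφ : IsLinearLieGroup IG φ}

instance : TopologicalSpace (OrbitBundle IS S P hφ) :=
  inferInstanceAs (TopologicalSpace (P.fiberBundleCore IS S hφ).TotalSpace)

/-- The charts of `Z` are the local trivializations followed by products of charts of the base and
of the fibre. -/
instance : ChartedSpace (ModelProd HM HS) (OrbitBundle IS S P hφ) :=
  @ChartedSpace.comp (ModelProd HM HS) _ (M × S) _ (OrbitBundle IS S P hφ) _ _
    (inferInstanceAs (ChartedSpace (M × S) (P.fiberBundleCore IS S hφ).TotalSpace))

/-- The projection of `Z` onto `M`. -/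
def proj (z : OrbitBundle IS S P hφ) : M :=
  Bundle.TotalSpace.proj (F := S) (E := (P.fiberBundleCore IS S hφ).Fiber) z

/-- The component in `S` of a point of `Z`, with respect to the trivialization of `Z` given by
`frame i`. -/
def coord (i : ι) (z : OrbitBundle IS S P hφ) : S :=
  ((P.fiberBundleCore IS S hφ).localTriv i z).2

/-- The transition functions between charts of `Z` are smooth. -/
instance [IsManifold IM ∞ M] [IsManifold IS ∞ S] :
    IsManifold (IM.prod IS) ∞ (OrbitBundle IS S P hφ) := by
  apply isManifold_of_contDiffOn
  rintro _ _ ⟨_, ⟨_, ⟨i, rfl⟩, rfl⟩, c, hc, rfl⟩ ⟨_, ⟨_, ⟨j, rfl⟩, rfl⟩, c', hc', rfl⟩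
  set e := ((P.fiberBundleCore IS S hφ).localTriv i).toOpenPartialHomeomorph
  set e' := ((P.fiberBundleCore IS S hφ).localTriv j).toOpenPartialHomeomorph
  have h1 : ContMDiffOn (IM.prod IS) (IM.prod IS) ∞ c.symm c.target :=
    contMDiffOn_symm_of_mem_maximalAtlas (IsManifold.subset_maximalAtlas hc)
  have h3 : ContMDiffOn (IM.prod IS) (IM.prod IS) ∞ c' c'.source :=
    contMDiffOn_of_mem_maximalAtlas (IsManifold.subset_maximalAtlas hc')
  have hsource : ∀ p ∈ (e.symm ≫ₕ e').source, p.1 ∈ P.baseSet i ∩ P.baseSet j := by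
    intro p hp
    have hp' : p.1 ∈ ((P.fiberBundleCore IS S hφ).localTriv i).baseSet ∧
        p.1 ∈ ((P.fiberBundleCore IS S hφ).localTriv j).baseSet := by simpa [e, e'] using hp
    exact hp'
  have h2 : ContMDiffOn (IM.prod IS) (IM.prod IS) ∞ (e.symm ≫ₕ e') (e.symm ≫ₕ e').source := by
    have h4 : ContMDiffOn (IM.prod IS) (IM.prod IS) ∞
        (fun p : M × S ↦ (p.1, P.transition i j p.1 • p.2)) (e.symm ≫ₕ e').source := by
      refine contMDiffOn_fst.prodMk ?_
      have h5 : ContMDiffOn (IM.prod IS) (IG.prod IS) ∞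
          (fun p : M × S ↦ (P.transition i j p.1, p.2)) (e.symm ≫ₕ e').source :=
        ((P.contMDiffOn_transition i j).comp contMDiffOn_fst hsource).prodMk contMDiffOn_snd
      exact (contMDiff_smul (I := IG) (I' := IS) (n := ∞) (G := G) (M := S)).comp_contMDiffOn h5
    refine h4.congr fun p hp ↦ ?_
    have hp' := hsource p hp
    have h6 : (e.symm ≫ₕ e') p = (p.1, (P.fiberBundleCore IS S hφ).coordChange
        (P.indexAt p.1) j p.1 ((P.fiberBundleCore IS S hφ).coordChange i (P.indexAt p.1) p.1 p.2)) :=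
      rfl
    rw [h6, (P.fiberBundleCore IS S hφ).coordChange_comp i (P.indexAt p.1) j p.1
      ⟨⟨hp'.1, P.mem_baseSet_at p.1⟩, hp'.2⟩]
    rfl
  have key : ContMDiffOn (IM.prod IS) (IM.prod IS) ∞ (c' ∘ (e.symm ≫ₕ e') ∘ c.symm)
      (c.symm ≫ₕ (e.symm ≫ₕ e') ≫ₕ c').source := by
    refine h3.comp (h2.comp (h1.mono ?_) ?_) ?_ <;> intro x hx <;>
      simp only [mfld_simps] at hx ⊢ <;> tauto
  rw [← contMDiffOn_iff_contDiffOn]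
  refine (IM.prod IS).contMDiff.comp_contMDiffOn
    (key.comp ((IM.prod IS).contMDiffOn_symm.mono Set.inter_subset_right) ?_)
  intro x hx
  have hx' : (IM.prod IS).symm x ∈ ((e ≫ₕ c).symm ≫ₕ (e' ≫ₕ c')).source := hx.1
  simp only [mfld_simps] at hx' ⊢
  tauto

/-- The subspace of the fibre of `E` which a point of `Z` is: in the frame `u` at `x`, the class of
`(u, s)` is the subspace `u s` of `E x`. -/
def subspace (incl : S → Submodule 𝕜 F) (z : OrbitBundle IS S P hφ) : Submodule 𝕜 (E z.proj) :=
  (incl (z.coord (P.indexAt z.proj))).map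
    ((P.frame (P.indexAt z.proj) z.proj : F →L[𝕜] E z.proj) : F →ₗ[𝕜] E z.proj)

/-- The subspace of the fibre of `E` associated to a point of `Z` can be computed in any frame. -/
lemma subspace_eq {incl : S → Submodule 𝕜 F}
    (hsmul : ∀ (g : G) (s : S),
      incl (g • s) = (incl s).map ((φ g : F →L[𝕜] F) : F →ₗ[𝕜] F))
    (z : OrbitBundle IS S P hφ) {i : ι} (hi : z.proj ∈ P.baseSet i) :
    z.subspace incl = (incl (z.coord i)).map
      ((P.frame i z.proj : F →L[𝕜] E z.proj) : F →ₗ[𝕜] E z.proj) := by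
  have h : ∀ j, z.coord j = P.transition (P.indexAt z.proj) j z.proj • (show S from z.2) :=
    fun _ ↦ rfl
  have hx := P.mem_baseSet_at z.proj
  rw [subspace, h, h, P.transition_self hφ.injective hx, one_smul, hsmul, ← Submodule.map_comp]
  congr 1
  ext ξ
  exact (P.frame_transition _ i z.proj ⟨hx, hi⟩ ξ).symm

variable [∀ x, IsTopologicalAddGroup (E x)] [∀ x, ContinuousSMul 𝕜 (E x)]

/-- The connection `ℋ ⊆ TZ` induced on `Z` by a connection on `E` compatible with `G`: in the
trivialization of `Z` given by a frame with local connection form `Γ`, it is formed of the vectors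
`(v, -(Γ(v) s))` tangent at `(x, s)`, where `Γ(v) ∈ 𝔤` acts on `S` by the fundamental vector
field. -/
def horizontal (cov : CovariantDerivative IM F E) (z : OrbitBundle IS S P hφ) :
    Submodule 𝕜 (TangentSpace (IM.prod IS) z) where
  carrier := {w | ∀ i, z.proj ∈ P.baseSet i → ∃ A : GroupLieAlgebra IG G,
    (∀ ξ : F, lieAlgebraRep IG φ A ξ =
      P.connectionForm cov i z.proj (mfderiv (IM.prod IS) IM proj z w) ξ) ∧
    mfderiv (IM.prod IS) IS (coord i) z w = -infinitesimalAction IG IS (z.coord i) A}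
  zero_mem' i _ := ⟨0, by simp [GStructure.connectionForm], by simp⟩
  add_mem' {w w'} hw hw' i hi := by
    obtain ⟨A, h1, h2⟩ := hw i hi
    obtain ⟨A', h1', h2'⟩ := hw' i hi
    refine ⟨A + A', fun ξ ↦ ?_, ?_⟩
    · simp only [map_add, add_apply, h1, h1', GStructure.connectionForm]
    · simp only [map_add, h2, h2', neg_add]
  smul_mem' c w hw i hi := by
    obtain ⟨A, h1, h2⟩ := hw i hi
    refine ⟨c • A, fun ξ ↦ ?_, ?_⟩
    · simp only [map_smul, smul_apply, h1, GStructure.connectionForm]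
    · simp only [map_smul, h2, smul_neg]

/-- The distribution `𝒞` on `Z`: it is formed of the horizontal vectors at `p ∈ Z` which project
into `ρ(p)`. -/
def distribution (cov : CovariantDerivative IM F E) (ρ : ∀ x, E x →L[𝕜] TangentSpace IM x)
    (incl : S → Submodule 𝕜 F) (z : OrbitBundle IS S P hφ) :
    Submodule 𝕜 (TangentSpace (IM.prod IS) z) :=
  z.horizontal cov ⊓
    ((z.subspace incl).map (ρ z.proj : E z.proj →ₗ[𝕜] TangentSpace IM z.proj)).comap
      (mfderiv (IM.prod IS) IM proj z :
        TangentSpace (IM.prod IS) z →ₗ[𝕜] TangentSpace IM z.proj)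

end OrbitBundle

end OrbitBundle

/-! ### Integrable distributions -/

/-- A distribution `D` on a manifold is integrable if the Lie bracket of any two local sections
of `D` is a local section of `D`. -/
def IsIntegrableDistribution {𝕜 : Type*} [RCLike 𝕜]
    {EN : Type*} [NormedAddCommGroup EN] [NormedSpace 𝕜 EN]
    {HN : Type*} [TopologicalSpace HN] (J : ModelWithCorners 𝕜 EN HN)
    {N : Type*} [TopologicalSpace N] [ChartedSpace HN N] [IsManifold J 1 N]
    (D : ∀ z : N, Submodule 𝕜 (TangentSpace J z)) : Prop :=
  ∀ U : Set N, IsOpen U → ∀ X Y : ∀ z : N, TangentSpace J z,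
    ContMDiffOn J J.tangent ∞ (fun z ↦ (⟨z, X z⟩ : TangentBundle J N)) U →
    ContMDiffOn J J.tangent ∞ (fun z ↦ (⟨z, Y z⟩ : TangentBundle J N)) U →
    (∀ z ∈ U, X z ∈ D z) → (∀ z ∈ U, Y z ∈ D z) →
    ∀ z ∈ U, VectorField.mlieBracket J X Y z ∈ D z

end

/-! The tautological bundle over `Z` has fibre `p` at the point `p`, and lies in the pull-back of
`E`. Write `D` for the pulled-back connection. The proof rests on a description of `ℋ`: a vector `W`
is horizontal exactly when `D_W` sends sections of the tautological bundle to values in it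
(`IsHorizontalIn.mem_incl` and `isHorizontalIn_of_forall_mem`). In a frame of `P`, a tautological
section is a function `g : Z → F` with `g y ∈ incl (y.coord i)`, and `D_W g = dg(W) + Γ(dπ W) g` is
`covAlong`.

For sections `X`, `Y` of `𝒞`, whether `[X, Y]` lies in `𝒞` splits into two questions.

Horizontality: `D_X D_Y g - D_Y D_X g - D_[X,Y] g = R(dπ X, dπ Y) g` (`covAlong_commutator`). For
tautological `g` the first two terms are in `p`, so `D_[X,Y] g` is in `p` if and only if the
curvature term is. This gives the condition on `R`.

Projection: near a point, `dπ X = ρ e` and `dπ Y = ρ f` with `e`, `f` tautological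
(`exists_tautological_lift`, where the injectivity of `ρ` on `p` enters), and `dπ [X, Y] = ρ (D_X f
- D_Y e) - T(e, f)` (`mvfderiv_mlieBracket_eq_sub_torsionOf`). The first term is in `ρ(p)`, so `dπ
[X, Y]` is in `ρ(p)` if and only if `T(e, f)` is. This gives the condition on `T`.

Thus (ii) implies (i). The converse also needs sections of `𝒞` with prescribed projection at a point
(`exists_section_distribution`); they are horizontal lifts.

For the last claim, `T = 0` and the Jacobi identity for the fields `ρ s` give the Bianchi identity
after applying `ρ` (`anchor_cyclic_curvature_eq_zero`). By (ii) the cyclic sum of curvatures is in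
`p`, where `ρ` is injective, so the sum itself vanishes. -/

set_option linter.unusedSectionVars false

/-! ### Lie brackets, and connection forms pulled back along a map. -/

section Calculus

variable {𝕜 : Type*} [RCLike 𝕜]
  {EN : Type*} [NormedAddCommGroup EN] [NormedSpace 𝕜 EN]
  {HN : Type*} [TopologicalSpace HN] {J : ModelWithCorners 𝕜 EN HN}
  {N : Type*} [TopologicalSpace N] [ChartedSpace HN N]
  {V : Type*} [NormedAddCommGroup V] [NormedSpace 𝕜 V]
  {V' : Type*} [NormedAddCommGroup V'] [NormedSpace 𝕜 V']

lemma mvfderiv_congr {h h' : N → V} {z : N} (H : h =ᶠ[𝓝 z] h') :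
    mvfderiv J h z = mvfderiv J h' z := by
  ext W
  have h0 : h z = h' z := H.self_of_nhds
  simp only [mvfderiv]
  have := H.mfderiv_eq (I := J) (I' := 𝓘(𝕜, V))
  exact congrArg (fun L : EN →L[𝕜] V => L W) this

lemma mvfderiv_comp_apply_vec {EM : Type*} [NormedAddCommGroup EM] [NormedSpace 𝕜 EM]
    {HM : Type*} [TopologicalSpace HM] {I : ModelWithCorners 𝕜 EM HM}
    {M : Type*} [TopologicalSpace M] [ChartedSpace HM M] {g : M → V} {f : N → M} {z : N}
    (hg : MDifferentiableAt I 𝓘(𝕜, V) g (f z)) (hf : MDifferentiableAt J I f z)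
    (W : TangentSpace J z) :
    mvfderiv J (fun y ↦ g (f y)) z W = mvfderiv I g (f z) (mfderiv J I f z W) :=
  congrArg (fun L : EN →L[𝕜] V => L W) (mfderiv_comp z hg hf)

lemma mvfderiv_eq_fderiv {h : EN → V} {ζ : EN} :
    mvfderiv 𝓘(𝕜, EN) h ζ = fderiv 𝕜 h ζ := by
  ext W
  exact congrArg (fun L : EN →L[𝕜] V => L W) mfderiv_eq_fderiv

lemma mvfderiv_clm_apply {A : N → V →L[𝕜] V'} {b : N → V} {z : N}
    (hA : MDifferentiableAt J 𝓘(𝕜, V →L[𝕜] V') A z) (hb : MDifferentiableAt J 𝓘(𝕜, V) b z)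
    (W : TangentSpace J z) :
    mvfderiv J (fun y ↦ A y (b y)) z W
      = mvfderiv J A z W (b z) + A z (mvfderiv J b z W) := by
  have hu : UniqueDiffWithinAt 𝕜 (Set.range J) (extChartAt J z z) :=
    J.uniqueDiffOn _ (Set.mem_range_self _)
  have h := (hA.hasMFDerivAt.2.clm_apply hb.hasMFDerivAt.2).fderivWithin hu
  have hz : (extChartAt J z).symm (extChartAt J z z) = z := extChartAt_to_inv z
  rw [(hA.clm_apply hb).mvfderiv]
  refine (congrArg (fun L : EN →L[𝕜] V' => L W) h).trans ?_
  simp only [writtenInExtChartAt, extChartAt_model_space_eq_id, PartialEquiv.refl_coe, Function.comp_apply, hz, id]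
  exact add_comm _ _

lemma mdifferentiableAt_mvfderiv_apply [IsManifold J 1 N] {h : N → V} {z : N} {Y : ∀ z : N, TangentSpace J z}
   (hh : ContMDiffAt J 𝓘(𝕜, V) 2 h z)
   (hY : MDifferentiableAt J J.tangent (fun y ↦ (⟨y, Y y⟩ : TangentBundle J N)) z) :
   MDifferentiableAt J 𝓘(𝕜, V) (fun y ↦ mvfderiv J h y (Y y)) z := by
  have h1 := (hh.mfderiv_const (m := 1) (by norm_num [one_add_one_eq_two])).mdifferentiableAt one_ne_zero
  have h2 := MDifferentiableAt.clm_apply_of_inCoordinates h1 hY (hh.mdifferentiableAt two_ne_zero)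
  exact ((contMDiff_snd_tangentBundle_modelSpace V 𝓘(𝕜, V) (n := 1)).contMDiffAt.mdifferentiableAt one_ne_zero).comp _ h2

/-- The Lie bracket on a manifold is defined by pulling fields back to a chart, so derivatives along
a field have to be read there as well. The pull-back inverts the derivative of the inverse chart,
and the chain rule cancels this inverse. -/
lemma fderiv_comp_extChartAt_symm_apply_mpullback [J.Boundaryless] [IsManifold J 1 N]
    {h : N → V} {z : N} (Y : ∀ z : N, TangentSpace J z) {ζ : EN} (hζ : ζ ∈ (extChartAt J z).target)
    (hh : MDifferentiableAt J 𝓘(𝕜, V) h ((extChartAt J z).symm ζ)) :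
    fderiv 𝕜 (h ∘ (extChartAt J z).symm) ζ
        (VectorField.mpullbackWithin 𝓘(𝕜, EN) J (extChartAt J z).symm Y (Set.range J) ζ)
      = mvfderiv J h ((extChartAt J z).symm ζ) (Y ((extChartAt J z).symm ζ)) := by
  have hr : Set.range J = Set.univ := J.range_eq_univ
  have h1 : MDifferentiableAt 𝓘(𝕜, EN) J (extChartAt J z).symm ζ := by
    have := mdifferentiableWithinAt_extChartAt_symm (I := J) (x := z) hζ
    rwa [hr, mdifferentiableWithinAt_univ] at this
  have hinv := isInvertible_mfderivWithin_extChartAt_symm (I := J) (x := z) hζ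
  rw [hr, mfderivWithin_univ] at hinv
  set w : EN :=
    VectorField.mpullbackWithin 𝓘(𝕜, EN) J (extChartAt J z).symm Y (Set.range J) ζ with hw
  have hw' : mfderiv 𝓘(𝕜, EN) J (extChartAt J z).symm ζ w = Y ((extChartAt J z).symm ζ) := by
    simp only [hw, VectorField.mpullbackWithin_apply, hr, mfderivWithin_univ]
    exact hinv.self_apply_inverse _
  rw [← hw', ← mvfderiv_comp_apply_vec hh h1, mvfderiv_eq_fderiv]
  rfl

/-- The identity `[X, Y] h = X (Y h) - Y (X h)`. In the chart, `X (Y h)` is a second derivative of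
`h` at `(X, Y)` plus `dh(dY(X))`; the symmetric second derivatives cancel and the rest is `dh` of
the bracket. It is stated for vector-valued `h` so that it applies to chart coordinates, as well as
to `F`-valued functions. -/
lemma mvfderiv_mlieBracket [J.Boundaryless] [IsManifold J ∞ N] [CompleteSpace EN]
    {h : N → V} {z : N} {X Y : ∀ z : N, TangentSpace J z}
    (hh : ContMDiffAt J 𝓘(𝕜, V) 2 h z)
    (hX : MDifferentiableAt J J.tangent (fun y ↦ (⟨y, X y⟩ : TangentBundle J N)) z)
    (hY : MDifferentiableAt J J.tangent (fun y ↦ (⟨y, Y y⟩ : TangentBundle J N)) z) :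
    mvfderiv J h z (VectorField.mlieBracket J X Y z)
      = mvfderiv J (fun y ↦ mvfderiv J h y (Y y)) z (X z)
        - mvfderiv J (fun y ↦ mvfderiv J h y (X y)) z (Y z) := by
  have i1 : IsManifold J 1 N := inferInstance
  have i2 : IsManifold J 2 N := inferInstance
  have hr : Set.range J = Set.univ := J.range_eq_univ
  set φ := extChartAt J z with hφ
  set ĥ : EN → V := h ∘ φ.symm with hĥ
  set pb : (∀ z : N, TangentSpace J z) → EN → EN := fun X ↦
    VectorField.mpullbackWithin 𝓘(𝕜, EN) J φ.symm X (Set.range J) with hpb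
  have hsymm : ContMDiffAt 𝓘(𝕜, EN) J 2 φ.symm (φ z) := by
    have := contMDiffWithinAt_extChartAt_symm_range_self (I := J) (n := 2) z
    rwa [hr, contMDiffWithinAt_univ] at this
  have hz : φ.symm (φ z) = z := extChartAt_to_inv z
  have hh2 : ContDiffAt 𝕜 2 ĥ (φ z) := by
    rw [← contMDiffAt_iff_contDiffAt]
    exact ContMDiffAt.comp (φ z) (by rwa [hz]) hsymm
  -- the derivative of `h` along a vector field, read in the chart
  have key : ∀ Z : (∀ z : N, TangentSpace J z),
      (fun y ↦ mvfderiv J h y (Z y)) ∘ φ.symm =ᶠ[𝓝 (φ z)] fun ζ ↦ fderiv 𝕜 ĥ ζ (pb Z ζ) := by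
    intro Z
    have e1 : ∀ᶠ y in 𝓝 z, MDifferentiableAt J 𝓘(𝕜, V) h y := by
      filter_upwards [(contMDiffAt_iff_contMDiffAt_nhds (by simp)).1 hh] with y hy using hy.mdifferentiableAt two_ne_zero
    have e2 : ∀ᶠ ζ in 𝓝 (φ z), MDifferentiableAt J 𝓘(𝕜, V) h (φ.symm ζ) :=
      hsymm.continuousAt.eventually (by rwa [hz])
    filter_upwards [e2, extChartAt_target_mem_nhds (I := J) z] with ζ h1 h2
    exact (fderiv_comp_extChartAt_symm_apply_mpullback Z h2 h1).symm
  have hpbd : ∀ Z : (∀ z : N, TangentSpace J z),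
      MDifferentiableAt J J.tangent (fun y ↦ (⟨y, Z y⟩ : TangentBundle J N)) z →
      DifferentiableAt 𝕜 (pb Z) (φ z) := by
    intro Z hZ
    rw [← mdifferentiableWithinAt_univ] at hZ
    have := hZ.differentiableWithinAt_mpullbackWithin_vectorField
    rw [Set.preimage_univ, Set.univ_inter, hr] at this
    simp only [hpb, hr]
    exact differentiableWithinAt_univ.1 this
  have hpbz : ∀ Z : (∀ z : N, TangentSpace J z), pb Z (φ z) = Z z := by
    intro Z
    have := mfderivWithin_extChartAt_symm_inverse_apply (I := J) (Z z)
    simp only [hpb, VectorField.mpullbackWithin_apply]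
    -- At its own centre a chart has the identity as derivative, so the pulled-back field takes the
    -- same value there.
    rw [mfderivWithin_range_extChartAt_symm]
    have := ContinuousLinearMap.inverse_id (R := 𝕜) (M := EN)
    refine (congrArg (fun L : EN →L[𝕜] EN => L (Z (φ.symm (φ z)))) this).trans ?_
    have aux : ∀ y, y = z → (Z y : EN) = Z z := by rintro _ rfl; rfl
    exact aux _ hz
  have hd : DifferentiableAt 𝕜 (fderiv 𝕜 ĥ) (φ z) :=
    (hh2.fderiv_right (m := 1) (by norm_num [one_add_one_eq_two])).differentiableAt one_ne_zero
  have hder : ∀ Z W : (∀ z : N, TangentSpace J z),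
      MDifferentiableAt J J.tangent (fun y ↦ (⟨y, Z y⟩ : TangentBundle J N)) z →
      mvfderiv J (fun y ↦ mvfderiv J h y (Z y)) z (W z)
        = fderiv 𝕜 (fderiv 𝕜 ĥ) (φ z) (W z) (Z z) + fderiv 𝕜 ĥ (φ z) (fderiv 𝕜 (pb Z) (φ z) (W z)) := by
    intro Z W hZ
    have h1 := (mdifferentiableAt_mvfderiv_apply hh hZ).mvfderiv
    rw [h1, hr, fderivWithin_univ]
    have h2 := (key Z).fderiv_eq (𝕜 := 𝕜)
    refine (congrArg (fun L : EN →L[𝕜] V => L (W z)) h2).trans ?_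
    have h3 := (hd.hasFDerivAt.clm_apply (hpbd Z hZ).hasFDerivAt).fderiv
    refine (congrArg (fun L : EN →L[𝕜] V => L (W z)) h3).trans ?_
    simp only [hpbz]
    exact add_comm _ _
  have hsym : IsSymmSndFDerivAt 𝕜 ĥ (φ z) := hh2.isSymmSndFDerivAt (by simp)
  rw [hder Y X hY, hder X Y hX, hsym.eq (X z) (Y z)]
  have hbr : VectorField.mlieBracket J X Y z = VectorField.lieBracket 𝕜 (pb X) (pb Y) (φ z) := by
    rw [← VectorField.mlieBracketWithin_univ, VectorField.mlieBracketWithin_apply,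
      mfderiv_extChartAt_self]
    have := ContinuousLinearMap.inverse_id (R := 𝕜) (M := EN)
    refine (congrArg (fun L : EN →L[𝕜] EN => L _) this).trans ?_
    simp only [Set.preimage_univ, Set.univ_inter, hr, hpb]
    exact congrFun VectorField.lieBracketWithin_univ _
  rw [hbr, (hh.mdifferentiableAt two_ne_zero).mvfderiv, hr, fderivWithin_univ, VectorField.lieBracket, hpbz, hpbz]
  refine (map_sub _ _ _).trans ?_
  rw [add_sub_add_left_eq_sub]
  rfl

variable {B : Type*} [NormedAddCommGroup B] [NormedSpace 𝕜 B]
  {F : Type*} [NormedAddCommGroup F] [NormedSpace 𝕜 F]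

/-- The derivative along `W` of an `F`-valued function `g`, with respect to the connection on the
trivial bundle with fibre `F` whose connection form is the pull-back along `q` of `G`. -/
noncomputable def covAlong (J : ModelWithCorners 𝕜 EN HN) (q : N → B) (G : N → B →L[𝕜] F →L[𝕜] F) (g : N → F)
    (z : N) (W : TangentSpace J z) : F :=
  mvfderiv J g z W + G z (mvfderiv J q z W) (g z)

/-- The curvature of a connection form with value `Γ` and derivative `D` at a point. -/
noncomputable def curvatureOf (D : B →L[𝕜] B →L[𝕜] F →L[𝕜] F) (Γ : B →L[𝕜] F →L[𝕜] F) (a b : B) (ξ : F) : F :=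
  D a b ξ - D b a ξ + (Γ a (Γ b ξ) - Γ b (Γ a ξ))

/-- The torsion of a connection form with value `Γ` at a point with respect to a map into
the tangent bundle, with value `r` and derivative `D` at this point. -/
noncomputable def torsionOf (D : B →L[𝕜] F →L[𝕜] B) (r : F →L[𝕜] B) (Γ : B →L[𝕜] F →L[𝕜] F) (e f : F) : B :=
  r (Γ (r e) f - Γ (r f) e) - (D (r e) f - D (r f) e)

section Smooth

variable [IsManifold J 1 N] {q : N → B} {G : N → B →L[𝕜] F →L[𝕜] F} {g : N → F} {z : N}
  {Y : ∀ z : N, TangentSpace J z}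

lemma mdifferentiableAt_covAlong (hq : ContMDiffAt J 𝓘(𝕜, B) 2 q z)
    (hG : MDifferentiableAt J 𝓘(𝕜, B →L[𝕜] F →L[𝕜] F) G z) (hg : ContMDiffAt J 𝓘(𝕜, F) 2 g z)
    (hY : MDifferentiableAt J J.tangent (fun y ↦ (⟨y, Y y⟩ : TangentBundle J N)) z) :
    MDifferentiableAt J 𝓘(𝕜, F) (fun y ↦ covAlong J q G g y (Y y)) z :=
  (mdifferentiableAt_mvfderiv_apply hg hY).add
    ((hG.clm_apply (mdifferentiableAt_mvfderiv_apply hq hY)).clm_apply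
      (hg.mdifferentiableAt two_ne_zero))

lemma mvfderiv_covAlong (hq : ContMDiffAt J 𝓘(𝕜, B) 2 q z)
    (hG : MDifferentiableAt J 𝓘(𝕜, B →L[𝕜] F →L[𝕜] F) G z) (hg : ContMDiffAt J 𝓘(𝕜, F) 2 g z)
    (hY : MDifferentiableAt J J.tangent (fun y ↦ (⟨y, Y y⟩ : TangentBundle J N)) z)
    (W : TangentSpace J z) :
    mvfderiv J (fun y ↦ covAlong J q G g y (Y y)) z W =
      mvfderiv J (fun y ↦ mvfderiv J g y (Y y)) z W
        + (mvfderiv J G z W (mvfderiv J q z (Y z)) (g z)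
          + G z (mvfderiv J (fun y ↦ mvfderiv J q y (Y y)) z W) (g z)
          + G z (mvfderiv J q z (Y z)) (mvfderiv J g z W)) := by
  have h1 := mdifferentiableAt_mvfderiv_apply hg hY
  have h2 := mdifferentiableAt_mvfderiv_apply hq hY
  have h3 := hG.clm_apply h2
  have h4 := hg.mdifferentiableAt two_ne_zero
  simp only [covAlong]
  rw [mvfderiv_fun_add h1 (h3.clm_apply h4), add_apply, mvfderiv_clm_apply h3 h4,
    mvfderiv_clm_apply hG h2, add_apply]

end Smooth

variable [J.Boundaryless] [IsManifold J ∞ N] [CompleteSpace EN] {q : N → B} {z : N}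
  {X Y : ∀ z : N, TangentSpace J z}

/-- Expand both iterated derivatives. The second derivatives of `g` and of `q` are absorbed by the
bracket, and the mixed terms `Γ(dq Y) (X g) + Γ(dq X) (Y g)` are symmetric in `X`, `Y`. What
survives is the antisymmetrised derivative of the form and the commutator of its values. By `hD` the
derivative of `G` factors through `dq`, so the result is a pulled-back curvature. It is used with
`q` a chart of `M`, and with `q` this chart composed with the projection of `Z`. -/
theorem covAlong_commutator {G : N → B →L[𝕜] F →L[𝕜] F} {D : B →L[𝕜] B →L[𝕜] F →L[𝕜] F} {g : N → F}
    (hq : ContMDiffAt J 𝓘(𝕜, B) 2 q z)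
    (hG : MDifferentiableAt J 𝓘(𝕜, B →L[𝕜] F →L[𝕜] F) G z)
    (hD : ∀ W : TangentSpace J z, mvfderiv J G z W = D (mvfderiv J q z W))
    (hg : ContMDiffAt J 𝓘(𝕜, F) 2 g z)
    (hX : MDifferentiableAt J J.tangent (fun y ↦ (⟨y, X y⟩ : TangentBundle J N)) z)
    (hY : MDifferentiableAt J J.tangent (fun y ↦ (⟨y, Y y⟩ : TangentBundle J N)) z) :
    covAlong J q G (fun y ↦ covAlong J q G g y (Y y)) z (X z)
      - covAlong J q G (fun y ↦ covAlong J q G g y (X y)) z (Y z)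
      - covAlong J q G g z (VectorField.mlieBracket J X Y z)
      = curvatureOf D (G z) (mvfderiv J q z (X z)) (mvfderiv J q z (Y z)) (g z) := by
  have i1 : IsManifold J 1 N := inferInstance
  rw [covAlong, covAlong, covAlong, mvfderiv_covAlong hq hG hg hX, mvfderiv_covAlong hq hG hg hY]
  simp only [covAlong, curvatureOf]
  rw [mvfderiv_mlieBracket hg hX hY, mvfderiv_mlieBracket hq hX hY, hD, hD]
  simp only [map_sub, map_add, sub_apply]
  abel

/-- The bracket formula applied to the coordinates `q` themselves: `dq [X, Y] = X (r f) - Y (r e)`,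
which the product rule expands. The form `G` is arbitrary, since its contributions to the covariant
derivatives and to the torsion cancel. -/
theorem mvfderiv_mlieBracket_eq_sub_torsionOf {G : N → B →L[𝕜] F →L[𝕜] F} {r : N → F →L[𝕜] B}
    {D : B →L[𝕜] F →L[𝕜] B} {e f : N → F}
    (hq : ContMDiffAt J 𝓘(𝕜, B) 2 q z)
    (hr : MDifferentiableAt J 𝓘(𝕜, F →L[𝕜] B) r z)
    (hD : ∀ W : TangentSpace J z, mvfderiv J r z W = D (mvfderiv J q z W))
    (he : MDifferentiableAt J 𝓘(𝕜, F) e z) (hf : MDifferentiableAt J 𝓘(𝕜, F) f z)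
    (hX : MDifferentiableAt J J.tangent (fun y ↦ (⟨y, X y⟩ : TangentBundle J N)) z)
    (hY : MDifferentiableAt J J.tangent (fun y ↦ (⟨y, Y y⟩ : TangentBundle J N)) z)
    (hXe : ∀ᶠ y in 𝓝 z, mvfderiv J q y (X y) = r y (e y))
    (hYf : ∀ᶠ y in 𝓝 z, mvfderiv J q y (Y y) = r y (f y)) :
    mvfderiv J q z (VectorField.mlieBracket J X Y z)
      = r z (covAlong J q G f z (X z) - covAlong J q G e z (Y z))
        - torsionOf D (r z) (G z) (e z) (f z) := by
  rw [mvfderiv_mlieBracket hq hX hY, mvfderiv_congr hXe, mvfderiv_congr hYf,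
    mvfderiv_clm_apply hr he, mvfderiv_clm_apply hr hf, hD, hD]
  simp only [covAlong, torsionOf, hXe.self_of_nhds, hYf.self_of_nhds, map_sub, map_add]
  abel

end Calculus

/-! ### Local frames, connection forms and the anchor in coordinates. -/

section Frames

variable {𝕜 : Type*} [RCLike 𝕜]
  {EM : Type*} [NormedAddCommGroup EM] [NormedSpace 𝕜 EM]
  {HM : Type*} [TopologicalSpace HM] {IM : ModelWithCorners 𝕜 EM HM}
  {M : Type*} [TopologicalSpace M] [ChartedSpace HM M]
  {F : Type*} [NormedAddCommGroup F] [NormedSpace 𝕜 F] [FiniteDimensional 𝕜 F]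

/-- A choice of basis identifies the operators on the finite-dimensional space `F` with finite
families of vectors, for which smoothness is componentwise. -/
lemma contMDiffAt_clm_of_apply {V : Type*} [NormedAddCommGroup V] [NormedSpace 𝕜 V] {n : ℕ∞ω}
    {A : M → F →L[𝕜] V} {x : M} (h : ∀ ξ, ContMDiffAt IM 𝓘(𝕜, V) n (fun y ↦ A y ξ) x) :
    ContMDiffAt IM 𝓘(𝕜, F →L[𝕜] V) n A x := by
  let d := Module.finrank 𝕜 F
  have hd : d = Module.finrank 𝕜 (Fin d → 𝕜) := (Module.finrank_fin_fun 𝕜).symm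
  let e₁ := ContinuousLinearEquiv.ofFinrankEq hd
  let e₂ := (e₁.arrowCongr (1 : V ≃L[𝕜] V)).trans (ContinuousLinearEquiv.piRing (Fin d))
  have h1 : ContMDiffAt IM 𝓘(𝕜, Fin d → V) n (fun y ↦ e₂ (A y)) x :=
    contMDiffAt_pi_space.2 fun i ↦ h _
  have h2 := e₂.symm.contDiff.contMDiff.contMDiffAt.comp x h1
  exact h2.congr_of_eventuallyEq (Filter.Eventually.of_forall fun y ↦ (e₂.symm_apply_apply _).symm)

variable {E : M → Type*} [TopologicalSpace (Bundle.TotalSpace F E)]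
  [∀ x, AddCommGroup (E x)] [∀ x, Module 𝕜 (E x)] [∀ x, TopologicalSpace (E x)]
  [FiberBundle F E] [VectorBundle 𝕜 F E]
  {EG : Type*} [NormedAddCommGroup EG] [NormedSpace 𝕜 EG]
  {HG : Type*} [TopologicalSpace HG] {IG : ModelWithCorners 𝕜 EG HG}
  {G : Type*} [TopologicalSpace G] [ChartedSpace HG G] [Group G]
  {φ : G →* (F ≃L[𝕜] F)} {ι : Type*}

namespace GStructure

variable (P : GStructure IM IG E φ ι) {i : ι} {x : M}

/-- The frame `frame i` read in the preferred trivialization of `E` at `x`. -/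
noncomputable def frameCoord (i : ι) (x y : M) : F →L[𝕜] F :=
  (trivializationAt F E x).continuousLinearMapAt 𝕜 y ∘L (P.frame i y : F →L[𝕜] E y)

lemma eventually_mem_trivializationAt (F : Type*) [NormedAddCommGroup F]
    (E : M → Type*) [TopologicalSpace (Bundle.TotalSpace F E)] [∀ x, TopologicalSpace (E x)]
    [FiberBundle F E] (x : M) :
    ∀ᶠ y in 𝓝 x, y ∈ (trivializationAt F E x).baseSet :=
  (trivializationAt F E x).open_baseSet.mem_nhds (FiberBundle.mem_baseSet_trivializationAt' x)

lemma trivializationAt_frame {y : M} (hy : y ∈ (trivializationAt F E x).baseSet) (ξ : F) :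
    (trivializationAt F E x ⟨y, P.frame i y ξ⟩).2 = P.frameCoord i x y ξ := by
  simp [frameCoord, Bundle.Trivialization.coe_linearMapAt_of_mem _ hy]

lemma contMDiffAt_frameCoord (hx : x ∈ P.baseSet i) :
    ContMDiffAt IM 𝓘(𝕜, F →L[𝕜] F) ∞ (P.frameCoord i x) x := by
  refine contMDiffAt_clm_of_apply fun ξ ↦ ?_
  have h := (P.contMDiffOn_frame i ξ).contMDiffAt ((P.isOpen_baseSet i).mem_nhds hx)
  rw [Bundle.contMDiffAt_section] at h
  refine h.congr_of_eventuallyEq ?_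
  filter_upwards [eventually_mem_trivializationAt F E x] with y hy
  exact (P.trivializationAt_frame hy ξ).symm

lemma frameCoord_eq {y : M} (hy : y ∈ (trivializationAt F E x).baseSet) :
    P.frameCoord i x y = (((P.frame i y).trans
      ((trivializationAt F E x).continuousLinearEquivAt 𝕜 y hy) : F ≃L[𝕜] F) : F →L[𝕜] F) := by
  ext ξ
  simp [frameCoord, Bundle.Trivialization.coe_linearMapAt_of_mem _ hy]

/-- A `GStructure` only provides smoothness of `x ↦ frame i x ξ`. Coefficients of sections in the
frame need the inverse frame, which is smooth because inversion of operators is. -/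
lemma contMDiffAt_inverse_frameCoord (hx : x ∈ P.baseSet i) :
    ContMDiffAt IM 𝓘(𝕜, F →L[𝕜] F) ∞ (fun y ↦ (P.frameCoord i x y).inverse) x := by
  have : CompleteSpace F := FiniteDimensional.complete 𝕜 F
  have h := contDiffAt_map_inverse (𝕜 := 𝕜) (n := ∞) ((P.frame i x).trans
    ((trivializationAt F E x).continuousLinearEquivAt 𝕜 x
      (FiberBundle.mem_baseSet_trivializationAt' x)))
  rw [← P.frameCoord_eq] at h
  exact h.contMDiffAt.comp x (P.contMDiffAt_frameCoord hx)

lemma inverse_frameCoord_apply {y : M} (hy : y ∈ (trivializationAt F E x).baseSet) (e : E y) :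
    (P.frameCoord i x y).inverse ((trivializationAt F E x).continuousLinearMapAt 𝕜 y e)
      = (P.frame i y).symm e := by
  rw [frameCoord_eq P hy, ContinuousLinearMap.inverse_equiv]
  apply (P.frame i y).injective
  simp [Bundle.Trivialization.coe_linearMapAt_of_mem _ hy]
  exact (trivializationAt F E x).symm_apply_apply_mk hy e

lemma mdifferentiableAt_frame_apply (hx : x ∈ P.baseSet i) {h : M → F}
    (hh : MDifferentiableAt IM 𝓘(𝕜, F) h x) :
    MDifferentiableAt IM (IM.prod 𝓘(𝕜, F))
      (fun y ↦ Bundle.TotalSpace.mk' F y (P.frame i y (h y))) x := by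
  rw [mdifferentiableAt_section (IB := IM)]
  have h0 := (P.contMDiffAt_frameCoord hx).mdifferentiableAt (n := ∞) (by simp)
  refine (h0.clm_apply hh).congr_of_eventuallyEq ?_
  filter_upwards [eventually_mem_trivializationAt F E x] with y hy
  exact P.trivializationAt_frame hy _

lemma contMDiffAt_frame_symm_apply (hx : x ∈ P.baseSet i) {σ : ∀ y, E y} {n : ℕ∞}
    (hσ : ContMDiffAt IM (IM.prod 𝓘(𝕜, F)) n (fun y ↦ Bundle.TotalSpace.mk' F y (σ y)) x) :
    ContMDiffAt IM 𝓘(𝕜, F) n (fun y ↦ (P.frame i y).symm (σ y)) x := by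
  rw [Bundle.contMDiffAt_section] at hσ
  refine (((P.contMDiffAt_inverse_frameCoord hx).of_le (by exact_mod_cast le_top)).clm_apply hσ).congr_of_eventuallyEq ?_
  filter_upwards [eventually_mem_trivializationAt F E x] with y hy
  rw [← P.inverse_frameCoord_apply hy]
  simp [Bundle.Trivialization.coe_linearMapAt_of_mem _ hy]

lemma mdifferentiableAt_frame_symm_apply (hx : x ∈ P.baseSet i) {σ : ∀ y, E y}
    (hσ : MDifferentiableAt IM (IM.prod 𝓘(𝕜, F)) (fun y ↦ Bundle.TotalSpace.mk' F y (σ y)) x) :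
    MDifferentiableAt IM 𝓘(𝕜, F) (fun y ↦ (P.frame i y).symm (σ y)) x := by
  rw [mdifferentiableAt_section] at hσ
  have h0 := (P.contMDiffAt_inverse_frameCoord hx).mdifferentiableAt (n := ∞) (by simp)
  refine (h0.clm_apply hσ).congr_of_eventuallyEq ?_
  filter_upwards [eventually_mem_trivializationAt F E x] with y hy
  rw [← P.inverse_frameCoord_apply hy]
  simp [Bundle.Trivialization.coe_linearMapAt_of_mem _ hy]

variable [∀ x, IsTopologicalAddGroup (E x)] [∀ x, ContinuousSMul 𝕜 (E x)]
  [ContMDiffVectorBundle 1 F E IM] (cov : CovariantDerivative IM F E)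

lemma connectionForm_add (hx : x ∈ P.baseSet i) (v : TangentSpace IM x) (ξ η : F) :
    P.connectionForm cov i x v (ξ + η) = P.connectionForm cov i x v ξ + P.connectionForm cov i x v η := by
  have h := fun ξ : F ↦ P.mdifferentiableAt_frame_apply hx (h := fun _ ↦ ξ) mdifferentiableAt_const
  have h2 := cov.isCovariantDerivativeOnUniv.add (h ξ) (h η)
  rw [connectionForm, connectionForm, connectionForm, ← map_add, ← add_apply, ← h2]
  congr 3
  ext y
  simp

lemma connectionForm_smul (hx : x ∈ P.baseSet i) (v : TangentSpace IM x) (c : 𝕜) (ξ : F) :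
    P.connectionForm cov i x v (c • ξ) = c • P.connectionForm cov i x v ξ := by
  have h := P.mdifferentiableAt_frame_apply hx (h := fun _ ↦ ξ) mdifferentiableAt_const
  have h2 := cov.isCovariantDerivativeOnUniv.smul_const c h
  rw [connectionForm, connectionForm, ← map_smul, ← smul_apply, ← h2]
  congr 3
  ext y
  simp

/-- `connectionForm` only concerns constant coefficients `ξ`. The difference between `∇ σ` and `u
d(u⁻¹ σ)` satisfies no Leibniz term, hence is tensorial, so at `x` the coefficient `h` may be
replaced in it by the constant `h x`. -/
theorem cov_frame_apply (hx : x ∈ P.baseSet i) {h : M → F}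
    (hh : MDifferentiableAt IM 𝓘(𝕜, F) h x) (v : TangentSpace IM x) :
    cov (fun y ↦ P.frame i y (h y)) x v
      = P.frame i x (mvfderiv IM h x v + P.connectionForm cov i x v (h x)) := by
  have ht : TensorialAt IM F (fun σ : (∀ y, E y) ↦ cov σ x v
      - P.frame i x (mvfderiv IM (fun y ↦ (P.frame i y).symm (σ y)) x v)) x := by
    constructor
    · intro f σ hf hσ
      have h1 := cov.isCovariantDerivativeOnUniv.leibniz hσ hf
      have h2 := mvfderiv_fun_smul hf (P.mdifferentiableAt_frame_symm_apply hx hσ)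
      simp only [Pi.smul_apply', map_smul]
      rw [h1, h2]
      simp only [add_apply, smul_apply, map_add, map_smul, ContinuousLinearMap.smulRight_apply,
        ContinuousLinearEquiv.apply_symm_apply]
      module
    · intro σ σ' hσ hσ'
      have h1 := cov.isCovariantDerivativeOnUniv.add hσ hσ'
      have h2 := mvfderiv_fun_add (P.mdifferentiableAt_frame_symm_apply hx hσ)
        (P.mdifferentiableAt_frame_symm_apply hx hσ')
      simp only [Pi.add_apply, map_add]
      rw [h1, h2]
      simp only [add_apply, map_add]
      abel
  have h3 := ht.pointwise (P.mdifferentiableAt_frame_apply hx hh)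
    (P.mdifferentiableAt_frame_apply hx (h := fun _ ↦ h x) mdifferentiableAt_const) rfl
  simp only [ContinuousLinearEquiv.symm_apply_apply] at h3
  rw [mvfderiv_const] at h3
  simp at h3
  rw [map_add, connectionForm, ContinuousLinearEquiv.apply_symm_apply, ← h3]
  abel

variable [IsManifold IM ∞ M]

omit [ContMDiffVectorBundle 1 F E IM]

variable (IM) in
lemma eventually_mvfderiv_extChartAt (x : M) : ∀ᶠ y in 𝓝 x,
    (mvfderiv IM (extChartAt IM x) y : TangentSpace IM y →L[𝕜] EM)
      = (trivializationAt EM (TangentSpace IM) x).continuousLinearMapAt 𝕜 y := by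
  filter_upwards [(chartAt HM x).open_source.mem_nhds (mem_chart_source HM x)] with y hy
  exact (TangentBundle.continuousLinearMapAt_trivializationAt hy).symm

/-- To differentiate the connection form, it has to become a smooth function with values in a fixed
space of operators. Its values on a basis of `F` are smooth by the smoothness of the connection on
the open set `baseSet i`, and are assembled by means of the dual basis. -/
theorem exists_connectionForm_coord (hcov : IsSmoothConnection IM cov)
    [ContMDiffVectorBundle ∞ F E IM] (hx : x ∈ P.baseSet i) :
    ∃ Γ : M → EM →L[𝕜] F →L[𝕜] F, ContMDiffAt IM 𝓘(𝕜, EM →L[𝕜] F →L[𝕜] F) ∞ Γ x ∧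
      ∀ᶠ y in 𝓝 x, ∀ (v : TangentSpace IM y) (ξ : F),
        Γ y (mvfderiv IM (extChartAt IM x) y v) ξ = P.connectionForm cov i y v ξ := by
  let b := Module.finBasis 𝕜 F
  let β : F → M → EM →L[𝕜] F := fun ξ y ↦ (P.frameCoord i x y).inverse ∘L
    ContinuousLinearMap.inCoordinates EM (TangentSpace IM) F E x y x y
      (cov (fun y ↦ P.frame i y ξ) y)
  have hβ : ∀ ξ, ContMDiffAt IM 𝓘(𝕜, EM →L[𝕜] F) ∞ (β ξ) x := by
    intro ξ
    have h1 := (hcov _ (P.isOpen_baseSet i)).contMDiff (P.contMDiffOn_frame i ξ)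
    have h2 := h1.contMDiffAt ((P.isOpen_baseSet i).mem_nhds hx)
    rw [contMDiffAt_hom_bundle] at h2
    exact (P.contMDiffAt_inverse_frameCoord hx).clm_comp h2.2
  have hβ' : ∀ᶠ y in 𝓝 x, ∀ (v : TangentSpace IM y) (ξ : F),
      β ξ y (mvfderiv IM (extChartAt IM x) y v) = P.connectionForm cov i y v ξ := by
    filter_upwards [eventually_mem_trivializationAt F E x,
      eventually_mem_trivializationAt EM (TangentSpace IM) x, eventually_mvfderiv_extChartAt IM x]
      with y hy1 hy2 hy3 v ξ
    rw [hy3]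
    simp only [β, ContinuousLinearMap.inCoordinates, ContinuousLinearMap.comp_apply]
    rw [P.inverse_frameCoord_apply hy1, Bundle.Trivialization.symmL_continuousLinearMapAt _ hy2]
    rfl
  let Γ : M → EM →L[𝕜] F →L[𝕜] F := fun y ↦
    ∑ k, ContinuousLinearMap.flip ((b.coord k).toContinuousLinearMap.smulRight (β (b k) y))
  refine ⟨Γ, ?_, ?_⟩
  · refine contMDiffAt_finsetSum fun k _ ↦ ?_
    have h1 : ContDiff 𝕜 ∞ (fun a : EM →L[𝕜] F ↦
        (b.coord k).toContinuousLinearMap.smulRight a) := contDiff_const.smulRight contDiff_id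
    have h2 : ContDiff 𝕜 ∞ (fun a : F →L[𝕜] EM →L[𝕜] F ↦ a.flip) := by
      have := LinearIsometryEquiv.contDiff (𝕜 := 𝕜) (n := ∞) (E := F →L[𝕜] EM →L[𝕜] F)
        (F := EM →L[𝕜] F →L[𝕜] F) (ContinuousLinearMap.flipₗᵢ 𝕜 F EM F)
      exact this
    exact (h2.comp h1).contMDiff.contMDiffAt.comp x (hβ (b k))
  · filter_upwards [hβ', (P.isOpen_baseSet i).mem_nhds hx] with y hy hyi v ξ
    -- Linearity in `ξ` is not built into `connectionForm`: it comes from the axioms of `∇`, which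
    -- apply because the frame is differentiable at points of `baseSet i`.
    let l : F →ₗ[𝕜] F :=
      { toFun := P.connectionForm cov i y v
        map_add' := P.connectionForm_add cov hyi v
        map_smul' := P.connectionForm_smul cov hyi v }
    have hl : P.connectionForm cov i y v ξ = l ξ := rfl
    conv_rhs => rw [hl, ← b.sum_repr ξ, map_sum]
    simp only [Γ, sum_apply, ContinuousLinearMap.flip_apply, ContinuousLinearMap.smulRight_apply,
      smul_apply, hy, map_smul]
    rfl

theorem exists_anchor_coord [ContMDiffVectorBundle ∞ F E IM] (hx : x ∈ P.baseSet i)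
    {ρ : ∀ x, E x →L[𝕜] TangentSpace IM x}
    (hρ : ContMDiff IM (IM.prod 𝓘(𝕜, F →L[𝕜] EM)) ∞
      (fun x ↦ Bundle.TotalSpace.mk' (F →L[𝕜] EM)
        (E := fun x ↦ E x →L[𝕜] TangentSpace IM x) x (ρ x))) :
    ∃ r : M → F →L[𝕜] EM, ContMDiffAt IM 𝓘(𝕜, F →L[𝕜] EM) ∞ r x ∧
      ∀ᶠ y in 𝓝 x, ∀ ξ : F,
        mvfderiv IM (extChartAt IM x) y (ρ y (P.frame i y ξ)) = r y ξ := by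
  have h1 := hρ x
  rw [contMDiffAt_hom_bundle] at h1
  refine ⟨_, h1.2.clm_comp (P.contMDiffAt_frameCoord hx), ?_⟩
  filter_upwards [eventually_mem_trivializationAt F E x, eventually_mvfderiv_extChartAt IM x]
    with y hy1 hy2 ξ
  rw [hy2]
  simp only [ContinuousLinearMap.inCoordinates, frameCoord, ContinuousLinearMap.comp_apply]
  rw [Bundle.Trivialization.symmL_continuousLinearMapAt _ hy1]
  rfl

end GStructure
end Frames

/-! ### Curvature and torsion computed in a frame. -/

section Koszul

variable {𝕜 : Type*} [RCLike 𝕜]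
  {EM : Type*} [NormedAddCommGroup EM] [NormedSpace 𝕜 EM] [FiniteDimensional 𝕜 EM]
  {HM : Type*} [TopologicalSpace HM] {IM : ModelWithCorners 𝕜 EM HM} [IM.Boundaryless]
  {M : Type*} [TopologicalSpace M] [ChartedSpace HM M] [IsManifold IM ∞ M]
  {F : Type*} [NormedAddCommGroup F] [NormedSpace 𝕜 F] [FiniteDimensional 𝕜 F]
  {E : M → Type*} [TopologicalSpace (Bundle.TotalSpace F E)]
  [∀ x, AddCommGroup (E x)] [∀ x, Module 𝕜 (E x)] [∀ x, TopologicalSpace (E x)]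
  [∀ x, IsTopologicalAddGroup (E x)] [∀ x, ContinuousSMul 𝕜 (E x)]
  [FiberBundle F E] [VectorBundle 𝕜 F E] [ContMDiffVectorBundle ∞ F E IM]
  {EG : Type*} [NormedAddCommGroup EG] [NormedSpace 𝕜 EG]
  {HG : Type*} [TopologicalSpace HG] {IG : ModelWithCorners 𝕜 EG HG}
  {G : Type*} [TopologicalSpace G] [ChartedSpace HG G] [Group G]
  {φ : G →* (F ≃L[𝕜] F)} {ι : Type*}

/-- The derivative at `x` of a vector-valued function, in the chart at `x`. -/
noncomputable def derivInChart (IM : ModelWithCorners 𝕜 EM HM) {V : Type*} [NormedAddCommGroup V]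
    [NormedSpace 𝕜 V] (A : M → V) (x : M) : EM →L[𝕜] V :=
  mvfderiv IM A x

lemma mvfderiv_extChartAt_self (x : M) (v : TangentSpace IM x) :
    mvfderiv IM (extChartAt IM x) x v = v :=
  congrArg (fun L : EM →L[𝕜] EM ↦ L v) mfderiv_extChartAt_self

/-- This supplies the hypothesis `hD` of the commutator and torsion formulas when `q` is the chart
centred at `x`. -/
lemma mvfderiv_eq_derivInChart {V : Type*} [NormedAddCommGroup V]
    [NormedSpace 𝕜 V] (A : M → V) (x : M) (v : TangentSpace IM x) :
    mvfderiv IM A x v = derivInChart IM A x (mvfderiv IM (extChartAt IM x) x v) := by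
  rw [mvfderiv_extChartAt_self]
  rfl

lemma contMDiffAt_extChartAt_two (x : M) :
    ContMDiffAt IM 𝓘(𝕜, EM) 2 (extChartAt IM x) x := contMDiffAt_extChartAt

namespace GStructure

variable (P : GStructure IM IG E φ ι) {i : ι} {x : M} (cov : CovariantDerivative IM F E)
  {Γ : M → EM →L[𝕜] F →L[𝕜] F}

lemma eventually_cov_frame (hx : x ∈ P.baseSet i)
    (hΓc : ∀ᶠ y in 𝓝 x, ∀ (v : TangentSpace IM y) (ξ : F),
        Γ y (mvfderiv IM (extChartAt IM x) y v) ξ = P.connectionForm cov i y v ξ)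
    {h : M → F} (hh : ContMDiffAt IM 𝓘(𝕜, F) 1 h x) :
    ∀ᶠ y in 𝓝 x, ∀ v : TangentSpace IM y, cov (fun y ↦ P.frame i y (h y)) y v
      = P.frame i y (covAlong IM (extChartAt IM x) Γ h y v) := by
  filter_upwards [hΓc, (P.isOpen_baseSet i).mem_nhds hx,
    (contMDiffAt_iff_contMDiffAt_nhds (by simp)).1 hh] with y h1 h2 h3 v
  rw [P.cov_frame_apply cov h2 (h3.mdifferentiableAt one_ne_zero), covAlong, h1]

/-- The right-hand side involves only the values of `σ`, `X`, `Y` at `x`. This is the tensoriality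
of curvature, and it makes the choice of extensions in `connectionCurvature` immaterial. -/
theorem cov_commutator_frame (hx : x ∈ P.baseSet i)
    (hΓ : MDifferentiableAt IM 𝓘(𝕜, EM →L[𝕜] F →L[𝕜] F) Γ x)
    (hΓc : ∀ᶠ y in 𝓝 x, ∀ (v : TangentSpace IM y) (ξ : F),
        Γ y (mvfderiv IM (extChartAt IM x) y v) ξ = P.connectionForm cov i y v ξ)
    {σ : ∀ y, E y}
    (hσ : ContMDiffAt IM (IM.prod 𝓘(𝕜, F)) 2 (fun y ↦ Bundle.TotalSpace.mk' F y (σ y)) x)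
    {X Y : ∀ y : M, TangentSpace IM y}
    (hX : MDifferentiableAt IM IM.tangent (fun y ↦ (⟨y, X y⟩ : TangentBundle IM M)) x)
    (hY : MDifferentiableAt IM IM.tangent (fun y ↦ (⟨y, Y y⟩ : TangentBundle IM M)) x) :
    cov (fun y ↦ cov σ y (Y y)) x (X x) - cov (fun y ↦ cov σ y (X y)) x (Y x)
        - cov σ x (VectorField.mlieBracket IM X Y x)
      = P.frame i x (curvatureOf (derivInChart IM Γ x) (Γ x)
          (mvfderiv IM (extChartAt IM x) x (X x)) (mvfderiv IM (extChartAt IM x) x (Y x))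
          ((P.frame i x).symm (σ x))) := by
  have : CompleteSpace EM := FiniteDimensional.complete 𝕜 EM
  set h : M → F := fun y ↦ (P.frame i y).symm (σ y) with hh
  have hσh : σ = fun y ↦ P.frame i y (h y) := by ext y; simp [hh]
  have hsm : ContMDiffAt IM 𝓘(𝕜, F) 2 h x := P.contMDiffAt_frame_symm_apply hx (n := 2) hσ
  have hev := P.eventually_cov_frame cov hx hΓc (hsm.of_le one_le_two)
  have key : ∀ (Z W : ∀ y : M, TangentSpace IM y),
      MDifferentiableAt IM IM.tangent (fun y ↦ (⟨y, Z y⟩ : TangentBundle IM M)) x →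
      cov (fun y ↦ cov σ y (Z y)) x (W x) = P.frame i x (covAlong IM (extChartAt IM x) Γ
        (fun y ↦ covAlong IM (extChartAt IM x) Γ h y (Z y)) x (W x)) := by
    intro Z W hZ
    have h1 := mdifferentiableAt_covAlong (contMDiffAt_extChartAt_two x) hΓ hsm hZ
    have h2 := P.mdifferentiableAt_frame_apply hx h1
    have h3 : ∀ᶠ y in 𝓝 x, cov σ y (Z y)
        = P.frame i y (covAlong IM (extChartAt IM x) Γ h y (Z y)) := by
      filter_upwards [hev] with y hy
      rw [← hy, hσh]
    have h4 := h2.congr_of_eventuallyEq (f₁ := fun y ↦ Bundle.TotalSpace.mk' F y (cov σ y (Z y))) (by filter_upwards [h3] with y hy using by rw [hy])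
    -- The inner derivative is known in the frame on a neighbourhood of `x` only; by locality of `∇`
    -- this suffices for the outer one.
    have h5 := cov.isCovariantDerivativeOnUniv.congr_of_eventuallyEq h4 h2 Filter.univ_mem h3
    rw [h5, P.cov_frame_apply cov hx h1, ← hΓc.self_of_nhds]
    rfl
  rw [key Y X hY, key X Y hX]
  conv_lhs => rw [hσh]
  rw [hev.self_of_nhds, ← map_sub, ← map_sub, covAlong_commutator (contMDiffAt_extChartAt_two x) hΓ (mvfderiv_eq_derivInChart Γ x) hsm hX hY]

variable {ρ : ∀ x, E x →L[𝕜] TangentSpace IM x} {r : M → F →L[𝕜] EM}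

lemma mdifferentiableAt_anchor_apply
    (hρ : ContMDiff IM (IM.prod 𝓘(𝕜, F →L[𝕜] EM)) ∞
      (fun x ↦ Bundle.TotalSpace.mk' (F →L[𝕜] EM)
        (E := fun x ↦ E x →L[𝕜] TangentSpace IM x) x (ρ x)))
    {σ : ∀ y, E y}
    (hσ : MDifferentiableAt IM (IM.prod 𝓘(𝕜, F)) (fun y ↦ Bundle.TotalSpace.mk' F y (σ y)) x) :
    MDifferentiableAt IM IM.tangent
      (fun y ↦ (⟨y, ρ y (σ y)⟩ : TangentBundle IM M)) x :=
  ((hρ x).mdifferentiableAt (by simp)).clm_bundle_apply hσ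

lemma contMDiffAt_anchor_apply {n : ℕ∞}
    (hρ : ContMDiff IM (IM.prod 𝓘(𝕜, F →L[𝕜] EM)) ∞
      (fun x ↦ Bundle.TotalSpace.mk' (F →L[𝕜] EM)
        (E := fun x ↦ E x →L[𝕜] TangentSpace IM x) x (ρ x)))
    {σ : ∀ y, E y}
    (hσ : ContMDiffAt IM (IM.prod 𝓘(𝕜, F)) n (fun y ↦ Bundle.TotalSpace.mk' F y (σ y)) x) :
    ContMDiffAt IM IM.tangent n
      (fun y ↦ (⟨y, ρ y (σ y)⟩ : TangentBundle IM M)) x :=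
  ((hρ x).of_le (by exact_mod_cast le_top)).clm_bundle_apply hσ

/-- As for curvature, the value depends only on `σ x` and `τ x`, so `anchoredTorsion` may be
computed on any differentiable sections. -/
theorem torsion_frame (hx : x ∈ P.baseSet i)
    (hΓc : ∀ᶠ y in 𝓝 x, ∀ (v : TangentSpace IM y) (ξ : F),
        Γ y (mvfderiv IM (extChartAt IM x) y v) ξ = P.connectionForm cov i y v ξ)
    (hρ : ContMDiff IM (IM.prod 𝓘(𝕜, F →L[𝕜] EM)) ∞
      (fun x ↦ Bundle.TotalSpace.mk' (F →L[𝕜] EM)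
        (E := fun x ↦ E x →L[𝕜] TangentSpace IM x) x (ρ x)))
    (hr : MDifferentiableAt IM 𝓘(𝕜, F →L[𝕜] EM) r x)
    (hrc : ∀ᶠ y in 𝓝 x, ∀ ξ : F,
        mvfderiv IM (extChartAt IM x) y (ρ y (P.frame i y ξ)) = r y ξ)
    {σ τ : ∀ y, E y}
    (hσ : MDifferentiableAt IM (IM.prod 𝓘(𝕜, F)) (fun y ↦ Bundle.TotalSpace.mk' F y (σ y)) x)
    (hτ : MDifferentiableAt IM (IM.prod 𝓘(𝕜, F)) (fun y ↦ Bundle.TotalSpace.mk' F y (τ y)) x) :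
    mvfderiv IM (extChartAt IM x) x (ρ x (cov τ x (ρ x (σ x)) - cov σ x (ρ x (τ x)))
        - VectorField.mlieBracket IM (fun y ↦ ρ y (σ y)) (fun y ↦ ρ y (τ y)) x)
      = torsionOf (derivInChart IM r x) (r x) (Γ x)
          ((P.frame i x).symm (σ x)) ((P.frame i x).symm (τ x)) := by
  have : CompleteSpace EM := FiniteDimensional.complete 𝕜 EM
  have hσ' := P.mdifferentiableAt_frame_symm_apply hx hσ
  have hτ' := P.mdifferentiableAt_frame_symm_apply hx hτ
  have hev : ∀ σ : ∀ y, E y, ∀ᶠ y in 𝓝 x, mvfderiv IM (extChartAt IM x) y (ρ y (σ y))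
      = r y ((P.frame i y).symm (σ y)) := by
    intro σ
    filter_upwards [hrc] with y hy
    rw [← hy, ContinuousLinearEquiv.apply_symm_apply]
  have h1 := mvfderiv_mlieBracket_eq_sub_torsionOf (G := Γ) (contMDiffAt_extChartAt_two x) hr
    (mvfderiv_eq_derivInChart r x) hσ' hτ' (mdifferentiableAt_anchor_apply hρ hσ)
    (mdifferentiableAt_anchor_apply hρ hτ) (hev σ) (hev τ)
  have hc : ∀ (τ : ∀ y, E y) (v : TangentSpace IM x),
      MDifferentiableAt IM 𝓘(𝕜, F) (fun y ↦ (P.frame i y).symm (τ y)) x →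
      cov τ x v = P.frame i x
        (covAlong IM (extChartAt IM x) Γ (fun y ↦ (P.frame i y).symm (τ y)) x v) := by
    intro τ v hτ
    have := P.cov_frame_apply cov hx hτ v
    simp only [ContinuousLinearEquiv.apply_symm_apply] at this
    rw [this, covAlong, hΓc.self_of_nhds]
  rw [map_sub, h1, hc τ _ hτ', hc σ _ hσ', ← map_sub, hrc.self_of_nhds, sub_sub_cancel]

end GStructure

theorem connectionCurvature_eq {x : M} {i : ι} (P : GStructure IM IG E φ ι)
    (cov : CovariantDerivative IM F E) {Γ : M → EM →L[𝕜] F →L[𝕜] F} (hx : x ∈ P.baseSet i)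
    (hΓ : MDifferentiableAt IM 𝓘(𝕜, EM →L[𝕜] F →L[𝕜] F) Γ x)
    (hΓc : ∀ᶠ y in 𝓝 x, ∀ (v : TangentSpace IM y) (ξ : F),
        Γ y (mvfderiv IM (extChartAt IM x) y v) ξ = P.connectionForm cov i y v ξ)
    (v w : TangentSpace IM x) (e : E x) :
    connectionCurvature IM cov x v w e
      = P.frame i x (curvatureOf (derivInChart IM Γ x) (Γ x)
          (mvfderiv IM (extChartAt IM x) x v) (mvfderiv IM (extChartAt IM x) x w)
          ((P.frame i x).symm e)) := by
  have h := P.cov_commutator_frame cov hx hΓ hΓc (σ := FiberBundle.extend F e)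
    (FiberBundle.contMDiffAt_extend IM F e)
    (X := FiberBundle.extend (E := (TangentSpace IM : M → Type _)) EM v)
    (Y := FiberBundle.extend (E := (TangentSpace IM : M → Type _)) EM w)
    (FiberBundle.mdifferentiableAt_extend IM EM v) (FiberBundle.mdifferentiableAt_extend IM EM w)
  simp only [FiberBundle.extend_apply_self] at h
  exact h

theorem anchoredTorsion_eq {x : M} {i : ι} (P : GStructure IM IG E φ ι)
    (cov : CovariantDerivative IM F E) {Γ : M → EM →L[𝕜] F →L[𝕜] F} (hx : x ∈ P.baseSet i)
    (hΓc : ∀ᶠ y in 𝓝 x, ∀ (v : TangentSpace IM y) (ξ : F),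
        Γ y (mvfderiv IM (extChartAt IM x) y v) ξ = P.connectionForm cov i y v ξ)
    {ρ : ∀ x, E x →L[𝕜] TangentSpace IM x} {r : M → F →L[𝕜] EM}
    (hρ : ContMDiff IM (IM.prod 𝓘(𝕜, F →L[𝕜] EM)) ∞
      (fun x ↦ Bundle.TotalSpace.mk' (F →L[𝕜] EM)
        (E := fun x ↦ E x →L[𝕜] TangentSpace IM x) x (ρ x)))
    (hr : MDifferentiableAt IM 𝓘(𝕜, F →L[𝕜] EM) r x)
    (hrc : ∀ᶠ y in 𝓝 x, ∀ ξ : F,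
        mvfderiv IM (extChartAt IM x) y (ρ y (P.frame i y ξ)) = r y ξ)
    (e f : E x) :
    mvfderiv IM (extChartAt IM x) x (anchoredTorsion IM cov ρ x e f)
      = torsionOf (derivInChart IM r x) (r x) (Γ x)
          ((P.frame i x).symm e) ((P.frame i x).symm f) := by
  have h := P.torsion_frame cov hx hΓc hρ hr hrc (σ := FiberBundle.extend F e)
    (τ := FiberBundle.extend F f)
    (FiberBundle.mdifferentiableAt_extend IM F e) (FiberBundle.mdifferentiableAt_extend IM F f)
  simp only [FiberBundle.extend_apply_self] at h
  exact h

end Koszul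

/-! ### The first Bianchi identity, relative to the anchor. -/

section Bianchi

variable {𝕜 : Type*} [RCLike 𝕜]
  {EM : Type*} [NormedAddCommGroup EM] [NormedSpace 𝕜 EM] [FiniteDimensional 𝕜 EM]
  {HM : Type*} [TopologicalSpace HM] {IM : ModelWithCorners 𝕜 EM HM} [IM.Boundaryless]
  {M : Type*} [TopologicalSpace M] [ChartedSpace HM M] [IsManifold IM ∞ M]
  {F : Type*} [NormedAddCommGroup F] [NormedSpace 𝕜 F] [FiniteDimensional 𝕜 F]
  {E : M → Type*} [TopologicalSpace (Bundle.TotalSpace F E)]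
  [∀ x, AddCommGroup (E x)] [∀ x, Module 𝕜 (E x)] [∀ x, TopologicalSpace (E x)]
  [∀ x, IsTopologicalAddGroup (E x)] [∀ x, ContinuousSMul 𝕜 (E x)]
  [FiberBundle F E] [VectorBundle 𝕜 F E] [ContMDiffVectorBundle ∞ F E IM]
  {EG : Type*} [NormedAddCommGroup EG] [NormedSpace 𝕜 EG]
  {HG : Type*} [TopologicalSpace HG] {IG : ModelWithCorners 𝕜 EG HG}
  {G : Type*} [TopologicalSpace G] [ChartedSpace HG G] [Group G]
  {φ : G →* (F ≃L[𝕜] F)} {ι : Type*} (P : GStructure IM IG E φ ι)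
  {cov : CovariantDerivative IM F E} (hcov : IsSmoothConnection IM cov)
  {ρ : ∀ x, E x →L[𝕜] TangentSpace IM x}

namespace GStructure

include P hcov in
lemma mdifferentiableAt_cov_apply {x : M} {σ : ∀ y, E y}
    (hσ : ContMDiffAt IM (IM.prod 𝓘(𝕜, F)) 2 (fun y ↦ Bundle.TotalSpace.mk' F y (σ y)) x)
    {X : ∀ y : M, TangentSpace IM y}
    (hX : MDifferentiableAt IM IM.tangent (fun y ↦ (⟨y, X y⟩ : TangentBundle IM M)) x) :
    MDifferentiableAt IM (IM.prod 𝓘(𝕜, F))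
      (fun y ↦ Bundle.TotalSpace.mk' F y (cov σ y (X y))) x := by
  have hx := P.mem_baseSet_at x
  obtain ⟨Γ, hΓ, hΓc⟩ := P.exists_connectionForm_coord cov hcov hx
  have hsm := P.contMDiffAt_frame_symm_apply hx (n := 2) hσ
  have hev := P.eventually_cov_frame cov hx hΓc (hsm.of_le one_le_two)
  refine (P.mdifferentiableAt_frame_apply hx (mdifferentiableAt_covAlong
    (contMDiffAt_extChartAt_two x) (hΓ.mdifferentiableAt (by simp)) hsm hX)).congr_of_eventuallyEq ?_
  filter_upwards [hev] with y hy
  rw [← hy]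
  simp

include P hcov in
-- Frees the curvature from the chosen extensions, so that it can be evaluated on the fields `ρ s`,
-- for which brackets are controlled by the torsion.
theorem cov_commutator {x : M} {σ : ∀ y, E y}
    (hσ : ContMDiffAt IM (IM.prod 𝓘(𝕜, F)) 2 (fun y ↦ Bundle.TotalSpace.mk' F y (σ y)) x)
    {X Y : ∀ y : M, TangentSpace IM y}
    (hX : MDifferentiableAt IM IM.tangent (fun y ↦ (⟨y, X y⟩ : TangentBundle IM M)) x)
    (hY : MDifferentiableAt IM IM.tangent (fun y ↦ (⟨y, Y y⟩ : TangentBundle IM M)) x) :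
    connectionCurvature IM cov x (X x) (Y x) (σ x) =
      cov (fun y ↦ cov σ y (Y y)) x (X x) - cov (fun y ↦ cov σ y (X y)) x (Y x)
        - cov σ x (VectorField.mlieBracket IM X Y x) := by
  have hx := P.mem_baseSet_at x
  obtain ⟨Γ, hΓ, hΓc⟩ := P.exists_connectionForm_coord cov hcov hx
  have hΓ' := hΓ.mdifferentiableAt (by simp)
  rw [P.cov_commutator_frame cov hx hΓ' hΓc hσ hX hY, connectionCurvature_eq P cov hx hΓ' hΓc]

include P hcov in
theorem anchor_cov_sub_mlieBracket
    (hρ : ContMDiff IM (IM.prod 𝓘(𝕜, F →L[𝕜] EM)) ∞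
      (fun x ↦ Bundle.TotalSpace.mk' (F →L[𝕜] EM)
        (E := fun x ↦ E x →L[𝕜] TangentSpace IM x) x (ρ x)))
    {x : M} {σ τ : ∀ y, E y}
    (hσ : MDifferentiableAt IM (IM.prod 𝓘(𝕜, F)) (fun y ↦ Bundle.TotalSpace.mk' F y (σ y)) x)
    (hτ : MDifferentiableAt IM (IM.prod 𝓘(𝕜, F)) (fun y ↦ Bundle.TotalSpace.mk' F y (τ y)) x) :
    anchoredTorsion IM cov ρ x (σ x) (τ x) =
      ρ x (cov τ x (ρ x (σ x)) - cov σ x (ρ x (τ x)))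
        - VectorField.mlieBracket IM (fun y ↦ ρ y (σ y)) (fun y ↦ ρ y (τ y)) x := by
  have hx := P.mem_baseSet_at x
  obtain ⟨Γ, hΓ, hΓc⟩ := P.exists_connectionForm_coord cov hcov hx
  obtain ⟨r, hr, hrc⟩ := P.exists_anchor_coord hx hρ
  have hr' := hr.mdifferentiableAt (by simp)
  have h1 := P.torsion_frame cov hx hΓc hρ hr' hrc hσ hτ
  have h2 := anchoredTorsion_eq P cov hx hΓc hρ hr' hrc (σ x) (τ x)
  rw [← h1, mvfderiv_extChartAt_self, mvfderiv_extChartAt_self] at h2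
  exact h2

include P hcov in
/-- The first Bianchi identity for a torsion-free connection. -/
theorem anchor_cyclic_curvature_eq_zero
    (hρ : ContMDiff IM (IM.prod 𝓘(𝕜, F →L[𝕜] EM)) ∞
      (fun x ↦ Bundle.TotalSpace.mk' (F →L[𝕜] EM)
        (E := fun x ↦ E x →L[𝕜] TangentSpace IM x) x (ρ x)))
    (hT : ∀ (x : M) (e₁ e₂ : E x), anchoredTorsion IM cov ρ x e₁ e₂ = 0)
    (x : M) (e₁ e₂ e₃ : E x) :
    ρ x (connectionCurvature IM cov x (ρ x e₁) (ρ x e₂) e₃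
      + connectionCurvature IM cov x (ρ x e₂) (ρ x e₃) e₁
      + connectionCurvature IM cov x (ρ x e₃) (ρ x e₁) e₂) = 0 := by
  have : CompleteSpace EM := FiniteDimensional.complete 𝕜 EM
  let s : E x → ∀ y, E y := fun e ↦ FiberBundle.extend F e
  have hs0 : ∀ e, s e x = e := fun e ↦ FiberBundle.extend_apply_self F e
  have hs : ∀ e, ContMDiffAt IM (IM.prod 𝓘(𝕜, F)) 2
      (fun y ↦ Bundle.TotalSpace.mk' F y (s e y)) x := fun e ↦ FiberBundle.contMDiffAt_extend IM F e
  have hs1 : ∀ e, MDifferentiableAt IM (IM.prod 𝓘(𝕜, F))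
      (fun y ↦ Bundle.TotalSpace.mk' F y (s e y)) x := fun e ↦ (hs e).mdifferentiableAt two_ne_zero
  let X : E x → ∀ y : M, TangentSpace IM y := fun e y ↦ ρ y (s e y)
  have hX2 : ∀ e, ContMDiffAt IM IM.tangent 2 (fun y ↦ (⟨y, X e y⟩ : TangentBundle IM M)) x :=
    fun e ↦ contMDiffAt_anchor_apply (n := 2) hρ (hs e)
  have hX : ∀ e, MDifferentiableAt IM IM.tangent (fun y ↦ (⟨y, X e y⟩ : TangentBundle IM M)) x :=
    fun e ↦ (hX2 e).mdifferentiableAt two_ne_zero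
  let c : E x → E x → ∀ y, E y := fun e f y ↦ cov (s f) y (X e y)
  have hc : ∀ e f, MDifferentiableAt IM (IM.prod 𝓘(𝕜, F))
      (fun y ↦ Bundle.TotalSpace.mk' F y (c e f y)) x :=
    fun e f ↦ P.mdifferentiableAt_cov_apply hcov (hs f) (hX e)
  -- `d e f = ∇_{ρ s_e} s_f - ∇_{ρ s_f} s_e`. Without torsion, its image under `ρ` is the bracket of
  -- `ρ s_e` and `ρ s_f`.
  let d : E x → E x → ∀ y, E y := fun e f ↦ c e f + (-1 : 𝕜) • c f e
  have hneg : ∀ e f, MDifferentiableAt IM (IM.prod 𝓘(𝕜, F))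
      (fun y ↦ Bundle.TotalSpace.mk' F y (((-1 : 𝕜) • c e f) y)) x := fun e f ↦ by
    have := (mdifferentiableAt_const (I := IM) (x := x) (c := (-1 : 𝕜))).smul_section (hc e f)
    exact this
  have hd : ∀ e f, MDifferentiableAt IM (IM.prod 𝓘(𝕜, F))
      (fun y ↦ Bundle.TotalSpace.mk' F y (d e f y)) x := fun e f ↦
    mdifferentiableAt_add_section (hc e f) (hneg f e)
  have hcd : ∀ e f (v : TangentSpace IM x), cov (d e f) x v = cov (c e f) x v - cov (c f e) x v := by
    intro e f v
    have h1 := cov.isCovariantDerivativeOnUniv.add (hc e f) (hneg f e)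
    have h2 := cov.isCovariantDerivativeOnUniv.smul_const (-1 : 𝕜) (hc f e)
    have h3 : cov (d e f) x v = _ := congrArg (fun L ↦ L v) h1
    rw [h3, add_apply, h2, neg_one_smul, neg_apply, sub_eq_add_neg]
  -- the bracket of two fields `X e`, `X f`
  have hbr : ∀ e f, VectorField.mlieBracket IM (X e) (X f) =ᶠ[𝓝 x] fun y ↦ ρ y (d e f y) := by
    intro e f
    filter_upwards [(contMDiffAt_iff_contMDiffAt_nhds (by simp)).1 (hs e),
      (contMDiffAt_iff_contMDiffAt_nhds (by simp)).1 (hs f)] with y he hf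
    have h := P.anchor_cov_sub_mlieBracket hcov hρ (he.mdifferentiableAt two_ne_zero)
      (hf.mdifferentiableAt two_ne_zero)
    rw [hT] at h
    have h' := sub_eq_zero.1 h.symm
    rw [← h']
    congr 1
    simp [d, c, X, sub_eq_add_neg]
  have hR : ∀ e f g, connectionCurvature IM cov x (ρ x e) (ρ x f) g
      = cov (c f g) x (ρ x e) - cov (c e g) x (ρ x f) - cov (s g) x (ρ x (d e f x)) := by
    intro e f g
    have h := P.cov_commutator hcov (hs g) (hX e) (hX f)
    rw [(hbr e f).self_of_nhds] at h
    simp only [X, hs0] at h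
    exact h
  -- Vanishing of the torsion on the pair `d e f`, `s g` expresses the iterated bracket through `∇`.
  have hT' : ∀ e f g, ρ x (cov (s g) x (ρ x (d e f x)) - cov (d e f) x (ρ x g))
      = VectorField.mlieBracket IM (VectorField.mlieBracket IM (X e) (X f)) (X g) x := by
    intro e f g
    have h := P.anchor_cov_sub_mlieBracket hcov hρ (hd e f) (hs1 g)
    rw [hT, hs0] at h
    exact (sub_eq_zero.1 h.symm).trans
      ((hbr e f).mlieBracket_vectorField_eq (Filter.EventuallyEq.refl _ (X g))).symm
  have i3 : IsManifold IM (minSmoothness 𝕜 3) M := by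
    rw [minSmoothness_of_isRCLikeNormedField]; infer_instance
  have hJ := VectorField.leibniz_identity_mlieBracket_apply (U := X e₁) (V := X e₂) (W := X e₃)
    (by rw [minSmoothness_of_isRCLikeNormedField]; exact hX2 _)
    (by rw [minSmoothness_of_isRCLikeNormedField]; exact hX2 _)
    (by rw [minSmoothness_of_isRCLikeNormedField]; exact hX2 _)
  have h1 : VectorField.mlieBracket IM (X e₁) (VectorField.mlieBracket IM (X e₂) (X e₃)) x
      = - ρ x (cov (s e₁) x (ρ x (d e₂ e₃ x)) - cov (d e₂ e₃) x (ρ x e₁)) := by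
    rw [VectorField.mlieBracket_swap_apply, hT']
  have h2 : VectorField.mlieBracket IM (X e₂) (VectorField.mlieBracket IM (X e₁) (X e₃)) x
      = - ρ x (cov (s e₂) x (ρ x (d e₁ e₃ x)) - cov (d e₁ e₃) x (ρ x e₂)) := by
    rw [VectorField.mlieBracket_swap_apply, hT']
  have hdx : ∀ e f, d e f x = c e f x - c f e x := fun e f ↦ by simp [d, sub_eq_add_neg]
  rw [h1, h2, ← hT' e₁ e₂ e₃, ← sub_eq_zero] at hJ
  -- The zero on the right is replaced by the Jacobi expression. Both sides are then the same
  -- combination of images under `ρ` of second derivatives of the `s e` and of derivatives of the `s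
  -- e` along `ρ (d e f)`.
  rw [hR, hR, hR, ← hJ]
  simp only [hcd, hdx, map_sub, map_add]
  abel

end GStructure
end Bianchi

/-! ### Submanifolds of a Grassmannian and moving tautological subspaces. -/

section Grassmannian

variable {𝕜 : Type*} [RCLike 𝕜]
  {F : Type*} [NormedAddCommGroup F] [NormedSpace 𝕜 F] [FiniteDimensional 𝕜 F]
  {ES : Type*} [NormedAddCommGroup ES] [NormedSpace 𝕜 ES]
  {HS : Type*} [TopologicalSpace HS] {IS : ModelWithCorners 𝕜 ES HS}
  {S : Type*} [TopologicalSpace S] [ChartedSpace HS S]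

/-- `Φ` is a local family of endomorphisms of `F`, starting from the identity at `s₀`, which moves
the subspace `incl s₀` to the subspaces `incl s`. The last condition expresses that `incl` is
an immersion at `s₀`. -/
structure IsMovingFrame (IS : ModelWithCorners 𝕜 ES HS) (incl : S → Submodule 𝕜 F) (s₀ : S)
    (Φ : S → F →L[𝕜] F) : Prop where
  contMDiffAt : ∀ᶠ s in 𝓝 s₀, ContMDiffAt IS 𝓘(𝕜, F →L[𝕜] F) ∞ Φ s
  apply_self : Φ s₀ = ContinuousLinearMap.id 𝕜 F
  eq_map : ∀ᶠ s in 𝓝 s₀, incl s = (incl s₀).map (Φ s : F →ₗ[𝕜] F)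
  eq_zero_of_forall_mem : ∀ w : TangentSpace IS s₀,
    (∀ f ∈ incl s₀, mvfderiv IS Φ s₀ w f ∈ incl s₀) → w = 0

lemma mem_graphSubspace_iff {p q : Submodule 𝕜 F} (hpq : IsCompl p q) (a : p →L[𝕜] q) (f : F) :
    f ∈ graphSubspace a ↔ q.projectionOnto p hpq.symm f = a (p.projectionOnto q hpq f) := by
  constructor
  · rintro ⟨b, rfl⟩
    simp [Submodule.projectionOnto_apply_left, Submodule.projectionOnto_apply_right]
  · intro h
    refine ⟨p.projectionOnto q hpq f, ?_⟩
    simp only [LinearMap.add_apply, Submodule.subtype_apply, LinearMap.comp_apply,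
      ContinuousLinearMap.coe_coe, ← h]
    exact Submodule.projection_add_projection_eq_self hpq f

/-- `IsGrassmannianSubmanifold` gives smoothness at each point only in a chart adapted to that
point. This is the change of charts: if `B s ∘ j` parametrises `incl s`, with components `Tp s` and
`Tq s` in `p` and `q`, then `incl s` is the graph of `Tq s ∘ (Tp s)⁻¹`. It is what makes one chart
smooth at all points near its centre. -/
lemma IsGrassmannianSubmanifold.eventually_contMDiffAt {incl : S → Submodule 𝕜 F}
    (hincl : IsGrassmannianSubmanifold IS incl) {p q : Submodule 𝕜 F} (hpq : IsCompl p q)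
    {a : S → p →L[𝕜] q} {s₀ : S} (ha : ∀ᶠ s in 𝓝 s₀, incl s = graphSubspace (a s)) :
    ContMDiffAt IS 𝓘(𝕜, p →L[𝕜] q) ∞ a s₀ := by
  have : CompleteSpace p := FiniteDimensional.complete 𝕜 p
  obtain ⟨q', hq', b, hb, -, hbs⟩ := hincl.immersion s₀
  let πp : F →L[𝕜] p := (p.projectionOnto q hpq).toContinuousLinearMap
  let πq : F →L[𝕜] q := (q.projectionOnto p hpq.symm).toContinuousLinearMap
  -- The identification of `p` with `incl s₀` as a graph, chosen so that `Tp s₀` is the identity and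
  -- `Tp s` stays invertible near `s₀`.
  let j : p →L[𝕜] incl s₀ := (p.subtypeL + q.subtypeL ∘L a s₀).codRestrict (incl s₀) (by
    intro f
    rw [ha.self_of_nhds]
    exact ⟨f, rfl⟩)
  let B : S → incl s₀ →L[𝕜] F := fun s ↦ (incl s₀).subtypeL + q'.subtypeL ∘L b s
  have hB : ContMDiffAt IS 𝓘(𝕜, incl s₀ →L[𝕜] F) ∞ B s₀ :=
    contMDiffAt_const.add (contMDiffAt_const.clm_comp hb)
  let Tp : S → p →L[𝕜] p := fun s ↦ πp ∘L (B s ∘L j)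
  let Tq : S → p →L[𝕜] q := fun s ↦ πq ∘L (B s ∘L j)
  have hTp : ContMDiffAt IS 𝓘(𝕜, p →L[𝕜] p) ∞ Tp s₀ :=
    contMDiffAt_const.clm_comp (hB.clm_comp contMDiffAt_const)
  have hTq : ContMDiffAt IS 𝓘(𝕜, p →L[𝕜] q) ∞ Tq s₀ :=
    contMDiffAt_const.clm_comp (hB.clm_comp contMDiffAt_const)
  have hb0 : b s₀ = 0 := by
    ext f
    have h1 : (f : F) ∈ graphSubspace (b s₀) := by rw [← hbs.self_of_nhds]; exact f.2
    rw [mem_graphSubspace_iff hq', Submodule.projectionOnto_apply_right,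
      Submodule.projectionOnto_apply_left] at h1
    simp [← h1]
  have hTp0 : Tp s₀ = ((ContinuousLinearEquiv.refl 𝕜 p : p ≃L[𝕜] p) : p →L[𝕜] p) := by
    ext f
    simp [Tp, B, hb0, j, πp, Submodule.projectionOnto_apply_left,
      Submodule.projectionOnto_apply_right]
  have hinv : ContMDiffAt IS 𝓘(𝕜, p →L[𝕜] p) ∞ (fun s ↦ (Tp s).inverse) s₀ := by
    have h := contDiffAt_map_inverse (𝕜 := 𝕜) (n := ∞) (ContinuousLinearEquiv.refl 𝕜 p)
    rw [← hTp0] at h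
    exact h.contMDiffAt.comp s₀ hTp
  have hunit : ∀ᶠ s in 𝓝 s₀, (Tp s).IsInvertible := by
    have h := ContinuousLinearEquiv.nhds (ContinuousLinearEquiv.refl 𝕜 p)
    rw [← hTp0] at h
    exact hTp.continuousAt h
  refine (hTq.clm_comp hinv).congr_of_eventuallyEq ?_
  filter_upwards [hunit, ha, hbs] with s h1 h2 h3
  have h4 : Tq s = a s ∘L Tp s := by
    ext f
    have h5 : B s (j f) ∈ graphSubspace (a s) := by
      rw [← h2, h3]
      exact ⟨j f, rfl⟩
    rw [mem_graphSubspace_iff hpq] at h5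
    exact congrArg Subtype.val h5
  rw [h4, ContinuousLinearMap.comp_assoc, h1.self_comp_inverse, ContinuousLinearMap.comp_id]

/-- Take the shear `id + a s ∘ π`, where `π` is the projection onto `incl s₀` along `q`: it sends
`incl s₀` onto the graph of `a s`. Its derivative has values in `q`, so it preserves `incl s₀` only
if the derivative of `a` vanishes, and then the immersion property applies. -/
theorem IsGrassmannianSubmanifold.exists_isMovingFrame {incl : S → Submodule 𝕜 F}
    (hincl : IsGrassmannianSubmanifold IS incl) (s₀ : S) :
    ∃ Φ : S → F →L[𝕜] F, IsMovingFrame IS incl s₀ Φ := by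
  obtain ⟨q, hq, a, ha, hinj, has⟩ := hincl.immersion s₀
  let p := incl s₀
  let πp : F →L[𝕜] p := (p.projectionOnto q hq).toContinuousLinearMap
  let L : (p →L[𝕜] q) →L[𝕜] (F →L[𝕜] F) :=
    (ContinuousLinearMap.compL 𝕜 F q F q.subtypeL) ∘L
      ((ContinuousLinearMap.compL 𝕜 F p q).flip πp)
  have hL : ∀ b, L b = q.subtypeL ∘L (b ∘L πp) := fun b ↦ rfl
  have hsm : ∀ᶠ s in 𝓝 s₀, ContMDiffAt IS 𝓘(𝕜, p →L[𝕜] q) ∞ a s := by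
    filter_upwards [has.eventually_nhds] with s hs using hincl.eventually_contMDiffAt hq hs
  have ha0 : a s₀ = 0 := by
    ext f
    have h1 : (f : F) ∈ graphSubspace (a s₀) := by rw [← has.self_of_nhds]; exact f.2
    rw [mem_graphSubspace_iff hq, Submodule.projectionOnto_apply_right,
      Submodule.projectionOnto_apply_left] at h1
    simp [← h1]
  refine ⟨fun s ↦ ContinuousLinearMap.id 𝕜 F + L (a s), ?_, ?_, ?_, ?_⟩
  · filter_upwards [hsm] with s hs
    have : ContDiff 𝕜 ∞ fun b : p →L[𝕜] q ↦ ContinuousLinearMap.id 𝕜 F + L b :=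
      contDiff_const.add L.contDiff
    exact this.contMDiff.contMDiffAt.comp s hs
  · simp [ha0]
  · filter_upwards [has] with s hs
    have hπ : ∀ b : p, πp (b : F) = b := fun b ↦ Submodule.projectionOnto_apply_left hq b
    rw [hs]
    ext f
    constructor
    · rintro ⟨b, rfl⟩
      exact ⟨b, b.2, by simp [hL, hπ]⟩
    · rintro ⟨b, hb, rfl⟩
      exact ⟨⟨b, hb⟩, by simp [hL, hπ ⟨b, hb⟩]⟩
  · intro w hw
    apply hinj
    rw [map_zero]
    have hd : mvfderiv IS (fun s ↦ ContinuousLinearMap.id 𝕜 F + L (a s)) s₀ w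
        = L (mvfderiv IS a s₀ w) := by
      have h1 := ha.mdifferentiableAt (by simp)
      have h2 : MDifferentiableAt 𝓘(𝕜, p →L[𝕜] q) 𝓘(𝕜, F →L[𝕜] F)
        (fun b ↦ ContinuousLinearMap.id 𝕜 F + L b) (a s₀) :=
        (L.differentiableAt.const_add _).mdifferentiableAt
      rw [mvfderiv_comp_apply_vec h2 h1, mvfderiv_eq_fderiv, fderiv_const_add]
      exact congrArg (fun A : (p →L[𝕜] q) →L[𝕜] (F →L[𝕜] F) ↦ A (mvfderiv IS a s₀ w)) L.fderiv
    refine ContinuousLinearMap.ext fun f : p ↦ Subtype.ext ?_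
    have h3 := hw f f.2
    rw [hd, hL] at h3
    have h4 : πp (f : F) = f := Submodule.projectionOnto_apply_left hq f
    simp only [ContinuousLinearMap.comp_apply, h4] at h3
    -- This vector lies both in `incl s₀` and in its complement `q`.
    have h5 : ((mvfderiv IS a s₀ w f : q) : F) = 0 := by
      have := hq.disjoint
      rw [Submodule.disjoint_def] at this
      exact this _ h3 (Subtype.property _)
    exact h5

namespace IsMovingFrame

variable {incl : S → Submodule 𝕜 F} {s₀ : S} {Φ : S → F →L[𝕜] F} (hΦ : IsMovingFrame IS incl s₀ Φ)

include hΦ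

lemma contMDiffAt_self : ContMDiffAt IS 𝓘(𝕜, F →L[𝕜] F) ∞ Φ s₀ := hΦ.contMDiffAt.self_of_nhds

lemma contMDiffAt_inverse :
    ContMDiffAt IS 𝓘(𝕜, F →L[𝕜] F) ∞ (fun s ↦ (Φ s).inverse) s₀ := by
  have : CompleteSpace F := FiniteDimensional.complete 𝕜 F
  have h := contDiffAt_map_inverse (𝕜 := 𝕜) (n := ∞) (ContinuousLinearEquiv.refl 𝕜 F)
  have h0 : Φ s₀ = (ContinuousLinearEquiv.refl 𝕜 F : F →L[𝕜] F) := hΦ.apply_self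
  rw [← h0] at h
  exact h.contMDiffAt.comp s₀ hΦ.contMDiffAt_self

lemma eventually_isInvertible : ∀ᶠ s in 𝓝 s₀, (Φ s).IsInvertible := by
  have : CompleteSpace F := FiniteDimensional.complete 𝕜 F
  have h := ContinuousLinearEquiv.nhds (ContinuousLinearEquiv.refl 𝕜 F)
  have h0 : Φ s₀ = (ContinuousLinearEquiv.refl 𝕜 F : F →L[𝕜] F) := hΦ.apply_self
  rw [← h0] at h
  exact hΦ.contMDiffAt_self.continuousAt h

end IsMovingFrame

variable {EN : Type*} [NormedAddCommGroup EN] [NormedSpace 𝕜 EN]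
  {HN : Type*} [TopologicalSpace HN] {J : ModelWithCorners 𝕜 EN HN}
  {N : Type*} [TopologicalSpace N] [ChartedSpace HN N]

/-- The projection along `p` onto a complement kills `b` near `z`, hence kills its derivative. -/
lemma mvfderiv_mem_of_eventually_mem {p : Submodule 𝕜 F} {b : N → F} {z : N}
    (hb : MDifferentiableAt J 𝓘(𝕜, F) b z) (hp : ∀ᶠ y in 𝓝 z, b y ∈ p) (W : TangentSpace J z) :
    mvfderiv J b z W ∈ p := by
  obtain ⟨q, hq⟩ := p.exists_isCompl
  let π : F →L[𝕜] q := (q.projectionOnto p hq.symm).toContinuousLinearMap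
  have h1 : (fun y ↦ π (b y)) =ᶠ[𝓝 z] fun _ ↦ 0 := by
    filter_upwards [hp] with y hy using (Submodule.projectionOnto_apply_eq_zero_iff hq.symm).2 hy
  have h2 : mvfderiv J (fun y ↦ π (b y)) z W = π (mvfderiv J b z W) := by
    rw [mvfderiv_comp_apply_vec π.differentiableAt.mdifferentiableAt hb, mvfderiv_eq_fderiv]
    exact congrArg (fun A : F →L[𝕜] q ↦ A (mvfderiv J b z W)) π.fderiv
  rw [mvfderiv_congr h1, mvfderiv_const] at h2
  exact (Submodule.projectionOnto_apply_eq_zero_iff hq.symm).1 h2.symm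

/-- Write `g = Φ(κ) b` with `b` valued in the fixed subspace `incl (κ z)`. Since `Φ` is the identity
at `κ z`, the product rule leaves the derivative of `b`, which stays in that subspace. Modulo `incl
(κ z)`, the derivative of a tautological function thus depends only on its value and on the motion
of the subspace. -/
theorem IsMovingFrame.mvfderiv_sub_mem {incl : S → Submodule 𝕜 F} {Φ : S → F →L[𝕜] F} {κ : N → S}
    {z : N} (hΦ : IsMovingFrame IS incl (κ z) Φ) (hκ : MDifferentiableAt J IS κ z) {g : N → F}
    (hg : MDifferentiableAt J 𝓘(𝕜, F) g z) (hgκ : ∀ᶠ y in 𝓝 z, g y ∈ incl (κ y))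
    (W : TangentSpace J z) :
    mvfderiv J g z W - mvfderiv IS Φ (κ z) (mfderiv J IS κ z W) (g z) ∈ incl (κ z) := by
  let b : N → F := fun y ↦ (Φ (κ y)).inverse (g y)
  have hΦd : MDifferentiableAt IS 𝓘(𝕜, F →L[𝕜] F) Φ (κ z) :=
    hΦ.contMDiffAt_self.mdifferentiableAt (by simp)
  have hΦκ : MDifferentiableAt J 𝓘(𝕜, F →L[𝕜] F) (fun y ↦ Φ (κ y)) z := hΦd.comp z hκ
  have hΦi : MDifferentiableAt J 𝓘(𝕜, F →L[𝕜] F) (fun y ↦ (Φ (κ y)).inverse) z :=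
    (hΦ.contMDiffAt_inverse.mdifferentiableAt (by simp)).comp z hκ
  have hb : MDifferentiableAt J 𝓘(𝕜, F) b z := hΦi.clm_apply hg
  have hinv := hκ.continuousAt.eventually hΦ.eventually_isInvertible
  have h1 : ∀ᶠ y in 𝓝 z, b y ∈ incl (κ z) := by
    filter_upwards [hgκ, hinv, hκ.continuousAt.eventually hΦ.eq_map] with y hy1 hy2 hy3
    rw [hy3] at hy1
    obtain ⟨c, hc, hc'⟩ := hy1
    have h2 : b y = c := by
      simp only [b, ← hc']
      exact hy2.inverse_apply_self c
    rwa [h2]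
  have h2 : g =ᶠ[𝓝 z] fun y ↦ Φ (κ y) (b y) := by
    filter_upwards [hinv] with y hy using (hy.self_apply_inverse _).symm
  have hbz : b z = g z := by simp [b, hΦ.apply_self]
  rw [mvfderiv_congr h2, mvfderiv_clm_apply hΦκ hb, mvfderiv_comp_apply_vec hΦd hκ, hΦ.apply_self,
    hbz, add_sub_cancel_left]
  exact mvfderiv_mem_of_eventually_mem hb h1 W

variable {EG : Type*} [NormedAddCommGroup EG] [NormedSpace 𝕜 EG]
  {HG : Type*} [TopologicalSpace HG] {IG : ModelWithCorners 𝕜 EG HG}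
  {G : Type*} [TopologicalSpace G] [ChartedSpace HG G] [Group G]
  {φ : G →* (F ≃L[𝕜] F)} [MulAction G S] [ContMDiffSMul IG IS ∞ G S]

/-- By equivariance `g ↦ φ g f` is tautological along the orbit map `g ↦ g • s`, so the previous
result applies at `1`. -/
theorem IsMovingFrame.lieAlgebraRep_sub_mem (hφ : IsLinearLieGroup IG φ)
    {incl : S → Submodule 𝕜 F}
    (hsmul : ∀ (g : G) (s : S), incl (g • s) = (incl s).map ((φ g : F →L[𝕜] F) : F →ₗ[𝕜] F))
    {s : S} {Φ : S → F →L[𝕜] F} (hΦ : IsMovingFrame IS incl s Φ) (A : GroupLieAlgebra IG G)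
    {f : F} (hf : f ∈ incl s) :
    lieAlgebraRep IG φ A f - mvfderiv IS Φ s (infinitesimalAction IG IS s A) f ∈ incl s := by
  have hs : (1 : G) • s = s := one_smul G s
  have hact : MDifferentiableAt IG IS (fun g : G ↦ g • s) 1 :=
    ((contMDiff_smul (I := IG) (I' := IS) (n := ∞) (G := G) (M := S)).comp
      (contMDiff_id.prodMk contMDiff_const)).contMDiffAt.mdifferentiableAt (by simp)
  have hφd : MDifferentiableAt IG 𝓘(𝕜, F →L[𝕜] F) (fun g : G ↦ (φ g : F →L[𝕜] F)) 1 :=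
    hφ.contMDiff.contMDiffAt.mdifferentiableAt (by simp)
  have hg : MDifferentiableAt IG 𝓘(𝕜, F) (fun g : G ↦ (φ g : F →L[𝕜] F) f) 1 :=
    hφd.clm_apply mdifferentiableAt_const
  have hΦ' : IsMovingFrame IS incl ((1 : G) • s) Φ := by rwa [hs]
  have h := hΦ'.mvfderiv_sub_mem (κ := fun g : G ↦ g • s) hact hg
    (Filter.Eventually.of_forall fun g ↦ by rw [hsmul]; exact ⟨f, hf, rfl⟩) A
  rw [mvfderiv_clm_apply hφd mdifferentiableAt_const, mvfderiv_const] at h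
  -- `1 • s` and `s` are not definitionally equal; the derivatives at both points are compared as
  -- maps on the model space `ES`.
  have aux : ∀ s' : S, s' = s → ∀ w : ES, (mvfderiv IS Φ s' : ES →L[𝕜] F →L[𝕜] F) w
    = (mvfderiv IS Φ s : ES →L[𝕜] F →L[𝕜] F) w := by rintro _ rfl w; rfl
  have h2 : mvfderiv IS Φ ((1 : G) • s) (mfderiv IG IS (fun g : G ↦ g • s) 1 A)
    = mvfderiv IS Φ s (infinitesimalAction IG IS s A) := aux _ hs _
  have h3 : mvfderiv IG (fun g : G ↦ (φ g : F →L[𝕜] F)) 1 A = lieAlgebraRep IG φ A := rfl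
  rw [h2, h3] at h
  simpa [hs] using h

end Grassmannian

/-! ### The manifold `Z` and its horizontal vectors. -/

section OrbitBundleGeometry

variable {𝕜 : Type*} [RCLike 𝕜]
  {EM : Type*} [NormedAddCommGroup EM] [NormedSpace 𝕜 EM] [FiniteDimensional 𝕜 EM]
  {HM : Type*} [TopologicalSpace HM] {IM : ModelWithCorners 𝕜 EM HM} [IM.Boundaryless]
  {M : Type*} [TopologicalSpace M] [ChartedSpace HM M] [IsManifold IM ∞ M]
  {F : Type*} [NormedAddCommGroup F] [NormedSpace 𝕜 F] [FiniteDimensional 𝕜 F]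
  {E : M → Type*} [TopologicalSpace (Bundle.TotalSpace F E)]
  [∀ x, AddCommGroup (E x)] [∀ x, Module 𝕜 (E x)] [∀ x, TopologicalSpace (E x)]
  [∀ x, IsTopologicalAddGroup (E x)] [∀ x, ContinuousSMul 𝕜 (E x)]
  [FiberBundle F E] [VectorBundle 𝕜 F E] [ContMDiffVectorBundle ∞ F E IM]
  {EG : Type*} [NormedAddCommGroup EG] [NormedSpace 𝕜 EG] [FiniteDimensional 𝕜 EG]
  {HG : Type*} [TopologicalSpace HG] {IG : ModelWithCorners 𝕜 EG HG} [IG.Boundaryless]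
  {G : Type*} [TopologicalSpace G] [ChartedSpace HG G] [Group G] [LieGroup IG ∞ G]
  {φ : G →* (F ≃L[𝕜] F)} {hφ : IsLinearLieGroup IG φ}
  {ι : Type*} {P : GStructure IM IG E φ ι}
  {ES : Type*} [NormedAddCommGroup ES] [NormedSpace 𝕜 ES] [FiniteDimensional 𝕜 ES]
  {HS : Type*} [TopologicalSpace HS] {IS : ModelWithCorners 𝕜 ES HS} [IS.Boundaryless]
  {S : Type*} [TopologicalSpace S] [ChartedSpace HS S] [IsManifold IS ∞ S]
  [MulAction G S] [ContMDiffSMul IG IS ∞ G S]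

namespace OrbitBundle

variable (IS S P hφ) in
/-- The trivialization of `Z` given by `frame i`. -/
noncomputable def trivHomeo (i : ι) : OpenPartialHomeomorph (OrbitBundle IS S P hφ) (M × S) :=
  ((P.fiberBundleCore IS S hφ).localTriv i).toOpenPartialHomeomorph

lemma mem_trivHomeo_source {i : ι} {z : OrbitBundle IS S P hφ} :
    z ∈ (trivHomeo hφ P IS S i).source ↔ z.proj ∈ P.baseSet i :=
  (P.fiberBundleCore IS S hφ).mem_localTriv_source i z

lemma mem_trivHomeo_target {i : ι} {p : M × S} :
    p ∈ (trivHomeo hφ P IS S i).target ↔ p.1 ∈ P.baseSet i :=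
  (P.fiberBundleCore IS S hφ).mem_localTriv_target i p

lemma trivHomeo_trans_mem_atlas (i : ι) {c : OpenPartialHomeomorph (M × S) (ModelProd HM HS)}
    (hc : c ∈ atlas (ModelProd HM HS) (M × S)) :
    (trivHomeo hφ P IS S i) ≫ₕ c ∈ atlas (ModelProd HM HS) (OrbitBundle IS S P hφ) :=
  ⟨_, ⟨_, ⟨i, rfl⟩, rfl⟩, c, hc, rfl⟩

/-- By construction `e` followed by a chart `c` of `M × S` is a chart of `Z`, and near `z` the map
`e` is that chart followed by the inverse of `c`. -/
lemma contMDiffAt_trivHomeo {i : ι} {z : OrbitBundle IS S P hφ} (hz : z.proj ∈ P.baseSet i) :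
    ContMDiffAt (IM.prod IS) (IM.prod IS) ∞ (trivHomeo hφ P IS S i) z := by
  set e := trivHomeo hφ P IS S i
  have hze : z ∈ e.source := mem_trivHomeo_source.2 hz
  let c := chartAt (ModelProd HM HS) (e z)
  have hc : c ∈ IsManifold.maximalAtlas (IM.prod IS) ∞ (M × S) := IsManifold.chart_mem_maximalAtlas _
  have hec : e ≫ₕ c ∈ IsManifold.maximalAtlas (IM.prod IS) ∞ (OrbitBundle IS S P hφ) :=
    IsManifold.subset_maximalAtlas (trivHomeo_trans_mem_atlas i (chart_mem_atlas _ _))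
  have hcz : e z ∈ c.source := mem_chart_source _ _
  have hz' : z ∈ (e ≫ₕ c).source := by simp [hze, hcz]
  have h1 := contMDiffAt_of_mem_maximalAtlas hec hz'
  have h2 := contMDiffAt_symm_of_mem_maximalAtlas hc (c.map_source hcz)
  refine (h2.comp z h1).congr_of_eventuallyEq ?_
  filter_upwards [(e ≫ₕ c).open_source.mem_nhds hz'] with y hy
  simp only [mfld_simps] at hy
  simp [hy.2]

lemma contMDiffAt_trivHomeo_symm {i : ι} {p : M × S} (hp : p.1 ∈ P.baseSet i) :
    ContMDiffAt (IM.prod IS) (IM.prod IS) ∞ (trivHomeo hφ P IS S i).symm p := by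
  set e := trivHomeo hφ P IS S i
  have hpe : p ∈ e.target := mem_trivHomeo_target.2 hp
  let c := chartAt (ModelProd HM HS) p
  have hc : c ∈ IsManifold.maximalAtlas (IM.prod IS) ∞ (M × S) := IsManifold.chart_mem_maximalAtlas _
  have hec : e ≫ₕ c ∈ IsManifold.maximalAtlas (IM.prod IS) ∞ (OrbitBundle IS S P hφ) :=
    IsManifold.subset_maximalAtlas (trivHomeo_trans_mem_atlas i (chart_mem_atlas _ _))
  have hcp : p ∈ c.source := mem_chart_source _ _
  have hp' : c p ∈ (e ≫ₕ c).target := by simp [hcp, hpe]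
  have h1 := contMDiffAt_of_mem_maximalAtlas hc hcp
  have h2 := contMDiffAt_symm_of_mem_maximalAtlas hec hp'
  refine (h2.comp p h1).congr_of_eventuallyEq ?_
  filter_upwards [c.open_source.mem_nhds hcp] with y hy
  simp [hy]

lemma contMDiffAt_proj (z : OrbitBundle IS S P hφ) :
    ContMDiffAt (IM.prod IS) IM ∞ (proj : OrbitBundle IS S P hφ → M) z :=
  contMDiffAt_fst.comp z (contMDiffAt_trivHomeo (P.mem_baseSet_at z.proj))

lemma contMDiffAt_coord {i : ι} {z : OrbitBundle IS S P hφ} (hz : z.proj ∈ P.baseSet i) :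
    ContMDiffAt (IM.prod IS) IS ∞ (coord i : OrbitBundle IS S P hφ → S) z :=
  contMDiffAt_snd.comp z (contMDiffAt_trivHomeo hz)

lemma mdifferentiableAt_proj (z : OrbitBundle IS S P hφ) :
    MDifferentiableAt (IM.prod IS) IM (proj : OrbitBundle IS S P hφ → M) z :=
  (contMDiffAt_proj z).mdifferentiableAt (by simp)

lemma mdifferentiableAt_coord {i : ι} {z : OrbitBundle IS S P hφ} (hz : z.proj ∈ P.baseSet i) :
    MDifferentiableAt (IM.prod IS) IS (coord i : OrbitBundle IS S P hφ → S) z :=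
  (contMDiffAt_coord hz).mdifferentiableAt (by simp)

lemma eventually_proj_mem {i : ι} {z : OrbitBundle IS S P hφ} (hz : z.proj ∈ P.baseSet i) :
    ∀ᶠ y : OrbitBundle IS S P hφ in 𝓝 z, y.proj ∈ P.baseSet i :=
  (contMDiffAt_proj z).continuousAt.eventually ((P.isOpen_baseSet i).mem_nhds hz)

lemma coord_eq_transition_smul {i j : ι} {z : OrbitBundle IS S P hφ} (hi : z.proj ∈ P.baseSet i)
    (hj : z.proj ∈ P.baseSet j) : z.coord j = P.transition i j z.proj • z.coord i := by
  have h : ∀ j, z.coord j = P.transition (P.indexAt z.proj) j z.proj • (show S from z.2) :=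
    fun _ ↦ rfl
  rw [h j, h i, smul_smul, P.transition_mul hφ.injective (P.mem_baseSet_at z.proj) hi hj]

variable (cov : CovariantDerivative IM F E) {z : OrbitBundle IS S P hφ} {i j : ι}

/-- The local expression, in the trivialization given by `frame i`, of horizontality. -/
def IsHorizontalIn (cov : CovariantDerivative IM F E) (i : ι) (z : OrbitBundle IS S P hφ)
    (W : TangentSpace (IM.prod IS) z) : Prop :=
  ∃ A : GroupLieAlgebra IG G,
    (∀ ξ : F, lieAlgebraRep IG φ A ξ =
      P.connectionForm cov i z.proj (mfderiv (IM.prod IS) IM proj z W) ξ) ∧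
    mfderiv (IM.prod IS) IS (coord i) z W = -infinitesimalAction IG IS (z.coord i) A

variable {cov} {incl : S → Submodule 𝕜 F} (hincl : IsGrassmannianSubmanifold IS incl)
  (hsmul : ∀ (g : G) (s : S), incl (g • s) = (incl s).map ((φ g : F →L[𝕜] F) : F →ₗ[𝕜] F))

include hincl hsmul in
-- Modulo the tautological subspace, `dg(W)` is the motion of the subspace along `W` applied to `g
-- z`. Horizontality makes this motion the infinitesimal action of `-A`, hence `-A` acting on `g z`,
-- where `A` represents `Γ(dπ W)`.
theorem IsHorizontalIn.mem_incl (hz : z.proj ∈ P.baseSet i) {W : TangentSpace (IM.prod IS) z}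
    (hW : IsHorizontalIn cov i z W) {g : OrbitBundle IS S P hφ → F}
    (hg : MDifferentiableAt (IM.prod IS) 𝓘(𝕜, F) g z)
    (hgi : ∀ᶠ y : OrbitBundle IS S P hφ in 𝓝 z, g y ∈ incl (y.coord i)) :
    mvfderiv (IM.prod IS) g z W
      + P.connectionForm cov i z.proj (mfderiv (IM.prod IS) IM proj z W) (g z)
      ∈ incl (z.coord i) := by
  obtain ⟨Φ, hΦ⟩ := hincl.exists_isMovingFrame (z.coord i)
  obtain ⟨A, hA, hAW⟩ := hW
  have h1 := hΦ.mvfderiv_sub_mem (mdifferentiableAt_coord hz) hg hgi W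
  have h2 := hΦ.lieAlgebraRep_sub_mem hφ hsmul A hgi.self_of_nhds
  have h3 := add_mem h1 h2
  rw [hAW, map_neg, neg_apply, hA] at h3
  convert h3 using 1
  abel

include hsmul in
-- Compatibility provides `A ∈ 𝔤` representing `Γ(dπ W)`. The hypothesis says that the motion along
-- `d(coord i)(W)` plus the fundamental vector of `A` preserves the subspace, so this tangent vector
-- of `S` vanishes because `S` is immersed.
theorem isHorizontalIn_of_forall_mem {Φ : S → F →L[𝕜] F} (hcomp : P.IsCompatible cov)
    (hΦ : IsMovingFrame IS incl (z.coord i) Φ) (hz : z.proj ∈ P.baseSet i)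
    {W : TangentSpace (IM.prod IS) z}
    (hW : ∀ f ∈ incl (z.coord i),
      mvfderiv (IM.prod IS) (fun y : OrbitBundle IS S P hφ ↦ Φ (y.coord i) f) z W
        + P.connectionForm cov i z.proj (mfderiv (IM.prod IS) IM proj z W) f
        ∈ incl (z.coord i)) :
    IsHorizontalIn cov i z W := by
  obtain ⟨A, hA⟩ := hcomp i z.proj hz (mfderiv (IM.prod IS) IM proj z W)
  refine ⟨A, hA, ?_⟩
  rw [eq_neg_iff_add_eq_zero]
  apply hΦ.eq_zero_of_forall_mem
  intro f hf
  have hΦd : MDifferentiableAt IS 𝓘(𝕜, F →L[𝕜] F) Φ (z.coord i) :=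
    hΦ.contMDiffAt_self.mdifferentiableAt (by simp)
  have h1 := hW f hf
  have hc := mdifferentiableAt_coord hz
  have h3 : MDifferentiableAt (IM.prod IS) 𝓘(𝕜, F →L[𝕜] F)
    (fun y : OrbitBundle IS S P hφ ↦ Φ (y.coord i)) z := hΦd.comp z hc
  rw [mvfderiv_clm_apply h3 mdifferentiableAt_const, mvfderiv_const,
    mvfderiv_comp_apply_vec hΦd hc, ← hA] at h1
  have h2 := sub_mem h1 (hΦ.lieAlgebraRep_sub_mem hφ hsmul A hf)
  convert h2 using 1
  simp only [map_add, add_apply, zero_apply, map_zero, add_zero]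
  abel

/-- Horizontality can be checked in any frame. -/
theorem IsHorizontalIn.change_frame (hincl : IsGrassmannianSubmanifold IS incl)
    (hsmul : ∀ (g : G) (s : S), incl (g • s) = (incl s).map ((φ g : F →L[𝕜] F) : F →ₗ[𝕜] F))
    (hcomp : P.IsCompatible cov) (hi : z.proj ∈ P.baseSet i) (hj : z.proj ∈ P.baseSet j)
    {W : TangentSpace (IM.prod IS) z} (hW : IsHorizontalIn cov i z W) :
    IsHorizontalIn cov j z W := by
  -- The test functions `Φ f` of frame `j` are rewritten in frame `i`, where they are again
  -- tautological, differentiated there along `W`, and brought back by the transition function.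
  obtain ⟨Φ, hΦ⟩ := hincl.exists_isMovingFrame (z.coord j)
  refine isHorizontalIn_of_forall_mem hsmul hcomp hΦ hj fun f hf ↦ ?_
  have hτ : ∀ a b, z.proj ∈ P.baseSet a → z.proj ∈ P.baseSet b →
      MDifferentiableAt IM 𝓘(𝕜, F →L[𝕜] F)
      (fun y ↦ (φ (P.transition a b y) : F →L[𝕜] F)) z.proj := fun a b ha hb ↦ by
    have h1 := (P.contMDiffOn_transition a b).contMDiffAt
      (((P.isOpen_baseSet a).inter (P.isOpen_baseSet b)).mem_nhds ⟨ha, hb⟩)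
    exact (hφ.contMDiff.contMDiffAt.comp _ h1).mdifferentiableAt (by simp)
  have hmul : ∀ x ∈ P.baseSet i ∩ P.baseSet j, ∀ ξ,
      φ (P.transition i j x) (φ (P.transition j i x) ξ) = ξ := by
    intro x hx ξ
    have := P.transition_mul hφ.injective hx.2 hx.1 hx.2
    rw [P.transition_self hφ.injective hx.2] at this
    have h2 := congrArg (fun a ↦ φ a ξ) this
    simp only [map_mul, map_one] at h2
    exact h2
  let g : OrbitBundle IS S P hφ → F := fun y ↦ Φ (y.coord j) f
  let g' : OrbitBundle IS S P hφ → F := fun y ↦ φ (P.transition j i y.proj) (g y)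
  have hg : MDifferentiableAt (IM.prod IS) 𝓘(𝕜, F) g z :=
    (MDifferentiableAt.comp z (hΦ.contMDiffAt_self.mdifferentiableAt (n := ∞) (by simp))
      (mdifferentiableAt_coord hj)).clm_apply mdifferentiableAt_const
  have hpr := mdifferentiableAt_proj z
  have hg' : MDifferentiableAt (IM.prod IS) 𝓘(𝕜, F) g' z :=
    (MDifferentiableAt.comp (g := fun y ↦ (φ (P.transition j i y) : F →L[𝕜] F)) z
      (hτ j i hj hi) hpr).clm_apply hg
  have hgg' : g =ᶠ[𝓝 z] fun y ↦ (φ (P.transition i j y.proj) : F →L[𝕜] F) (g' y) := by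
    filter_upwards [eventually_proj_mem hi, eventually_proj_mem hj] with y hy1 hy2
    exact (hmul _ ⟨hy1, hy2⟩ _).symm
  have htaut : ∀ᶠ y : OrbitBundle IS S P hφ in 𝓝 z, g' y ∈ incl (y.coord i) := by
    filter_upwards [eventually_proj_mem hi, eventually_proj_mem hj,
      (mdifferentiableAt_coord hj).continuousAt.eventually hΦ.eq_map] with y hy1 hy2 hy3
    rw [coord_eq_transition_smul hy2 hy1, hsmul]
    refine ⟨g y, ?_, rfl⟩
    rw [hy3]
    exact ⟨f, hf, rfl⟩
  have h1 := hW.mem_incl hincl hsmul hi hg' htaut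
  have hgz : g z = f := by simp [g, hΦ.apply_self]
  set v := mfderiv (IM.prod IS) IM proj z W with hv
  set T : M → F →L[𝕜] F := fun y ↦ (φ (P.transition i j y) : F →L[𝕜] F) with hT
  have hTd : MDifferentiableAt IM 𝓘(𝕜, F →L[𝕜] F) T z.proj := hτ i j hi hj
  have hTp : MDifferentiableAt (IM.prod IS) 𝓘(𝕜, F →L[𝕜] F)
      (fun y : OrbitBundle IS S P hφ ↦ T y.proj) z := hTd.comp z hpr
  -- the change of the connection form
  have hΓ : T z.proj (P.connectionForm cov i z.proj v (g' z))
      = mvfderiv IM T z.proj v (g' z) + P.connectionForm cov j z.proj v (T z.proj (g' z)) := by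
    have hd : MDifferentiableAt IM 𝓘(𝕜, F) (fun y ↦ T y (g' z)) z.proj :=
      hTd.clm_apply mdifferentiableAt_const
    have h2 := P.cov_frame_apply cov hj hd v
    have h3 := P.cov_frame_apply cov hi (h := fun _ ↦ g' z) mdifferentiableAt_const v
    have h4 : ∀ᶠ y in 𝓝 z.proj, P.frame j y (T y (g' z)) = P.frame i y (g' z) := by
      filter_upwards [(P.isOpen_baseSet i).mem_nhds hi, (P.isOpen_baseSet j).mem_nhds hj]
        with y hy1 hy2 using P.frame_transition i j y ⟨hy1, hy2⟩ _
    have h5 := cov.isCovariantDerivativeOnUniv.congr_of_eventuallyEq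
      (P.mdifferentiableAt_frame_apply hj hd)
      (P.mdifferentiableAt_frame_apply hi (h := fun _ ↦ g' z) mdifferentiableAt_const)
      Filter.univ_mem h4
    rw [h5, h3, mvfderiv_const, mvfderiv_clm_apply hTd mdifferentiableAt_const, mvfderiv_const] at h2
    simp only [zero_apply, map_zero, add_zero, zero_add] at h2
    apply (P.frame j z.proj).injective
    rw [← h2]
    exact P.frame_transition i j z.proj ⟨hi, hj⟩ _
  -- Gauge covariance: the derivative of the transition function in `dg` cancels that in the change
  -- of the connection form.
  have h6 : mvfderiv (IM.prod IS) g z W + P.connectionForm cov j z.proj v f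
      = T z.proj (mvfderiv (IM.prod IS) g' z W + P.connectionForm cov i z.proj v (g' z)) := by
    rw [map_add, hΓ, mvfderiv_congr hgg', mvfderiv_clm_apply hTp hg',
      mvfderiv_comp_apply_vec hTd hpr]
    have h7 : T z.proj (g' z) = f := by rw [← hgz]; exact hgg'.self_of_nhds.symm
    rw [h7]
    abel
  have h8 : incl (z.coord j) = (incl (z.coord i)).map (T z.proj : F →ₗ[𝕜] F) := by
    rw [coord_eq_transition_smul hi hj, hsmul]
  rw [h8]
  exact ⟨_, h1, h6.symm⟩

theorem mem_horizontal_of_isHorizontalIn (hincl : IsGrassmannianSubmanifold IS incl)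
    (hsmul : ∀ (g : G) (s : S), incl (g • s) = (incl s).map ((φ g : F →L[𝕜] F) : F →ₗ[𝕜] F))
    (hcomp : P.IsCompatible cov) (hi : z.proj ∈ P.baseSet i)
    {W : TangentSpace (IM.prod IS) z} (hW : IsHorizontalIn cov i z W) :
    W ∈ z.horizontal cov :=
  fun _ hj ↦ hW.change_frame hincl hsmul hcomp hi hj

end OrbitBundle

end OrbitBundleGeometry

/-! ### Smoothness of vector fields and sections along a map. -/

section AlongMap

variable {𝕜 : Type*} [RCLike 𝕜]
  {EN : Type*} [NormedAddCommGroup EN] [NormedSpace 𝕜 EN]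
  {HN : Type*} [TopologicalSpace HN] {J : ModelWithCorners 𝕜 EN HN}
  {N : Type*} [TopologicalSpace N] [ChartedSpace HN N]
  {EM : Type*} [NormedAddCommGroup EM] [NormedSpace 𝕜 EM]
  {HM : Type*} [TopologicalSpace HM] {IM : ModelWithCorners 𝕜 EM HM}
  {M : Type*} [TopologicalSpace M] [ChartedSpace HM M]
  {ES : Type*} [NormedAddCommGroup ES] [NormedSpace 𝕜 ES]
  {HS : Type*} [TopologicalSpace HS] {IS : ModelWithCorners 𝕜 ES HS}
  {S : Type*} [TopologicalSpace S] [ChartedSpace HS S]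

lemma ContMDiffAt.mfderiv_apply_along [IsManifold IM 1 M] [IsManifold IS 1 S] {f : M → S}
    {b : N → M} {z : N} (hf : ContMDiffAt IM IS ∞ f (b z)) (hb : ContMDiffAt J IM ∞ b z)
    {v : ∀ y : N, TangentSpace IM (b y)}
    (hv : ContMDiffAt J IM.tangent ∞ (fun y ↦ (⟨b y, v y⟩ : TangentBundle IM M)) z) :
    ContMDiffAt J IS.tangent ∞
      (fun y ↦ (⟨f (b y), mfderiv IM IS f (b y) (v y)⟩ : TangentBundle IS S)) z := by
  have h1 := (hf.mfderiv_const (m := ∞) (by simp)).comp z hb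
  exact ContMDiffAt.clm_apply_of_inCoordinates h1 hv (hf.comp z hb)

lemma contMDiffAt_tangentBundle_const [IsManifold IM 1 M] (x : M) {A : N → EM} {z : N}
    (hA : ContMDiffAt J 𝓘(𝕜, EM) ∞ A z) :
    ContMDiffAt J IM.tangent ∞ (fun y ↦ (⟨x, A y⟩ : TangentBundle IM M)) z := by
  refine (Bundle.contMDiffAt_totalSpace (E := (TangentSpace IM : M → Type _))).2
    ⟨contMDiffAt_const, ?_⟩
  let e := trivializationAt EM (TangentSpace IM) x
  have hx : x ∈ e.baseSet := FiberBundle.mem_baseSet_trivializationAt' x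
  let L : EM →L[𝕜] EM := e.continuousLinearMapAt 𝕜 x
  refine (L.contDiff.contMDiff.contMDiffAt.comp z hA).congr_of_eventuallyEq
    (Filter.Eventually.of_forall fun y ↦ ?_)
  exact (congrFun (Bundle.Trivialization.coe_linearMapAt_of_mem e hx) (A y)).symm

variable {EG : Type*} [NormedAddCommGroup EG] [NormedSpace 𝕜 EG]
  {HG : Type*} [TopologicalSpace HG] {IG : ModelWithCorners 𝕜 EG HG}
  {G : Type*} [TopologicalSpace G] [ChartedSpace HG G] [Group G]
  [IsManifold IG ∞ G] [IsManifold IS ∞ S] [MulAction G S] [ContMDiffSMul IG IS ∞ G S]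

/-- The fundamental vector at `κ` is the derivative of the action map `G × S → S` at `(1, κ)`
applied to `(A, 0)`, and so depends smoothly on `κ` and `A` jointly. -/
lemma contMDiffAt_infinitesimalAction {κ : N → S} {A : N → EG} {z : N}
    (hκ : ContMDiffAt J IS ∞ κ z) (hA : ContMDiffAt J 𝓘(𝕜, EG) ∞ A z) :
    ContMDiffAt J IS.tangent ∞
      (fun y ↦ (⟨κ y, infinitesimalAction (G := G) IG IS (κ y) (A y)⟩ :
        TangentBundle IS S)) z := by
  have hact : ContMDiff (IG.prod IS) IS ∞ (fun p : G × S ↦ p.1 • p.2) := contMDiff_smul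
  have h1 := contMDiffAt_tangentBundle_const (IM := IG) (1 : G) hA
  have h2 : ContMDiffAt J IS.tangent ∞ (fun y ↦ (⟨κ y, 0⟩ : TangentBundle IS S)) z :=
    (Bundle.contMDiff_zeroSection 𝕜 (TangentSpace IS : S → Type _)).contMDiffAt.comp z hκ
  have h3 := (contMDiff_equivTangentBundleProd_symm (I := IG) (M := G) (I' := IS) (M' := S)
    (n := ∞)).contMDiffAt.comp z (h1.prodMk h2)
  have h4 := (hact (1, κ z)).mfderiv_apply_along (b := fun y ↦ ((1 : G), κ y))
    (contMDiffAt_const.prodMk hκ) h3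
  refine h4.congr_of_eventuallyEq (Filter.Eventually.of_forall fun y ↦ ?_)
  have h5 : mfderiv (IG.prod IS) IS (fun p : G × S ↦ p.1 • p.2) (1, κ y) ((A y, 0) : EG × ES)
      = mfderiv IG IS (fun g : G ↦ g • κ y) 1 (A y) := by
    have h := mfderiv_prod_eq_add_apply (v := ((A y, 0) : EG × ES))
      ((hact (1, κ y)).mdifferentiableAt (by simp))
    exact h.trans ((congrArg _ (map_zero _)).trans (add_zero _))
  have aux : ∀ s : S, s = κ y → ∀ w : ES,
    (⟨κ y, w⟩ : TangentBundle IS S) = (⟨s, w⟩ : TangentBundle IS S) := by rintro _ rfl w; rfl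
  refine (aux ((1 : G) • κ y) (one_smul _ _) _).trans ?_
  exact congrArg (fun w : ES ↦ (⟨(1 : G) • κ y, w⟩ : TangentBundle IS S)) h5.symm

variable {F : Type*} [NormedAddCommGroup F] [NormedSpace 𝕜 F] [FiniteDimensional 𝕜 F]
  {E : M → Type*} [TopologicalSpace (Bundle.TotalSpace F E)]
  [∀ x, AddCommGroup (E x)] [∀ x, Module 𝕜 (E x)] [∀ x, TopologicalSpace (E x)]
  [FiberBundle F E] [VectorBundle 𝕜 F E] {φ : G →* (F ≃L[𝕜] F)} {ι : Type*}

namespace GStructure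

variable (P : GStructure IM IG E φ ι) {i : ι} {b : N → M} {z : N}

lemma contMDiffAt_frame_apply_along (hz : b z ∈ P.baseSet i) (hb : ContMDiffAt J IM ∞ b z)
    {h : N → F} (hh : ContMDiffAt J 𝓘(𝕜, F) ∞ h z) :
    ContMDiffAt J (IM.prod 𝓘(𝕜, F)) ∞
      (fun y ↦ Bundle.TotalSpace.mk' F (b y) (P.frame i (b y) (h y))) z := by
  rw [Bundle.contMDiffAt_totalSpace]
  refine ⟨hb, ?_⟩
  have h1 : ContMDiffAt J 𝓘(𝕜, F →L[𝕜] F) ∞ (fun y ↦ P.frameCoord i (b z) (b y)) z :=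
    (P.contMDiffAt_frameCoord hz).comp z hb
  refine (h1.clm_apply hh).congr_of_eventuallyEq ?_
  filter_upwards [hb.continuousAt.eventually (eventually_mem_trivializationAt F E (b z))] with y hy
  exact P.trivializationAt_frame hy _

lemma contMDiffAt_frame_symm_apply_along (hz : b z ∈ P.baseSet i) {σ : ∀ y, E (b y)}
    (hσ : ContMDiffAt J (IM.prod 𝓘(𝕜, F)) ∞ (fun y ↦ Bundle.TotalSpace.mk' F (b y) (σ y)) z) :
    ContMDiffAt J 𝓘(𝕜, F) ∞ (fun y ↦ (P.frame i (b y)).symm (σ y)) z := by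
  rw [Bundle.contMDiffAt_totalSpace] at hσ
  have hb : ContMDiffAt J IM ∞ b z := hσ.1
  have h1 : ContMDiffAt J 𝓘(𝕜, F →L[𝕜] F) ∞ (fun y ↦ (P.frameCoord i (b z) (b y)).inverse) z :=
    (P.contMDiffAt_inverse_frameCoord hz).comp z hb
  refine (h1.clm_apply hσ.2).congr_of_eventuallyEq ?_
  filter_upwards [hb.continuousAt.eventually (eventually_mem_trivializationAt F E (b z))] with y hy
  rw [← P.inverse_frameCoord_apply hy]
  simp [Bundle.Trivialization.coe_linearMapAt_of_mem _ hy]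

variable [∀ x, IsTopologicalAddGroup (E x)] [∀ x, ContinuousSMul 𝕜 (E x)]
  [IsManifold IM ∞ M] [ContMDiffVectorBundle ∞ F E IM]

lemma contMDiffAt_connectionForm_along {cov : CovariantDerivative IM F E}
    (hcov : IsSmoothConnection IM cov) (hz : b z ∈ P.baseSet i)
    {v : ∀ y, TangentSpace IM (b y)}
    (hv : ContMDiffAt J IM.tangent ∞ (fun y ↦ (⟨b y, v y⟩ : TangentBundle IM M)) z) (ξ : F) :
    ContMDiffAt J 𝓘(𝕜, F) ∞ (fun y ↦ P.connectionForm cov i (b y) (v y) ξ) z := by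
  have hb : ContMDiffAt J IM ∞ b z :=
    ((Bundle.contMDiffAt_totalSpace (E := (TangentSpace IM : M → Type _))).1 hv).1
  have h1 := (hcov _ (P.isOpen_baseSet i)).contMDiff (P.contMDiffOn_frame i ξ)
  have h2 := (h1.contMDiffAt ((P.isOpen_baseSet i).mem_nhds hz)).comp z hb
  exact P.contMDiffAt_frame_symm_apply_along hz (ContMDiffAt.clm_bundle_apply h2 hv)

end GStructure

end AlongMap

/-! ### Horizontal lifts and tautological lifts. -/

section Distribution

variable {𝕜 : Type*} [RCLike 𝕜]
  {EM : Type*} [NormedAddCommGroup EM] [NormedSpace 𝕜 EM] [FiniteDimensional 𝕜 EM]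
  {HM : Type*} [TopologicalSpace HM] {IM : ModelWithCorners 𝕜 EM HM} [IM.Boundaryless]
  {M : Type*} [TopologicalSpace M] [ChartedSpace HM M] [IsManifold IM ∞ M]
  {F : Type*} [NormedAddCommGroup F] [NormedSpace 𝕜 F] [FiniteDimensional 𝕜 F]
  {E : M → Type*} [TopologicalSpace (Bundle.TotalSpace F E)]
  [∀ x, AddCommGroup (E x)] [∀ x, Module 𝕜 (E x)] [∀ x, TopologicalSpace (E x)]
  [∀ x, IsTopologicalAddGroup (E x)] [∀ x, ContinuousSMul 𝕜 (E x)]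
  [FiberBundle F E] [VectorBundle 𝕜 F E] [ContMDiffVectorBundle ∞ F E IM]
  {EG : Type*} [NormedAddCommGroup EG] [NormedSpace 𝕜 EG] [FiniteDimensional 𝕜 EG]
  {HG : Type*} [TopologicalSpace HG] {IG : ModelWithCorners 𝕜 EG HG} [IG.Boundaryless]
  {G : Type*} [TopologicalSpace G] [ChartedSpace HG G] [Group G] [LieGroup IG ∞ G]
  {φ : G →* (F ≃L[𝕜] F)} {hφ : IsLinearLieGroup IG φ}
  {ι : Type*} {P : GStructure IM IG E φ ι}
  {ES : Type*} [NormedAddCommGroup ES] [NormedSpace 𝕜 ES] [FiniteDimensional 𝕜 ES]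
  {HS : Type*} [TopologicalSpace HS] {IS : ModelWithCorners 𝕜 ES HS} [IS.Boundaryless]
  {S : Type*} [TopologicalSpace S] [ChartedSpace HS S] [IsManifold IS ∞ S]
  [MulAction G S] [ContMDiffSMul IG IS ∞ G S]

namespace OrbitBundle

variable {cov : CovariantDerivative IM F E} {ρ : ∀ x, E x →L[𝕜] TangentSpace IM x}
  {z : OrbitBundle IS S P hφ} {i : ι} {incl : S → Submodule 𝕜 F}

lemma mfderiv_proj_trivHomeo_symm {y : OrbitBundle IS S P hφ} {p : M × S}
    (hp : p.1 ∈ P.baseSet i) (hy : (trivHomeo hφ P IS S i).symm p = y)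
    (V : TangentSpace (IM.prod IS) p) :
    mfderiv (IM.prod IS) IM proj y
      (mfderiv (IM.prod IS) (IM.prod IS) (trivHomeo hφ P IS S i).symm p V) = V.1 := by
  subst hy
  have h1 : (fun p ↦ proj ((trivHomeo hφ P IS S i).symm p)) =ᶠ[𝓝 p] Prod.fst := by
    filter_upwards [(trivHomeo hφ P IS S i).open_target.mem_nhds (mem_trivHomeo_target.2 hp)]
      with p' hp'
    rfl
  have h2 := mfderiv_comp p (mdifferentiableAt_proj ((trivHomeo hφ P IS S i).symm p))
    ((contMDiffAt_trivHomeo_symm hp).mdifferentiableAt (by simp))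
  have h3 := h1.mfderiv_eq (I := IM.prod IS) (I' := IM)
  rw [mfderiv_fst] at h3
  exact congrArg (fun L : (EM × ES) →L[𝕜] EM ↦ L V) (h2.symm.trans h3)

lemma mfderiv_coord_trivHomeo_symm {y : OrbitBundle IS S P hφ} {p : M × S}
    (hp : p.1 ∈ P.baseSet i) (hy : (trivHomeo hφ P IS S i).symm p = y)
    (V : TangentSpace (IM.prod IS) p) :
    mfderiv (IM.prod IS) IS (coord i) y
      (mfderiv (IM.prod IS) (IM.prod IS) (trivHomeo hφ P IS S i).symm p V) = V.2 := by
  subst hy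
  have hp1 : (trivHomeo hφ P IS S i).symm p ∈ (trivHomeo hφ P IS S i).source :=
    (trivHomeo hφ P IS S i).map_target (mem_trivHomeo_target.2 hp)
  have h1 : (fun p ↦ coord i ((trivHomeo hφ P IS S i).symm p)) =ᶠ[𝓝 p] Prod.snd := by
    filter_upwards [(trivHomeo hφ P IS S i).open_target.mem_nhds (mem_trivHomeo_target.2 hp)]
      with p' hp'
    exact congrArg (Prod.snd : M × S → S) ((trivHomeo hφ P IS S i).right_inv hp')
  have h2 := mfderiv_comp p (mdifferentiableAt_coord (mem_trivHomeo_source.1 hp1))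
    ((contMDiffAt_trivHomeo_symm hp).mdifferentiableAt (by simp))
  have h3 := h1.mfderiv_eq (I := IM.prod IS) (I' := IS)
  rw [mfderiv_snd] at h3
  exact congrArg (fun L : (EM × ES) →L[𝕜] ES ↦ L V) (h2.symm.trans h3)

/-- In the trivialization given by a frame, the lift of `v` is `v` paired with the fundamental
vector of `-A`, for `A ∈ 𝔤` representing `Γ(v)`. The point is to choose `A` smoothly. -/
theorem exists_horizontal_lift (hincl : IsGrassmannianSubmanifold IS incl)
    (hsmul : ∀ (g : G) (s : S), incl (g • s) = (incl s).map ((φ g : F →L[𝕜] F) : F →ₗ[𝕜] F))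
    (hcov : IsSmoothConnection IM cov) (hcomp : P.IsCompatible cov) (hz : z.proj ∈ P.baseSet i)
    {v : ∀ y : OrbitBundle IS S P hφ, TangentSpace IM y.proj}
    (hv : ∀ᶠ y in 𝓝 z, ContMDiffAt (IM.prod IS) IM.tangent ∞
      (fun y : OrbitBundle IS S P hφ ↦ (⟨y.proj, v y⟩ : TangentBundle IM M)) y) :
    ∃ X : ∀ y : OrbitBundle IS S P hφ, TangentSpace (IM.prod IS) y, ∀ᶠ y in 𝓝 z,
      ContMDiffAt (IM.prod IS) (IM.prod IS).tangent ∞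
        (fun y ↦ (⟨y, X y⟩ : TangentBundle (IM.prod IS) (OrbitBundle IS S P hφ))) y ∧
      X y ∈ y.horizontal cov ∧ mfderiv (IM.prod IS) IM proj y (X y) = v y := by
  let b := Module.finBasis 𝕜 F
  let rep' : GroupLieAlgebra IG G →ₗ[𝕜] (Fin (Module.finrank 𝕜 F) → F) :=
    { toFun := fun A k ↦ lieAlgebraRep IG φ A (b k)
      map_add' := fun A B ↦ by ext k; simp
      map_smul' := fun c A ↦ by ext k; simp }
  have hrep' : LinearMap.ker rep' = ⊥ := by
    rw [LinearMap.ker_eq_bot]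
    intro A B hAB
    apply hφ.injective_mfderiv
    have : (lieAlgebraRep IG φ A : F →ₗ[𝕜] F) = lieAlgebraRep IG φ B :=
      b.ext fun k ↦ congrFun hAB k
    have h : lieAlgebraRep IG φ A = lieAlgebraRep IG φ B := ContinuousLinearMap.coe_injective this
    exact h
  -- As `φ` is immersive at `1`, the representation of `𝔤` is injective, and a linear left inverse
  -- recovers `A` from `Γ(v)`.
  obtain ⟨L, hL⟩ := rep'.exists_leftInverse_of_injective hrep'
  let L' : (Fin (Module.finrank 𝕜 F) → F) →L[𝕜] EG := L.toContinuousLinearMap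
  let A : OrbitBundle IS S P hφ → EG := fun y ↦
    L' fun k ↦ P.connectionForm cov i y.proj (v y) (b k)
  have hA : ∀ y : OrbitBundle IS S P hφ, y.proj ∈ P.baseSet i → ∀ ξ,
      lieAlgebraRep IG φ (A y) ξ = P.connectionForm cov i y.proj (v y) ξ := by
    intro y hy ξ
    obtain ⟨B, hB⟩ := hcomp i y.proj hy (v y)
    have h1 : A y = L (rep' B) := congrArg L (funext fun k ↦ (hB (b k)).symm)
    have h2 : L (rep' B) = B := LinearMap.congr_fun hL B
    rw [h1, h2, hB]
  let V : ∀ y : OrbitBundle IS S P hφ, TangentSpace (IM.prod IS) (y.proj, y.coord i) :=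
    fun y ↦ (v y, infinitesimalAction (G := G) IG IS (y.coord i) (-A y))
  refine ⟨fun y ↦ mfderiv (IM.prod IS) (IM.prod IS) (trivHomeo hφ P IS S i).symm
    (y.proj, y.coord i) (V y), ?_⟩
  have hinv : ∀ y : OrbitBundle IS S P hφ, y.proj ∈ P.baseSet i →
      (trivHomeo hφ P IS S i).symm (y.proj, y.coord i) = y := fun y hy ↦
    (trivHomeo hφ P IS S i).left_inv (mem_trivHomeo_source.2 hy)
  filter_upwards [hv, eventually_proj_mem hz] with y hvy hy
  have hp : mfderiv (IM.prod IS) IM proj y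
      (mfderiv (IM.prod IS) (IM.prod IS) (trivHomeo hφ P IS S i).symm
        (y.proj, y.coord i) (V y)) = v y := mfderiv_proj_trivHomeo_symm hy (hinv y hy) _
  refine ⟨?_, ?_, hp⟩
  · have hAs : ContMDiffAt (IM.prod IS) 𝓘(𝕜, EG) ∞ (fun y ↦ -A y) y := by
      have h1 : ContMDiffAt (IM.prod IS) 𝓘(𝕜, Fin (Module.finrank 𝕜 F) → F) ∞
        (fun (y : OrbitBundle IS S P hφ) k ↦ P.connectionForm cov i y.proj (v y) (b k)) y :=
        contMDiffAt_pi_space.2 fun k ↦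
          P.contMDiffAt_connectionForm_along hcov (b := proj) hy hvy (b k)
      exact (L'.contDiff.contMDiff.contMDiffAt.comp y h1).neg
    have h1 := contMDiffAt_infinitesimalAction (G := G) (IG := IG) (contMDiffAt_coord hy) hAs
    have h2 := (contMDiff_equivTangentBundleProd_symm (I := IM) (M := M) (I' := IS) (M' := S)
      (n := ∞)).contMDiffAt.comp y (hvy.prodMk h1)
    have h3 := (contMDiffAt_trivHomeo_symm (hφ := hφ) (p := (y.proj, y.coord i)) hy).mfderiv_apply_along
      (b := fun y : OrbitBundle IS S P hφ ↦ (y.proj, y.coord i)) (contMDiffAt_trivHomeo hy) h2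
    refine h3.congr_of_eventuallyEq ?_
    filter_upwards [eventually_proj_mem hy] with y' hy'
    have aux : ∀ y'', y'' = y' → ∀ w : EM × ES,
      (⟨y', w⟩ : TangentBundle (IM.prod IS) (OrbitBundle IS S P hφ)) = ⟨y'', w⟩ := by
      rintro _ rfl w; rfl
    exact aux _ (hinv y' hy') _
  · refine mem_horizontal_of_isHorizontalIn hincl hsmul hcomp hy ⟨A y, ?_, ?_⟩
    · rw [hp]
      exact hA y hy
    · exact (mfderiv_coord_trivHomeo_symm hy (hinv y hy) _).trans
        (map_neg (infinitesimalAction (G := G) IG IS (y.coord i)) (A y))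

lemma mem_distribution_iff
    (hsmul : ∀ (g : G) (s : S), incl (g • s) = (incl s).map ((φ g : F →L[𝕜] F) : F →ₗ[𝕜] F))
    (hz : z.proj ∈ P.baseSet i) {W : TangentSpace (IM.prod IS) z} :
    W ∈ z.distribution cov ρ incl ↔ W ∈ z.horizontal cov ∧ ∃ f ∈ incl (z.coord i),
      mfderiv (IM.prod IS) IM proj z W = ρ z.proj (P.frame i z.proj f) := by
  rw [distribution, Submodule.mem_inf, subspace_eq hsmul z hz]
  refine and_congr_right fun _ ↦ ⟨?_, ?_⟩
  · rintro ⟨_, ⟨f, hf, rfl⟩, h⟩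
    exact ⟨f, hf, h.symm⟩
  · rintro ⟨f, hf, h⟩
    exact ⟨_, ⟨f, hf, rfl⟩, h.symm⟩

/-- A differentiable vector field which is projected into the tautological subspaces by `ρ` comes
from a differentiable function. -/
theorem exists_tautological_lift (hincl : IsGrassmannianSubmanifold IS incl)
    (hsmul : ∀ (g : G) (s : S), incl (g • s) = (incl s).map ((φ g : F →L[𝕜] F) : F →ₗ[𝕜] F))
    (hinj : Set.InjOn (ρ z.proj) (z.subspace incl)) (hz : z.proj ∈ P.baseSet i)
    {r : M → F →L[𝕜] EM} (hr : MDifferentiableAt IM 𝓘(𝕜, F →L[𝕜] EM) r z.proj)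
    (hrc : ∀ᶠ y in 𝓝 z.proj, ∀ ξ : F,
        mvfderiv IM (extChartAt IM z.proj) y (ρ y (P.frame i y ξ)) = r y ξ)
    {X : ∀ y : OrbitBundle IS S P hφ, TangentSpace (IM.prod IS) y}
    (hX : MDifferentiableAt (IM.prod IS) (IM.prod IS).tangent
        (fun y ↦ (⟨y, X y⟩ : TangentBundle (IM.prod IS) (OrbitBundle IS S P hφ))) z)
    (hXd : ∀ᶠ y in 𝓝 z, X y ∈ y.distribution cov ρ incl) :
    ∃ e : OrbitBundle IS S P hφ → F, MDifferentiableAt (IM.prod IS) 𝓘(𝕜, F) e z ∧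
      (∀ᶠ y in 𝓝 z, e y ∈ incl (y.coord i)) ∧
      ∀ᶠ y in 𝓝 z, mvfderiv (IM.prod IS)
        (fun y : OrbitBundle IS S P hφ ↦ extChartAt IM z.proj y.proj) y (X y)
        = r y.proj (e y) := by
  obtain ⟨Φ, hΦ⟩ := hincl.exists_isMovingFrame (z.coord i)
  let p := incl (z.coord i)
  have : CompleteSpace p := FiniteDimensional.complete 𝕜 p
  let q : OrbitBundle IS S P hφ → EM := fun y ↦ extChartAt IM z.proj y.proj
  have hq : ContMDiffAt (IM.prod IS) 𝓘(𝕜, EM) 2 q z :=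
    (contMDiffAt_extChartAt_two z.proj).comp z ((contMDiffAt_proj z).of_le ENat.LEInfty.out)
  have hpc := (contMDiffAt_proj z).continuousAt
  have hcc := (mdifferentiableAt_coord hz).continuousAt
  have hΦc : MDifferentiableAt (IM.prod IS) 𝓘(𝕜, F →L[𝕜] F)
      (fun y : OrbitBundle IS S P hφ ↦ Φ (y.coord i)) z :=
    MDifferentiableAt.comp z (hΦ.contMDiffAt_self.mdifferentiableAt (n := ∞) (by simp))
      (mdifferentiableAt_coord hz)
  -- `Ψ y` is `ρ` on the tautological subspace at `y`, carried by `Φ` to the fixed space `p`. It is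
  -- injective at `z`; composing with a left inverse `L` of `Ψ z` gives endomorphisms `K y` of `p`,
  -- invertible near `z`, so that solving `Ψ y (b y) = dq(X y)` for `b` is differentiable.
  let Ψ : OrbitBundle IS S P hφ → p →L[𝕜] EM := fun y ↦
    r y.proj ∘L (Φ (y.coord i) ∘L p.subtypeL)
  have hΨ : MDifferentiableAt (IM.prod IS) 𝓘(𝕜, p →L[𝕜] EM) Ψ z :=
    (hr.comp z (mdifferentiableAt_proj z)).clm_comp (hΦc.clm_comp mdifferentiableAt_const)
  have hΨz : LinearMap.ker (Ψ z : p →ₗ[𝕜] EM) = ⊥ := by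
    rw [LinearMap.ker_eq_bot]
    intro f f' hff
    have h1 : ∀ f : p, Ψ z f = ρ z.proj (P.frame i z.proj f) := fun f ↦ by
      simp only [Ψ, ContinuousLinearMap.comp_apply, hΦ.apply_self]
      rw [← hrc.self_of_nhds, mvfderiv_extChartAt_self]
      rfl
    have h2 : ∀ f : p, P.frame i z.proj f ∈ z.subspace incl := fun f ↦ by
      rw [subspace_eq hsmul z hz]
      exact ⟨f, f.2, rfl⟩
    have h3 : Ψ z f = Ψ z f' := hff
    rw [h1, h1] at h3
    exact Subtype.ext ((P.frame i z.proj).injective (hinj (h2 f) (h2 f') h3))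
  obtain ⟨L, hL⟩ := (Ψ z : p →ₗ[𝕜] EM).exists_leftInverse_of_injective hΨz
  let L' : EM →L[𝕜] p := L.toContinuousLinearMap
  let K : OrbitBundle IS S P hφ → p →L[𝕜] p := fun y ↦ L' ∘L Ψ y
  have hK : MDifferentiableAt (IM.prod IS) 𝓘(𝕜, p →L[𝕜] p) K z :=
    mdifferentiableAt_const.clm_comp hΨ
  have hKz : K z = ((ContinuousLinearEquiv.refl 𝕜 p : p ≃L[𝕜] p) : p →L[𝕜] p) :=
    ContinuousLinearMap.ext fun f ↦ LinearMap.congr_fun hL f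
  have hKi : MDifferentiableAt (IM.prod IS) 𝓘(𝕜, p →L[𝕜] p) (fun y ↦ (K y).inverse) z := by
    have h := contDiffAt_map_inverse (𝕜 := 𝕜) (n := 1) (ContinuousLinearEquiv.refl 𝕜 p)
    rw [← hKz] at h
    exact (h.contMDiffAt.mdifferentiableAt one_ne_zero).comp z hK
  have hKu : ∀ᶠ y in 𝓝 z, (K y).IsInvertible := by
    have h := ContinuousLinearEquiv.nhds (ContinuousLinearEquiv.refl 𝕜 p)
    rw [← hKz] at h
    exact hK.continuousAt h
  let b : OrbitBundle IS S P hφ → p := fun y ↦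
    (K y).inverse (L' (mvfderiv (IM.prod IS) q y (X y)))
  have hb : MDifferentiableAt (IM.prod IS) 𝓘(𝕜, p) b z :=
    hKi.clm_apply (mdifferentiableAt_const.clm_apply (mdifferentiableAt_mvfderiv_apply hq hX))
  have hbp : MDifferentiableAt (IM.prod IS) 𝓘(𝕜, F) (fun y ↦ (b y : F)) z :=
    (mdifferentiableAt_const (c := p.subtypeL)).clm_apply hb
  have key : ∀ᶠ y in 𝓝 z, Φ (y.coord i) (b y) ∈ incl (y.coord i) ∧
      mvfderiv (IM.prod IS) q y (X y) = r y.proj (Φ (y.coord i) (b y)) := by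
    filter_upwards [hKu, hXd, eventually_proj_mem hz, hpc.eventually hrc,
      hcc.eventually hΦ.eq_map, hpc.eventually ((chartAt HM z.proj).open_source.mem_nhds
        (mem_chart_source HM z.proj))] with y h1 h2 h3 h4 h5 h6
    obtain ⟨-, f, hf, hfX⟩ := (mem_distribution_iff hsmul h3).1 h2
    have h7 : mvfderiv (IM.prod IS) q y (X y) = r y.proj f := by
      rw [mvfderiv_comp_apply_vec (mdifferentiableAt_extChartAt h6) (mdifferentiableAt_proj y), hfX,
        h4]
    have hf' := hf
    rw [h5] at hf'
    obtain ⟨c, hc, hcf⟩ := hf'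
    have h8 : b y = ⟨c, hc⟩ := by
      have h9 : r y.proj f = Ψ y ⟨c, hc⟩ := by rw [← hcf]; rfl
      simp only [b]
      rw [h7, h9]
      exact h1.inverse_apply_self _
    have h10 : Φ (y.coord i) (b y) = f := by rw [h8]; exact hcf
    rw [h10]
    exact ⟨hf, h7⟩
  exact ⟨fun y ↦ Φ (y.coord i) (b y), hΦc.clm_apply hbp, key.mono fun _ h ↦ h.1,
    key.mono fun _ h ↦ h.2⟩

end OrbitBundle

end Distribution

/-! ### Brackets of sections of `𝒞`, and the equivalence. -/

section Integrability

variable {𝕜 : Type*} [RCLike 𝕜]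
  {EM : Type*} [NormedAddCommGroup EM] [NormedSpace 𝕜 EM] [FiniteDimensional 𝕜 EM]
  {HM : Type*} [TopologicalSpace HM] {IM : ModelWithCorners 𝕜 EM HM} [IM.Boundaryless]
  {M : Type*} [TopologicalSpace M] [ChartedSpace HM M] [IsManifold IM ∞ M]
  {F : Type*} [NormedAddCommGroup F] [NormedSpace 𝕜 F] [FiniteDimensional 𝕜 F]
  {E : M → Type*} [TopologicalSpace (Bundle.TotalSpace F E)]
  [∀ x, AddCommGroup (E x)] [∀ x, Module 𝕜 (E x)] [∀ x, TopologicalSpace (E x)]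
  [∀ x, IsTopologicalAddGroup (E x)] [∀ x, ContinuousSMul 𝕜 (E x)]
  [FiberBundle F E] [VectorBundle 𝕜 F E] [ContMDiffVectorBundle ∞ F E IM]
  {EG : Type*} [NormedAddCommGroup EG] [NormedSpace 𝕜 EG] [FiniteDimensional 𝕜 EG]
  {HG : Type*} [TopologicalSpace HG] {IG : ModelWithCorners 𝕜 EG HG} [IG.Boundaryless]
  {G : Type*} [TopologicalSpace G] [ChartedSpace HG G] [Group G] [LieGroup IG ∞ G]
  {φ : G →* (F ≃L[𝕜] F)} {hφ : IsLinearLieGroup IG φ}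
  {ι : Type*} {P : GStructure IM IG E φ ι}
  {ES : Type*} [NormedAddCommGroup ES] [NormedSpace 𝕜 ES] [FiniteDimensional 𝕜 ES]
  {HS : Type*} [TopologicalSpace HS] {IS : ModelWithCorners 𝕜 ES HS} [IS.Boundaryless]
  {S : Type*} [TopologicalSpace S] [ChartedSpace HS S] [IsManifold IS ∞ S]
  [MulAction G S] [ContMDiffSMul IG IS ∞ G S]

namespace OrbitBundle

variable {cov : CovariantDerivative IM F E} {ρ : ∀ x, E x →L[𝕜] TangentSpace IM x}
  {z : OrbitBundle IS S P hφ} {i : ι} {incl : S → Submodule 𝕜 F}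
  {Γ : M → EM →L[𝕜] F →L[𝕜] F} {r : M → F →L[𝕜] EM}

/-- The coordinates on the base given by the chart at `x`, as functions on `Z`. -/
noncomputable def baseChart (x : M) (y : OrbitBundle IS S P hφ) : EM := extChartAt IM x y.proj

lemma contMDiffAt_baseChart (z : OrbitBundle IS S P hφ) :
    ContMDiffAt (IM.prod IS) 𝓘(𝕜, EM) 2 (baseChart z.proj : OrbitBundle IS S P hφ → EM) z :=
  (contMDiffAt_extChartAt_two z.proj).comp z ((contMDiffAt_proj z).of_le ENat.LEInfty.out)

lemma mvfderiv_baseChart {x : M} {y : OrbitBundle IS S P hφ}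
    (hy : y.proj ∈ (chartAt HM x).source) (W : TangentSpace (IM.prod IS) y) :
    mvfderiv (IM.prod IS) (baseChart x : OrbitBundle IS S P hφ → EM) y W
      = mvfderiv IM (extChartAt IM x) y.proj (mfderiv (IM.prod IS) IM proj y W) :=
  mvfderiv_comp_apply_vec (mdifferentiableAt_extChartAt hy) (mdifferentiableAt_proj y) W

lemma mvfderiv_baseChart_self (W : TangentSpace (IM.prod IS) z) :
    mvfderiv (IM.prod IS) (baseChart z.proj : OrbitBundle IS S P hφ → EM) z W
      = mfderiv (IM.prod IS) IM proj z W :=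
  (mvfderiv_baseChart (mem_chart_source HM z.proj) W).trans (mvfderiv_extChartAt_self _ _)

lemma mvfderiv_comp_proj {V : Type*} [NormedAddCommGroup V] [NormedSpace 𝕜 V] {A : M → V}
    (hA : MDifferentiableAt IM 𝓘(𝕜, V) A z.proj) (W : TangentSpace (IM.prod IS) z) :
    mvfderiv (IM.prod IS) (fun y : OrbitBundle IS S P hφ ↦ A y.proj) z W
      = derivInChart IM A z.proj (mvfderiv (IM.prod IS)
        (baseChart z.proj : OrbitBundle IS S P hφ → EM) z W) := by
  rw [mvfderiv_comp_apply_vec hA (mdifferentiableAt_proj z), mvfderiv_baseChart_self]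
  rfl

/-- The centre `x` of the chart is kept independent of `z`, so that the chart may stay fixed while
the point varies. This is needed before differentiating a second time. -/
lemma covAlong_mem (hincl : IsGrassmannianSubmanifold IS incl)
    (hsmul : ∀ (g : G) (s : S), incl (g • s) = (incl s).map ((φ g : F →L[𝕜] F) : F →ₗ[𝕜] F))
    {x : M} (hz : z.proj ∈ P.baseSet i) (hzc : z.proj ∈ (chartAt HM x).source)
    (hΓc : ∀ (v : TangentSpace IM z.proj) (ξ : F),
        Γ z.proj (mvfderiv IM (extChartAt IM x) z.proj v) ξ = P.connectionForm cov i z.proj v ξ)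
    {W : TangentSpace (IM.prod IS) z} (hW : W ∈ z.horizontal cov)
    {g : OrbitBundle IS S P hφ → F} (hg : MDifferentiableAt (IM.prod IS) 𝓘(𝕜, F) g z)
    (hgi : ∀ᶠ y : OrbitBundle IS S P hφ in 𝓝 z, g y ∈ incl (y.coord i)) :
    covAlong (IM.prod IS) (baseChart x) (fun y : OrbitBundle IS S P hφ ↦ Γ y.proj) g z W
      ∈ incl (z.coord i) := by
  have h0 : IsHorizontalIn cov i z W := hW i hz
  have h := h0.mem_incl hincl hsmul hz hg hgi
  rwa [← hΓc, ← mvfderiv_baseChart hzc] at h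

lemma eventually_covAlong_mem (hincl : IsGrassmannianSubmanifold IS incl)
    (hsmul : ∀ (g : G) (s : S), incl (g • s) = (incl s).map ((φ g : F →L[𝕜] F) : F →ₗ[𝕜] F))
    (hz : z.proj ∈ P.baseSet i)
    (hΓc : ∀ᶠ y in 𝓝 z.proj, ∀ (v : TangentSpace IM y) (ξ : F),
        Γ y (mvfderiv IM (extChartAt IM z.proj) y v) ξ = P.connectionForm cov i y v ξ)
    {X : ∀ y : OrbitBundle IS S P hφ, TangentSpace (IM.prod IS) y}
    (hX : ∀ᶠ y in 𝓝 z, X y ∈ y.horizontal cov)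
    {g : OrbitBundle IS S P hφ → F}
    (hg : ∀ᶠ y in 𝓝 z, MDifferentiableAt (IM.prod IS) 𝓘(𝕜, F) g y)
    (hgi : ∀ᶠ y : OrbitBundle IS S P hφ in 𝓝 z, g y ∈ incl (y.coord i)) :
    ∀ᶠ y in 𝓝 z, covAlong (IM.prod IS) (baseChart z.proj)
      (fun y : OrbitBundle IS S P hφ ↦ Γ y.proj) g y (X y) ∈ incl (y.coord i) := by
  have hpc := (contMDiffAt_proj z).continuousAt
  filter_upwards [hpc.eventually hΓc, eventually_proj_mem hz, hX, hg, hgi.eventually_nhds,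
    hpc.eventually ((chartAt HM z.proj).open_source.mem_nhds (mem_chart_source HM z.proj))]
    with y h1 h2 h3 h4 h5 h6
  exact covAlong_mem hincl hsmul h2 h6 h1 h3 h4 h5

/-- The bracket of two horizontal vector fields moves a tautological function `g` out of the
tautological subspace by the curvature. -/
theorem covAlong_mlieBracket_add_curvatureOf_mem (hincl : IsGrassmannianSubmanifold IS incl)
    (hsmul : ∀ (g : G) (s : S), incl (g • s) = (incl s).map ((φ g : F →L[𝕜] F) : F →ₗ[𝕜] F))
    (hz : z.proj ∈ P.baseSet i)
    (hΓ : MDifferentiableAt IM 𝓘(𝕜, EM →L[𝕜] F →L[𝕜] F) Γ z.proj)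
    (hΓc : ∀ᶠ y in 𝓝 z.proj, ∀ (v : TangentSpace IM y) (ξ : F),
        Γ y (mvfderiv IM (extChartAt IM z.proj) y v) ξ = P.connectionForm cov i y v ξ)
    {X Y : ∀ y : OrbitBundle IS S P hφ, TangentSpace (IM.prod IS) y}
    (hX : MDifferentiableAt (IM.prod IS) (IM.prod IS).tangent
        (fun y ↦ (⟨y, X y⟩ : TangentBundle (IM.prod IS) (OrbitBundle IS S P hφ))) z)
    (hY : MDifferentiableAt (IM.prod IS) (IM.prod IS).tangent
        (fun y ↦ (⟨y, Y y⟩ : TangentBundle (IM.prod IS) (OrbitBundle IS S P hφ))) z)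
    (hXh : ∀ᶠ y in 𝓝 z, X y ∈ y.horizontal cov) (hYh : ∀ᶠ y in 𝓝 z, Y y ∈ y.horizontal cov)
    {g : OrbitBundle IS S P hφ → F} (hg : ContMDiffAt (IM.prod IS) 𝓘(𝕜, F) 2 g z)
    (hgi : ∀ᶠ y : OrbitBundle IS S P hφ in 𝓝 z, g y ∈ incl (y.coord i)) :
    covAlong (IM.prod IS) (baseChart z.proj) (fun y : OrbitBundle IS S P hφ ↦ Γ y.proj) g z
        (VectorField.mlieBracket (IM.prod IS) X Y z)
      + curvatureOf (derivInChart IM Γ z.proj) (Γ z.proj)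
        (mfderiv (IM.prod IS) IM proj z (X z)) (mfderiv (IM.prod IS) IM proj z (Y z)) (g z)
      ∈ incl (z.coord i) := by
  have : CompleteSpace (EM × ES) := FiniteDimensional.complete 𝕜 _
  have hq := contMDiffAt_baseChart z
  have hΓp : MDifferentiableAt (IM.prod IS) 𝓘(𝕜, EM →L[𝕜] F →L[𝕜] F)
      (fun y : OrbitBundle IS S P hφ ↦ Γ y.proj) z := hΓ.comp z (mdifferentiableAt_proj z)
  have h1 := covAlong_commutator hq hΓp (mvfderiv_comp_proj hΓ) hg hX hY
  have hg1 : ∀ᶠ y in 𝓝 z, MDifferentiableAt (IM.prod IS) 𝓘(𝕜, F) g y := by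
    filter_upwards [(contMDiffAt_iff_contMDiffAt_nhds (by simp)).1 hg] with y hy
      using hy.mdifferentiableAt two_ne_zero
  have hmem : ∀ X Y : ∀ y : OrbitBundle IS S P hφ, TangentSpace (IM.prod IS) y,
      MDifferentiableAt (IM.prod IS) (IM.prod IS).tangent
        (fun y ↦ (⟨y, Y y⟩ : TangentBundle (IM.prod IS) (OrbitBundle IS S P hφ))) z →
      (∀ᶠ y in 𝓝 z, X y ∈ y.horizontal cov) → (∀ᶠ y in 𝓝 z, Y y ∈ y.horizontal cov) →
      covAlong (IM.prod IS) (baseChart z.proj) (fun y : OrbitBundle IS S P hφ ↦ Γ y.proj)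
        (fun y ↦ covAlong (IM.prod IS) (baseChart z.proj)
          (fun y : OrbitBundle IS S P hφ ↦ Γ y.proj) g y (Y y)) z (X z) ∈ incl (z.coord i) :=
    fun X Y hY hXh hYh ↦ covAlong_mem hincl hsmul hz (mem_chart_source HM z.proj)
      hΓc.self_of_nhds hXh.self_of_nhds (mdifferentiableAt_covAlong hq hΓp hg hY)
      (eventually_covAlong_mem hincl hsmul hz hΓc hYh hg1 hgi)
  have h2 := sub_mem (hmem X Y hY hXh hYh) (hmem Y X hX hYh hXh)
  rw [mvfderiv_baseChart_self, mvfderiv_baseChart_self] at h1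
  rw [← h1]
  convert h2 using 1
  abel

/-- The projection of the bracket of two horizontal vector fields which project to tautological
sections. -/
theorem exists_mfderiv_proj_mlieBracket_eq (hincl : IsGrassmannianSubmanifold IS incl)
    (hsmul : ∀ (g : G) (s : S), incl (g • s) = (incl s).map ((φ g : F →L[𝕜] F) : F →ₗ[𝕜] F))
    (hcov : IsSmoothConnection IM cov)
    (hρ : ContMDiff IM (IM.prod 𝓘(𝕜, F →L[𝕜] EM)) ∞
      (fun x ↦ Bundle.TotalSpace.mk' (F →L[𝕜] EM)
        (E := fun x ↦ E x →L[𝕜] TangentSpace IM x) x (ρ x)))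
    (hinj : Set.InjOn (ρ z.proj) (z.subspace incl)) (hz : z.proj ∈ P.baseSet i)
    {X Y : ∀ y : OrbitBundle IS S P hφ, TangentSpace (IM.prod IS) y}
    (hX : MDifferentiableAt (IM.prod IS) (IM.prod IS).tangent
        (fun y ↦ (⟨y, X y⟩ : TangentBundle (IM.prod IS) (OrbitBundle IS S P hφ))) z)
    (hY : MDifferentiableAt (IM.prod IS) (IM.prod IS).tangent
        (fun y ↦ (⟨y, Y y⟩ : TangentBundle (IM.prod IS) (OrbitBundle IS S P hφ))) z)
    (hXd : ∀ᶠ y in 𝓝 z, X y ∈ y.distribution cov ρ incl)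
    (hYd : ∀ᶠ y in 𝓝 z, Y y ∈ y.distribution cov ρ incl)
    {e f : F} (he : e ∈ incl (z.coord i)) (hf : f ∈ incl (z.coord i))
    (hXe : mfderiv (IM.prod IS) IM proj z (X z) = ρ z.proj (P.frame i z.proj e))
    (hYf : mfderiv (IM.prod IS) IM proj z (Y z) = ρ z.proj (P.frame i z.proj f)) :
    ∃ h ∈ incl (z.coord i),
      mfderiv (IM.prod IS) IM proj z (VectorField.mlieBracket (IM.prod IS) X Y z)
        = ρ z.proj (P.frame i z.proj h)
          - anchoredTorsion IM cov ρ z.proj (P.frame i z.proj e) (P.frame i z.proj f) := by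
  have : CompleteSpace (EM × ES) := FiniteDimensional.complete 𝕜 _
  obtain ⟨Γ, hΓ, hΓc⟩ := P.exists_connectionForm_coord cov hcov hz
  obtain ⟨r, hr, hrc⟩ := P.exists_anchor_coord hz hρ
  have hr' := hr.mdifferentiableAt (by simp)
  obtain ⟨e', he', hei, hXe'⟩ := exists_tautological_lift hincl hsmul hinj hz hr' hrc hX hXd
  obtain ⟨f', hf', hfi, hYf'⟩ := exists_tautological_lift hincl hsmul hinj hz hr' hrc hY hYd
  have hrz : ∀ ξ, r z.proj ξ = ρ z.proj (P.frame i z.proj ξ) := fun ξ ↦ by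
    rw [← hrc.self_of_nhds, mvfderiv_extChartAt_self]
  have heq : ∀ a ∈ incl (z.coord i), ∀ b ∈ incl (z.coord i),
      ρ z.proj (P.frame i z.proj a) = ρ z.proj (P.frame i z.proj b) → a = b := by
    intro a ha b hb hab
    have hs : ∀ a ∈ incl (z.coord i), P.frame i z.proj a ∈ z.subspace incl := fun a ha ↦ by
      rw [subspace_eq hsmul z hz]
      exact ⟨a, ha, rfl⟩
    exact (P.frame i z.proj).injective (hinj (hs a ha) (hs b hb) hab)
  -- Both have the same image under `ρ ∘ u`, which is injective on the tautological subspace.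
  have hez : e' z = e := heq _ hei.self_of_nhds _ he
    ((hrz _).symm.trans ((hXe'.self_of_nhds.symm.trans (mvfderiv_baseChart_self _)).trans hXe))
  have hfz : f' z = f := heq _ hfi.self_of_nhds _ hf
    ((hrz _).symm.trans ((hYf'.self_of_nhds.symm.trans (mvfderiv_baseChart_self _)).trans hYf))
  have hrp : MDifferentiableAt (IM.prod IS) 𝓘(𝕜, F →L[𝕜] EM)
      (fun y : OrbitBundle IS S P hφ ↦ r y.proj) z := hr'.comp z (mdifferentiableAt_proj z)
  have h1 := mvfderiv_mlieBracket_eq_sub_torsionOf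
    (G := fun y : OrbitBundle IS S P hφ ↦ Γ y.proj) (contMDiffAt_baseChart z) hrp
    (mvfderiv_comp_proj hr') he' hf' hX hY hXe' hYf'
  have h2 := anchoredTorsion_eq P cov hz hΓc hρ hr' hrc (P.frame i z.proj e) (P.frame i z.proj f)
  rw [mvfderiv_extChartAt_self, ContinuousLinearEquiv.symm_apply_apply,
    ContinuousLinearEquiv.symm_apply_apply] at h2
  rw [mvfderiv_baseChart_self, hez, hfz, ← h2, hrz] at h1
  -- The vector is `D_X f' - D_Y e'`, tautological because `X`, `Y` are horizontal and `e'`, `f'`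
  -- are tautological.
  refine ⟨_, sub_mem ?_ ?_, h1⟩
  · exact covAlong_mem hincl hsmul hz (mem_chart_source HM z.proj) hΓc.self_of_nhds
      hXd.self_of_nhds.1 hf' hfi
  · exact covAlong_mem hincl hsmul hz (mem_chart_source HM z.proj) hΓc.self_of_nhds
      hYd.self_of_nhds.1 he' hei

variable (z) in
/-- The restriction on the curvature and on the torsion at `z` which characterises integrability. -/
def CurvatureTorsionCondition (cov : CovariantDerivative IM F E)
    (ρ : ∀ x, E x →L[𝕜] TangentSpace IM x) (incl : S → Submodule 𝕜 F) : Prop :=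
  (∀ e₁ ∈ z.subspace incl, ∀ e₂ ∈ z.subspace incl, ∀ e₃ ∈ z.subspace incl,
    connectionCurvature IM cov z.proj (ρ z.proj e₁) (ρ z.proj e₂) e₃ ∈ z.subspace incl) ∧
  (∀ e₁ ∈ z.subspace incl, ∀ e₂ ∈ z.subspace incl,
    ∃ e ∈ z.subspace incl, anchoredTorsion IM cov ρ z.proj e₁ e₂ = ρ z.proj e)

theorem mlieBracket_mem_distribution (hincl : IsGrassmannianSubmanifold IS incl)
    (hsmul : ∀ (g : G) (s : S), incl (g • s) = (incl s).map ((φ g : F →L[𝕜] F) : F →ₗ[𝕜] F))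
    (hcov : IsSmoothConnection IM cov) (hcomp : P.IsCompatible cov)
    (hρ : ContMDiff IM (IM.prod 𝓘(𝕜, F →L[𝕜] EM)) ∞
      (fun x ↦ Bundle.TotalSpace.mk' (F →L[𝕜] EM)
        (E := fun x ↦ E x →L[𝕜] TangentSpace IM x) x (ρ x)))
    (hinj : Set.InjOn (ρ z.proj) (z.subspace incl))
    (hRT : CurvatureTorsionCondition z cov ρ incl)
    {X Y : ∀ y : OrbitBundle IS S P hφ, TangentSpace (IM.prod IS) y}
    (hX : MDifferentiableAt (IM.prod IS) (IM.prod IS).tangent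
        (fun y ↦ (⟨y, X y⟩ : TangentBundle (IM.prod IS) (OrbitBundle IS S P hφ))) z)
    (hY : MDifferentiableAt (IM.prod IS) (IM.prod IS).tangent
        (fun y ↦ (⟨y, Y y⟩ : TangentBundle (IM.prod IS) (OrbitBundle IS S P hφ))) z)
    (hXd : ∀ᶠ y in 𝓝 z, X y ∈ y.distribution cov ρ incl)
    (hYd : ∀ᶠ y in 𝓝 z, Y y ∈ y.distribution cov ρ incl) :
    VectorField.mlieBracket (IM.prod IS) X Y z ∈ z.distribution cov ρ incl := by
  have hs : ∀ i, z.proj ∈ P.baseSet i → ∀ a, a ∈ incl (z.coord i) ↔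
      P.frame i z.proj a ∈ z.subspace incl := fun i hi a ↦ by
    rw [subspace_eq hsmul z hi]
    refine ⟨fun h ↦ ⟨a, h, rfl⟩, ?_⟩
    rintro ⟨b, hb, hab⟩
    rwa [← (P.frame i z.proj).injective hab]
  have hXY : ∀ i, z.proj ∈ P.baseSet i →
      ∃ e ∈ incl (z.coord i), ∃ f ∈ incl (z.coord i),
        mfderiv (IM.prod IS) IM proj z (X z) = ρ z.proj (P.frame i z.proj e) ∧
        mfderiv (IM.prod IS) IM proj z (Y z) = ρ z.proj (P.frame i z.proj f) := by
    intro i hi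
    obtain ⟨-, e, he, hXe⟩ := (mem_distribution_iff hsmul hi).1 hXd.self_of_nhds
    obtain ⟨-, f, hf, hYf⟩ := (mem_distribution_iff hsmul hi).1 hYd.self_of_nhds
    exact ⟨e, he, f, hf, hXe, hYf⟩
  have hi := P.mem_baseSet_at z.proj
  set i := P.indexAt z.proj
  obtain ⟨e, he, f, hf, hXe, hYf⟩ := hXY i hi
  refine (mem_distribution_iff hsmul hi).2 ⟨?_, ?_⟩
  · refine mem_horizontal_of_isHorizontalIn hincl hsmul hcomp hi ?_
    obtain ⟨Φ, hΦ⟩ := hincl.exists_isMovingFrame (z.coord i)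
    obtain ⟨Γ, hΓ, hΓc⟩ := P.exists_connectionForm_coord cov hcov hi
    have hΓ' := hΓ.mdifferentiableAt (by simp)
    refine isHorizontalIn_of_forall_mem hsmul hcomp hΦ hi fun a ha ↦ ?_
    have hg : ContMDiffAt (IM.prod IS) 𝓘(𝕜, F) 2
        (fun y : OrbitBundle IS S P hφ ↦ Φ (y.coord i) a) z :=
      ((hΦ.contMDiffAt_self.comp z (contMDiffAt_coord hi)).of_le ENat.LEInfty.out).clm_apply
        contMDiffAt_const
    have hgi : ∀ᶠ y : OrbitBundle IS S P hφ in 𝓝 z, Φ (y.coord i) a ∈ incl (y.coord i) := by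
      filter_upwards [(mdifferentiableAt_coord hi).continuousAt.eventually hΦ.eq_map] with y hy
      rw [hy]
      exact ⟨a, ha, rfl⟩
    have h1 := covAlong_mlieBracket_add_curvatureOf_mem hincl hsmul hi hΓ' hΓc hX hY
      (hXd.mono fun _ h ↦ h.1) (hYd.mono fun _ h ↦ h.1) hg hgi
    have hga : Φ (z.coord i) a = a := by rw [hΦ.apply_self]; rfl
    have h2 := hRT.1 _ ((hs i hi e).1 he) _ ((hs i hi f).1 hf) _ ((hs i hi a).1 ha)
    rw [connectionCurvature_eq P cov hi hΓ' hΓc, ← hs i hi, mvfderiv_extChartAt_self,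
      mvfderiv_extChartAt_self, ContinuousLinearEquiv.symm_apply_apply, ← hXe, ← hYf] at h2
    rw [hga] at h1
    -- The curvature term is in `p` by assumption, so `D_[X,Y]` keeps the test function `Φ a` in
    -- `p`, which is the criterion for horizontality.
    have h3 := (add_mem_cancel_right h2).1 h1
    rwa [covAlong, mvfderiv_baseChart (mem_chart_source HM z.proj), hΓc.self_of_nhds, hga] at h3
  · obtain ⟨h, hh, hB⟩ := exists_mfderiv_proj_mlieBracket_eq hincl hsmul hcov hρ hinj hi hX hY hXd
      hYd he hf hXe hYf
    obtain ⟨e', he', hT⟩ := hRT.2 _ ((hs i hi e).1 he) _ ((hs i hi f).1 hf)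
    refine ⟨h - (P.frame i z.proj).symm e', sub_mem hh ?_, ?_⟩
    · rw [hs i hi, ContinuousLinearEquiv.apply_symm_apply]
      exact he'
    · rw [hB, hT, map_sub, map_sub, ContinuousLinearEquiv.apply_symm_apply]

/-- There are sections of `𝒞` near `z` with any given projection at `z`. -/
theorem exists_section_distribution (hincl : IsGrassmannianSubmanifold IS incl)
    (hsmul : ∀ (g : G) (s : S), incl (g • s) = (incl s).map ((φ g : F →L[𝕜] F) : F →ₗ[𝕜] F))
    (hcov : IsSmoothConnection IM cov) (hcomp : P.IsCompatible cov)
    (hρ : ContMDiff IM (IM.prod 𝓘(𝕜, F →L[𝕜] EM)) ∞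
      (fun x ↦ Bundle.TotalSpace.mk' (F →L[𝕜] EM)
        (E := fun x ↦ E x →L[𝕜] TangentSpace IM x) x (ρ x)))
    (hz : z.proj ∈ P.baseSet i) {f : F} (hf : f ∈ incl (z.coord i)) :
    ∃ X : ∀ y : OrbitBundle IS S P hφ, TangentSpace (IM.prod IS) y,
      (∀ᶠ y in 𝓝 z, ContMDiffAt (IM.prod IS) (IM.prod IS).tangent ∞
        (fun y ↦ (⟨y, X y⟩ : TangentBundle (IM.prod IS) (OrbitBundle IS S P hφ))) y) ∧
      (∀ᶠ y in 𝓝 z, X y ∈ y.distribution cov ρ incl) ∧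
      mfderiv (IM.prod IS) IM proj z (X z) = ρ z.proj (P.frame i z.proj f) := by
  obtain ⟨Φ, hΦ⟩ := hincl.exists_isMovingFrame (z.coord i)
  have hcc := (mdifferentiableAt_coord hz).continuousAt
  -- The vector `f` is extended to the tautological function `Φ f`; the horizontal lift of its image
  -- under `ρ ∘ u` is the required section.
  have hv : ∀ᶠ y in 𝓝 z, ContMDiffAt (IM.prod IS) IM.tangent ∞
      (fun y : OrbitBundle IS S P hφ ↦ (⟨y.proj, ρ y.proj (P.frame i y.proj (Φ (y.coord i) f))⟩ :
        TangentBundle IM M)) y := by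
    filter_upwards [eventually_proj_mem hz, hcc.eventually hΦ.contMDiffAt] with y hy hΦy
    have h1 : ContMDiffAt (IM.prod IS) 𝓘(𝕜, F) ∞
        (fun y : OrbitBundle IS S P hφ ↦ Φ (y.coord i) f) y :=
      (hΦy.comp y (contMDiffAt_coord hy)).clm_apply contMDiffAt_const
    have h2 := P.contMDiffAt_frame_apply_along hy (contMDiffAt_proj y) h1
    exact ContMDiffAt.clm_bundle_apply ((hρ y.proj).comp y (contMDiffAt_proj y)) h2
  obtain ⟨X, hX⟩ := exists_horizontal_lift hincl hsmul hcov hcomp hz hv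
  refine ⟨X, hX.mono fun _ h ↦ h.1, ?_, ?_⟩
  · filter_upwards [hX, eventually_proj_mem hz, hcc.eventually hΦ.eq_map] with y h1 h2 h3
    refine (mem_distribution_iff hsmul h2).2 ⟨h1.2.1, _, ?_, h1.2.2⟩
    rw [h3]
    exact ⟨f, hf, rfl⟩
  · rw [hX.self_of_nhds.2.2, hΦ.apply_self]
    rfl

/-- The vectors in `p` at which `R` and `T` are tested are realised by sections of `𝒞` and by the
functions `Φ a`. Since their bracket is in `𝒞`, the same two identities can be read in the opposite
direction. -/
theorem curvatureTorsionCondition_of_isIntegrable (hincl : IsGrassmannianSubmanifold IS incl)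
    (hsmul : ∀ (g : G) (s : S), incl (g • s) = (incl s).map ((φ g : F →L[𝕜] F) : F →ₗ[𝕜] F))
    (hcov : IsSmoothConnection IM cov) (hcomp : P.IsCompatible cov)
    (hρ : ContMDiff IM (IM.prod 𝓘(𝕜, F →L[𝕜] EM)) ∞
      (fun x ↦ Bundle.TotalSpace.mk' (F →L[𝕜] EM)
        (E := fun x ↦ E x →L[𝕜] TangentSpace IM x) x (ρ x)))
    (hinj : Set.InjOn (ρ z.proj) (z.subspace incl))
    (hint : IsIntegrableDistribution (IM.prod IS)
        (fun z : OrbitBundle IS S P hφ ↦ z.distribution cov ρ incl)) :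
    CurvatureTorsionCondition z cov ρ incl := by
  have hi := P.mem_baseSet_at z.proj
  set i := P.indexAt z.proj
  obtain ⟨Γ, hΓ, hΓc⟩ := P.exists_connectionForm_coord cov hcov hi
  have hΓ' := hΓ.mdifferentiableAt (by simp)
  have hbr : ∀ e ∈ incl (z.coord i), ∀ f ∈ incl (z.coord i),
      ∃ X Y : ∀ y : OrbitBundle IS S P hφ, TangentSpace (IM.prod IS) y,
      MDifferentiableAt (IM.prod IS) (IM.prod IS).tangent
        (fun y ↦ (⟨y, X y⟩ : TangentBundle (IM.prod IS) (OrbitBundle IS S P hφ))) z ∧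
      MDifferentiableAt (IM.prod IS) (IM.prod IS).tangent
        (fun y ↦ (⟨y, Y y⟩ : TangentBundle (IM.prod IS) (OrbitBundle IS S P hφ))) z ∧
      (∀ᶠ y in 𝓝 z, X y ∈ y.distribution cov ρ incl) ∧
      (∀ᶠ y in 𝓝 z, Y y ∈ y.distribution cov ρ incl) ∧
      mfderiv (IM.prod IS) IM proj z (X z) = ρ z.proj (P.frame i z.proj e) ∧
      mfderiv (IM.prod IS) IM proj z (Y z) = ρ z.proj (P.frame i z.proj f) ∧
      VectorField.mlieBracket (IM.prod IS) X Y z ∈ z.distribution cov ρ incl := by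
    intro e he f hf
    obtain ⟨X, hX, hXd, hXe⟩ :=
      exists_section_distribution (ρ := ρ) hincl hsmul hcov hcomp hρ hi he
    obtain ⟨Y, hY, hYd, hYf⟩ :=
      exists_section_distribution (ρ := ρ) hincl hsmul hcov hcomp hρ hi hf
    -- Integrability is a statement about open sets, so the germs of `X` and `Y` are restricted to a
    -- common one.
    obtain ⟨U, hU, hUo, hzU⟩ := eventually_nhds_iff.1 (hX.and (hY.and (hXd.and hYd)))
    exact ⟨X, Y, hX.self_of_nhds.mdifferentiableAt (by simp),
      hY.self_of_nhds.mdifferentiableAt (by simp), hXd, hYd, hXe, hYf,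
      hint U hUo X Y (fun y hy ↦ (hU y hy).1.contMDiffWithinAt)
        (fun y hy ↦ (hU y hy).2.1.contMDiffWithinAt) (fun y hy ↦ (hU y hy).2.2.1)
        (fun y hy ↦ (hU y hy).2.2.2) z hzU⟩
  rw [CurvatureTorsionCondition, subspace_eq hsmul z hi]
  constructor
  · rintro _ ⟨e, he, rfl⟩ _ ⟨f, hf, rfl⟩ _ ⟨a, ha, rfl⟩
    obtain ⟨X, Y, hX, hY, hXd, hYd, hXe, hYf, hB⟩ := hbr e he f hf
    obtain ⟨Φ, hΦ⟩ := hincl.exists_isMovingFrame (z.coord i)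
    have hg : ContMDiffAt (IM.prod IS) 𝓘(𝕜, F) 2
        (fun y : OrbitBundle IS S P hφ ↦ Φ (y.coord i) a) z :=
      ((hΦ.contMDiffAt_self.comp z (contMDiffAt_coord hi)).of_le ENat.LEInfty.out).clm_apply
        contMDiffAt_const
    have hgi : ∀ᶠ y : OrbitBundle IS S P hφ in 𝓝 z, Φ (y.coord i) a ∈ incl (y.coord i) := by
      filter_upwards [(mdifferentiableAt_coord hi).continuousAt.eventually hΦ.eq_map] with y hy
      rw [hy]
      exact ⟨a, ha, rfl⟩
    have h1 := covAlong_mlieBracket_add_curvatureOf_mem hincl hsmul hi hΓ' hΓc hX hY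
      (hXd.mono fun _ h ↦ h.1) (hYd.mono fun _ h ↦ h.1) hg hgi
    have h2 := covAlong_mem hincl hsmul hi (mem_chart_source HM z.proj) hΓc.self_of_nhds hB.1
      (hg.mdifferentiableAt two_ne_zero) hgi
    have h3 := (add_mem_cancel_left h2).1 h1
    have hga : Φ (z.coord i) a = a := by rw [hΦ.apply_self]; rfl
    rw [hga, hXe, hYf] at h3
    refine ⟨_, h3, ?_⟩
    have h4 := connectionCurvature_eq P cov hi hΓ' hΓc (ρ z.proj (P.frame i z.proj e))
      (ρ z.proj (P.frame i z.proj f)) (P.frame i z.proj a)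
    rw [mvfderiv_extChartAt_self, mvfderiv_extChartAt_self,
      ContinuousLinearEquiv.symm_apply_apply] at h4
    exact h4.symm
  · rintro _ ⟨e, he, rfl⟩ _ ⟨f, hf, rfl⟩
    obtain ⟨X, Y, hX, hY, hXd, hYd, hXe, hYf, hB⟩ := hbr e he f hf
    obtain ⟨h, hh, hB'⟩ := exists_mfderiv_proj_mlieBracket_eq hincl hsmul hcov hρ hinj hi hX hY
      hXd hYd he hf hXe hYf
    obtain ⟨-, b, hb, hBb⟩ := (mem_distribution_iff hsmul hi).1 hB
    refine ⟨P.frame i z.proj (h - b), ⟨h - b, sub_mem hh hb, rfl⟩, ?_⟩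
    rw [map_sub, map_sub, ← hBb, hB', sub_sub_cancel]
    rfl

end OrbitBundle

end Integrability

theorem proposition1p4
    {𝕜 : Type*} [RCLike 𝕜]
    -- the base manifold `M`
    {EM : Type*} [NormedAddCommGroup EM] [NormedSpace 𝕜 EM] [FiniteDimensional 𝕜 EM]
    {HM : Type*} [TopologicalSpace HM] {IM : ModelWithCorners 𝕜 EM HM} [IM.Boundaryless]
    {M : Type*} [TopologicalSpace M] [ChartedSpace HM M] [IsManifold IM ∞ M]
    -- the vector bundle `E`, with typical fibre `F`
    {F : Type*} [NormedAddCommGroup F] [NormedSpace 𝕜 F] [FiniteDimensional 𝕜 F]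
    {E : M → Type*} [TopologicalSpace (Bundle.TotalSpace F E)]
    [∀ x, AddCommGroup (E x)] [∀ x, Module 𝕜 (E x)] [∀ x, TopologicalSpace (E x)]
    [∀ x, IsTopologicalAddGroup (E x)] [∀ x, ContinuousSMul 𝕜 (E x)]
    [FiberBundle F E] [VectorBundle 𝕜 F E] [ContMDiffVectorBundle ∞ F E IM]
    -- the structural group `G`, a Lie subgroup of the general linear group of `F`
    {EG : Type*} [NormedAddCommGroup EG] [NormedSpace 𝕜 EG] [FiniteDimensional 𝕜 EG]
    {HG : Type*} [TopologicalSpace HG] {IG : ModelWithCorners 𝕜 EG HG} [IG.Boundaryless]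
    {G : Type*} [TopologicalSpace G] [ChartedSpace HG G] [Group G] [LieGroup IG ∞ G]
    {φ : G →* (F ≃L[𝕜] F)} (hφ : IsLinearLieGroup IG φ)
    {ι : Type*} (P : GStructure IM IG E φ ι)
    -- the submanifold `S` of a Grassmannian of `F`, on which `G` acts transitively
    {ES : Type*} [NormedAddCommGroup ES] [NormedSpace 𝕜 ES] [FiniteDimensional 𝕜 ES]
    {HS : Type*} [TopologicalSpace HS] {IS : ModelWithCorners 𝕜 ES HS} [IS.Boundaryless]
    {S : Type*} [TopologicalSpace S] [ChartedSpace HS S] [IsManifold IS ∞ S]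
    [MulAction G S] [ContMDiffSMul IG IS ∞ G S] [MulAction.IsPretransitive G S]
    (incl : S → Submodule 𝕜 F) (hincl : IsGrassmannianSubmanifold IS incl)
    (hsmul : ∀ (g : G) (s : S),
      incl (g • s) = (incl s).map ((φ g : F →L[𝕜] F) : F →ₗ[𝕜] F))
    -- the connection `∇` on `E`, compatible with `G`
    (cov : CovariantDerivative IM F E) (hcov : IsSmoothConnection IM cov)
    (hcomp : P.IsCompatible cov)
    -- the morphism of vector bundles `ρ : E → TM`, injective on each `p ∈ Z`
    (ρ : ∀ x, E x →L[𝕜] TangentSpace IM x)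
    (hρ : ContMDiff IM (IM.prod 𝓘(𝕜, F →L[𝕜] EM)) ∞
      (fun x ↦ Bundle.TotalSpace.mk' (F →L[𝕜] EM)
        (E := fun x ↦ E x →L[𝕜] TangentSpace IM x) x (ρ x)))
    (hinj : ∀ z : OrbitBundle IS S P hφ, Set.InjOn (ρ z.proj) (z.subspace incl)) :
    (IsIntegrableDistribution (IM.prod IS)
        (fun z : OrbitBundle IS S P hφ ↦ z.distribution cov ρ incl) ↔
      ∀ z : OrbitBundle IS S P hφ,
        (∀ e₁ ∈ z.subspace incl, ∀ e₂ ∈ z.subspace incl, ∀ e₃ ∈ z.subspace incl,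
          connectionCurvature IM cov z.proj (ρ z.proj e₁) (ρ z.proj e₂) e₃ ∈ z.subspace incl) ∧
        (∀ e₁ ∈ z.subspace incl, ∀ e₂ ∈ z.subspace incl,
          ∃ e ∈ z.subspace incl, anchoredTorsion IM cov ρ z.proj e₁ e₂ = ρ z.proj e)) ∧
    ((∀ (x : M) (e₁ e₂ : E x), anchoredTorsion IM cov ρ x e₁ e₂ = 0) →
      IsIntegrableDistribution (IM.prod IS)
        (fun z : OrbitBundle IS S P hφ ↦ z.distribution cov ρ incl) →
      ∀ z : OrbitBundle IS S P hφ,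
        ∀ e₁ ∈ z.subspace incl, ∀ e₂ ∈ z.subspace incl, ∀ e₃ ∈ z.subspace incl,
          connectionCurvature IM cov z.proj (ρ z.proj e₁) (ρ z.proj e₂) e₃
            + connectionCurvature IM cov z.proj (ρ z.proj e₂) (ρ z.proj e₃) e₁
            + connectionCurvature IM cov z.proj (ρ z.proj e₃) (ρ z.proj e₁) e₂ = 0) := by
  have hiff : IsIntegrableDistribution (IM.prod IS)
        (fun z : OrbitBundle IS S P hφ ↦ z.distribution cov ρ incl) ↔
      ∀ z : OrbitBundle IS S P hφ, z.CurvatureTorsionCondition cov ρ incl := by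
    constructor
    · intro hint z
      exact OrbitBundle.curvatureTorsionCondition_of_isIntegrable hincl hsmul hcov hcomp hρ (hinj z)
        hint
    · intro hRT U hU X Y hX hY hXd hYd z hz
      have hUz := hU.mem_nhds hz
      exact OrbitBundle.mlieBracket_mem_distribution hincl hsmul hcov hcomp hρ (hinj z) (hRT z)
        ((hX.contMDiffAt hUz).mdifferentiableAt (by simp))
        ((hY.contMDiffAt hUz).mdifferentiableAt (by simp))
        (Filter.eventually_of_mem hUz hXd) (Filter.eventually_of_mem hUz hYd)
  refine ⟨hiff, fun hT hint z e₁ h₁ e₂ h₂ e₃ h₃ ↦ ?_⟩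
  have hR := (hiff.1 hint z).1
  -- Each summand is in `p` by (ii), so it is enough that `ρ` kills the sum.
  apply hinj z (add_mem (add_mem (hR _ h₁ _ h₂ _ h₃) (hR _ h₂ _ h₃ _ h₁)) (hR _ h₃ _ h₁ _ h₂))
    (zero_mem _)
  rw [map_zero]
  exact P.anchor_cyclic_curvature_eq_zero hcov hρ hT z.proj e₁ e₂ e₃
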